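/- **Theorem ($(1\pm\epsilon)$-distortion embedding for $\ell_1$).** There are a randomized algorithm, a constant $C>0$ and a polynomial $p(d)=d^k$ ($C$ and $k$ absolute) such that the following holds for all integers $n\ge 2$, $d\ge 1$, every $A\in\mathbb R^{n\times d}$ with full column rank, and every $\epsilon\in(0,1)$. Let $\operatorname{nnz}(A)$ be the number of nonzero entries of $A$. Given $n$, $d$, $\epsilon$ and the list of the nonzero entries of $A$ with their row and column indices, in any order, the algorithm always halts after at most $C\cdot \operatorname{nnz}(A)\cdot\log n$ steps and outputs a sampling matrix $S\in\mathbb R^{s\times n}$, that is, a matrix with exactly one nonzero entry in each row (given by the column index and the value of that entry), where $$ s\;\le\; C\,d^k\,\frac{\log(2/\epsilon)}{\epsilon^2}, \qquad\text{i.e. } s=O\big(\mathrm{poly}(d)\log(1/\epsilon)/\epsilon^2\big). $$ With probability at least $2/3$ over the random choices of the algorithm, $S$ embeds the $\ell_1$ column space of $A$ with distortion $1\pm\epsilon$: $$ (1-\epsilon)\,\|Ax\|_1\;\le\;\|SAx\|_1\;\le\;(1+\epsilon)\,\|Ax\|_1\qquad\text{for all }x\in\mathbb R^d . $$ Here an algorithm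 is a single program for a unit-cost random-access machine with natural-number and exact real variables and arrays (initially zero apart from the input), with addition, subtraction, multiplication and comparison on naturals, $+,-,\times,\div,\sqrt{\cdot}$ and comparison on reals, and unit-cost draws of uniform numbers in $[0,1]$, of uniform integers in $\{0,\dots,m-1\}$, and of standard Cauchy numbers. -/

import Mathlib

open MeasureTheory

/-! ### A randomized real RAM

Programs are finite pieces of syntax over natural-number variables, real variables, and
random-access arrays of naturals and of reals; variables and arrays are named by numerals.
Every operation has unit cost. Reals are exact, and there is no way to convert a real into a
natural number (no floor). Random numbers are drawn at unit cost. -/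

namespace RealRAM

/-- Natural-number expressions. `read a i` is the entry `i` of the natural-number array `a`;
`sub` is truncated subtraction. -/
inductive NExp : Type
  | const (c : ℕ)
  | var (x : ℕ)
  | add (e f : NExp)
  | sub (e f : NExp)
  | mul (e f : NExp)
  | read (a : ℕ) (i : NExp)

/-- Real expressions. `ofNat` turns a natural number into a real; `read a i` is the entry `i` of
the real array `a`. -/
inductive RExp : Type
  | ofNat (e : NExp)
  | var (x : ℕ)
  | add (e f : RExp)
  | sub (e f : RExp)
  | mul (e f : RExp)
  | div (e f : RExp)
  | sqrt (e : RExp)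
  | read (a : ℕ) (i : NExp)

/-- Tests: strict comparison of naturals or of reals, and Boolean combinations. -/
inductive BExp : Type
  | nlt (e f : NExp)
  | rlt (e f : RExp)
  | not (b : BExp)
  | and (b c : BExp)

/-- Programs. -/
inductive Cmd : Type
  | skip
  | seq (c c' : Cmd)
  | ite (b : BExp) (c c' : Cmd)
  | while (b : BExp) (c : Cmd)
  /-- natural variable `x := e` -/
  | nset (x : ℕ) (e : NExp)
  /-- real variable `x := e` -/
  | rset (x : ℕ) (e : RExp)
  /-- natural array entry `a[i] := e` -/
  | nstore (a : ℕ) (i e : NExp)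
  /-- real array entry `a[i] := e` -/
  | rstore (a : ℕ) (i : NExp) (e : RExp)
  /-- real variable `x :=` a fresh uniform random number in `[0,1]` -/
  | drawUniform (x : ℕ)
  /-- real variable `x :=` a fresh standard Cauchy random number -/
  | drawCauchy (x : ℕ)
  /-- natural variable `x :=` a fresh uniform random element of `{0, …, e - 1}` -/
  | drawBelow (x : ℕ) (e : NExp)

/-- Memory contents, together with the number `pos` of random draws made so far. -/
@[ext] structure State : Type where
  nvar : ℕ → ℕ
  rvar : ℕ → ℝ
  narr : ℕ → ℕ → ℕ
  rarr : ℕ → ℕ → ℝ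
  pos : ℕ

def NExp.eval (σ : State) : NExp → ℕ
  | .const c => c
  | .var x => σ.nvar x
  | .add e f => e.eval σ + f.eval σ
  | .sub e f => e.eval σ - f.eval σ
  | .mul e f => e.eval σ * f.eval σ
  | .read a i => σ.narr a (i.eval σ)

noncomputable def RExp.eval (σ : State) : RExp → ℝ
  | .ofNat e => (e.eval σ : ℝ)
  | .var x => σ.rvar x
  | .add e f => e.eval σ + f.eval σ
  | .sub e f => e.eval σ - f.eval σ
  | .mul e f => e.eval σ * f.eval σ
  | .div e f => e.eval σ / f.eval σ
  | .sqrt e => Real.sqrt (e.eval σ)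
  | .read a i => σ.rarr a (i.eval σ)

def BExp.holds (σ : State) : BExp → Prop
  | .nlt e f => e.eval σ < f.eval σ
  | .rlt e f => e.eval σ < f.eval σ
  | .not b => ¬ b.holds σ
  | .and b c => b.holds σ ∧ c.holds σ

/-- The cost of an expression is the number of its nodes. -/
def NExp.cost : NExp → ℕ
  | .const _ => 1
  | .var _ => 1
  | .add e f => e.cost + f.cost + 1
  | .sub e f => e.cost + f.cost + 1
  | .mul e f => e.cost + f.cost + 1
  | .read _ i => i.cost + 1

def RExp.cost : RExp → ℕ
  | .ofNat e => e.cost + 1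
  | .var _ => 1
  | .add e f => e.cost + f.cost + 1
  | .sub e f => e.cost + f.cost + 1
  | .mul e f => e.cost + f.cost + 1
  | .div e f => e.cost + f.cost + 1
  | .sqrt e => e.cost + 1
  | .read _ i => i.cost + 1

def BExp.cost : BExp → ℕ
  | .nlt e f => e.cost + f.cost + 1
  | .rlt e f => e.cost + f.cost + 1
  | .not b => b.cost + 1
  | .and b c => b.cost + c.cost + 1

/-- The source of randomness: an infinite sequence of numbers in `[0,1]`; each draw consumes the
next one. -/
abbrev Tape : Type := ℕ → unitInterval

/-- The entries of the tape are independent and uniform on `[0,1]`. -/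
noncomputable def tapeMeasure : Measure Tape :=
  Measure.infinitePi (fun _ : ℕ => (volume : Measure unitInterval))

/-- A standard Cauchy number from a uniform one, by inversion of the distribution function. -/
noncomputable def cauchyOf (u : unitInterval) : ℝ := Real.tan (Real.pi * ((u : ℝ) - 1 / 2))

/-- A uniform element of `{0, …, m - 1}` from a uniform number in `[0,1]`; the minimum only
matters for the null event `u = 1` and for `m = 0`, where the value is `0`. -/
noncomputable def belowOf (m : ℕ) (u : unitInterval) : ℕ := min ⌊(m : ℝ) * (u : ℝ)⌋₊ (m - 1)

def State.setN (σ : State) (x v : ℕ) : State :=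
  { σ with nvar := Function.update σ.nvar x v }

def State.setR (σ : State) (x : ℕ) (v : ℝ) : State :=
  { σ with rvar := Function.update σ.rvar x v }

def State.storeN (σ : State) (a i v : ℕ) : State :=
  { σ with narr := Function.update σ.narr a (Function.update (σ.narr a) i v) }

def State.storeR (σ : State) (a i : ℕ) (v : ℝ) : State :=
  { σ with rarr := Function.update σ.rarr a (Function.update (σ.rarr a) i v) }

/-- Move on to the next entry of the tape. -/
def State.advance (σ : State) : State := { σ with pos := σ.pos + 1 }

/-- `Exec ω c σ t τ`: on the tape `ω`, the program `c` started in `σ` halts in `τ` after exactly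
`t` steps. -/
inductive Exec (ω : Tape) : Cmd → State → ℕ → State → Prop
  | skip (σ : State) : Exec ω .skip σ 1 σ
  | seq {c c' : Cmd} {σ σ' σ'' : State} {t t' : ℕ} :
      Exec ω c σ t σ' → Exec ω c' σ' t' σ'' → Exec ω (.seq c c') σ (t + t') σ''
  | iteTrue {b : BExp} {c c' : Cmd} {σ σ' : State} {t : ℕ} :
      b.holds σ → Exec ω c σ t σ' → Exec ω (.ite b c c') σ (b.cost + 1 + t) σ'
  | iteFalse {b : BExp} {c c' : Cmd} {σ σ' : State} {t : ℕ} :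
      ¬ b.holds σ → Exec ω c' σ t σ' → Exec ω (.ite b c c') σ (b.cost + 1 + t) σ'
  | whileFalse {b : BExp} {c : Cmd} {σ : State} :
      ¬ b.holds σ → Exec ω (.while b c) σ (b.cost + 1) σ
  | whileTrue {b : BExp} {c : Cmd} {σ σ' σ'' : State} {t t' : ℕ} :
      b.holds σ → Exec ω c σ t σ' → Exec ω (.while b c) σ' t' σ'' →
      Exec ω (.while b c) σ (b.cost + 1 + t + t') σ''
  | nset (x : ℕ) (e : NExp) (σ : State) :
      Exec ω (.nset x e) σ (e.cost + 1) (σ.setN x (e.eval σ))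
  | rset (x : ℕ) (e : RExp) (σ : State) :
      Exec ω (.rset x e) σ (e.cost + 1) (σ.setR x (e.eval σ))
  | nstore (a : ℕ) (i e : NExp) (σ : State) :
      Exec ω (.nstore a i e) σ (i.cost + e.cost + 1) (σ.storeN a (i.eval σ) (e.eval σ))
  | rstore (a : ℕ) (i : NExp) (e : RExp) (σ : State) :
      Exec ω (.rstore a i e) σ (i.cost + e.cost + 1) (σ.storeR a (i.eval σ) (e.eval σ))
  | drawUniform (x : ℕ) (σ : State) :
      Exec ω (.drawUniform x) σ 1 ((σ.setR x (ω σ.pos : ℝ)).advance)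
  | drawCauchy (x : ℕ) (σ : State) :
      Exec ω (.drawCauchy x) σ 1 ((σ.setR x (cauchyOf (ω σ.pos))).advance)
  | drawBelow (x : ℕ) (e : NExp) (σ : State) :
      Exec ω (.drawBelow x e) σ (e.cost + 1)
        ((σ.setN x (belowOf (e.eval σ) (ω σ.pos))).advance)

/-- On a given tape, the running time and the final state are determined by the program and the
initial state. -/
theorem Exec.unique {ω : Tape} {c : Cmd} {σ τ τ' : State} {t t' : ℕ}
    (h : Exec ω c σ t τ) (h' : Exec ω c σ t' τ') : t = t' ∧ τ = τ' := by
  induction h generalizing t' τ' with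
  | seq _ _ ih₁ ih₂ =>
    cases h' with
    | seq k₁ k₂ =>
      obtain ⟨rfl, rfl⟩ := ih₁ k₁
      obtain ⟨rfl, rfl⟩ := ih₂ k₂
      exact ⟨rfl, rfl⟩
  | iteTrue hb _ ih =>
    cases h' with
    | iteTrue _ k =>
      obtain ⟨rfl, rfl⟩ := ih k
      exact ⟨rfl, rfl⟩
    | iteFalse hb' _ => exact absurd hb hb'
  | iteFalse hb _ ih =>
    cases h' with
    | iteTrue hb' _ => exact absurd hb' hb
    | iteFalse _ k =>
      obtain ⟨rfl, rfl⟩ := ih k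
      exact ⟨rfl, rfl⟩
  | whileFalse hb =>
    cases h' with
    | whileFalse _ => exact ⟨rfl, rfl⟩
    | whileTrue hb' _ _ => exact absurd hb' hb
  | whileTrue hb _ _ ih₁ ih₂ =>
    cases h' with
    | whileFalse hb' => exact absurd hb hb'
    | whileTrue _ k₁ k₂ =>
      obtain ⟨rfl, rfl⟩ := ih₁ k₁
      obtain ⟨rfl, rfl⟩ := ih₂ k₂
      exact ⟨rfl, rfl⟩
  | _ => cases h'; exact ⟨rfl, rfl⟩

end RealRAM

/-! ### Sparse matrices as inputs, sampling matrices as outputs -/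

/-- The positions of the nonzero entries of a matrix. -/
abbrev SupportPos {n d : ℕ} (A : Matrix (Fin n) (Fin d) ℝ) : Type :=
  {p : Fin n × Fin d // A p.1 p.2 ≠ 0}

/-- The number of nonzero entries of a matrix. -/
noncomputable def nnz {n d : ℕ} (A : Matrix (Fin n) (Fin d) ℝ) : ℕ := Nat.card (SupportPos A)

/-- The initial state that presents `A` in coordinate format, its nonzero entries being listed in
the order given by `e`, together with `ε`: the natural variables `0, 1, 2` hold `n`, `d` and
`nnz A`, the real variable `0` holds `ε`, and the `t`-th nonzero entry has its row index in the
natural array `0`, its column index in the natural array `1` and its value in the real array `0`.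
All other memory is zero. -/
noncomputable def inputState {n d : ℕ} (A : Matrix (Fin n) (Fin d) ℝ)
    (e : Fin (nnz A) ≃ SupportPos A) (ε : ℝ) : RealRAM.State where
  nvar x := if x = 0 then n else if x = 1 then d else if x = 2 then nnz A else 0
  rvar x := if x = 0 then ε else 0
  narr a t :=
    if h : t < nnz A then
      if a = 0 then ((e ⟨t, h⟩).1.1 : ℕ) else if a = 1 then ((e ⟨t, h⟩).1.2 : ℕ) else 0
    else 0
  rarr a t :=
    if h : t < nnz A then
      if a = 0 then A (e ⟨t, h⟩).1.1 (e ⟨t, h⟩).1.2 else 0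
    else 0
  pos := 0

/-- The number of rows of the matrix that a final state describes (natural variable `3`). -/
def outputRows (σ : RealRAM.State) : ℕ := σ.nvar 3

/-- The matrix with `n` columns that a final state describes: row `t` has the entry `t` of the
real array `1` in the column whose index is the entry `t` of the natural array `2`, and zeros
elsewhere. -/
def outputMatrix (n : ℕ) (σ : RealRAM.State) : Matrix (Fin (outputRows σ)) (Fin n) ℝ :=
  fun t i => if (i : ℕ) = σ.narr 2 t then σ.rarr 1 t else 0

/-- A sampling matrix: exactly one nonzero entry in each row. -/
def IsSamplingMatrix {s n : ℕ} (S : Matrix (Fin s) (Fin n) ℝ) : Prop :=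
  ∀ t : Fin s, ∃! i : Fin n, S t i ≠ 0

/-- The `ℓ₁` norm on `ℝᵐ`. -/
noncomputable def l1Norm {m : ℕ} (v : Fin m → ℝ) : ℝ :=
  ‖(WithLp.toLp 1 v : PiLp 1 (fun _ : Fin m => ℝ))‖

/-- `S` embeds the `ℓ₁` subspace spanned by the columns of `A` with distortion `1 ± ε`. -/
def EmbedsL1 {s n d : ℕ} (S : Matrix (Fin s) (Fin n) ℝ) (A : Matrix (Fin n) (Fin d) ℝ)
    (ε : ℝ) : Prop :=
  ∀ x : Fin d → ℝ,
    (1 - ε) * l1Norm (A.mulVec x) ≤ l1Norm (S.mulVec (A.mulVec x)) ∧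
      l1Norm (S.mulVec (A.mulVec x)) ≤ (1 + ε) * l1Norm (A.mulVec x)

/-! The embedding comes from sampling rows with probability roughly proportional to upper bounds for
their ℓ₁ sensitivities, meaning the largest share of ‖Ax‖₁ that one row can have. The difficulty is
to obtain such bounds in time O(nnz · log n) with no loss polynomial in d. If nnz(A) is smaller than
the target size s ~ d⁷ log(1/ε)/ε², all nonempty rows are output and the embedding is exact.
Otherwise d² ≤ s ≤ nnz(A), and costs of order d² per round are affordable.

A random set S contains each of the R nonempty rows with probability 1/d², so dense work of d² per
row of S costs only O(R). On S the Lewis iteration w ↦ √(leverage) is run: it keeps `Dominating` and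
takes the total weight W to at most √(dW) (`Dominating.step`), so about log R rounds bring it to 4d.
The result is a basis of ℝᵈ in which the ℓ₁ norm of S is Euclidean up to a factor 2√d, apart from
null directions (`IsRounding`).

The products of every row with O(log R) random 0-1 combinations of the basis vectors yield an
estimate u of its sensitivity. With high probability |a · x| ≤ 2du‖Ax‖₁ (`IsRounding.abs_dot_le`),
and always u ≤ 3d · sens(S ∪ {a}, a) (`IsEstimate.le_sens`). A leave-one-out argument bounds the
total: the expectation of the sum over all rows of sens(S ∪ {a}, a) is d² times the expectation of
the sum over S of sens(S, a), and the latter sum is at most 4d (`leave_one_out`, `sum_sens_le`). By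
Markov the estimates sum to at most 240d⁴, except with small probability.

Non-uniform sampling is done by integers only: 2R copies are distributed greedily over the rows in
proportion to the estimates (`makeCopies_runs`), and copies are drawn uniformly. A rescaled copy has
sensitivity O(d⁵)/M relative to the M = 2R copies, so a Chernoff bound at the points of a grid,
extended to all x by the rounding, gives the embedding (`card_not_embeds`).

All probabilities are counts over finite sets of drawn values. `Exec.transfer` and
`Runs.exists_final` make final states functions of these values, and `tapeMeasure_three_stages`
turns the three counts, with failure rates 1/10, 1/20 and 1/20, into a bound for the tape measure.
-/

namespace RealRAM

/-! ### Which memory a program can change, and which draws it makes. -/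

namespace Cmd

/-- Does the program assign the natural variable `x`? -/
def wnv : Cmd → ℕ → Bool
  | .skip, _ => false
  | .seq c c', x => c.wnv x || c'.wnv x
  | .ite _ c c', x => c.wnv x || c'.wnv x
  | .while _ c, x => c.wnv x
  | .nset y _, x => x == y
  | .rset _ _, _ => false
  | .nstore _ _ _, _ => false
  | .rstore _ _ _, _ => false
  | .drawUniform _, _ => false
  | .drawCauchy _, _ => false
  | .drawBelow y _, x => x == y

/-- Does the program assign the real variable `x`? -/
def wrv : Cmd → ℕ → Bool
  | .skip, _ => false
  | .seq c c', x => c.wrv x || c'.wrv x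
  | .ite _ c c', x => c.wrv x || c'.wrv x
  | .while _ c, x => c.wrv x
  | .nset _ _, _ => false
  | .rset y _, x => x == y
  | .nstore _ _ _, _ => false
  | .rstore _ _ _, _ => false
  | .drawUniform y, x => x == y
  | .drawCauchy y, x => x == y
  | .drawBelow _ _, _ => false

/-- Does the program store into the natural array `x`? -/
def wna : Cmd → ℕ → Bool
  | .seq c c', x => c.wna x || c'.wna x
  | .ite _ c c', x => c.wna x || c'.wna x
  | .while _ c, x => c.wna x
  | .nstore y _ _, x => x == y
  | _, _ => false

/-- Does the program store into the real array `x`? -/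
def wra : Cmd → ℕ → Bool
  | .seq c c', x => c.wra x || c'.wra x
  | .ite _ c c', x => c.wra x || c'.wra x
  | .while _ c, x => c.wra x
  | .rstore y _ _, x => x == y
  | _, _ => false

/-- Does the program draw random numbers? -/
def draws : Cmd → Bool
  | .seq c c' => c.draws || c'.draws
  | .ite _ c c' => c.draws || c'.draws
  | .while _ c => c.draws
  | .drawUniform _ => true
  | .drawCauchy _ => true
  | .drawBelow _ _ => true
  | _ => false

/-- All random draws of the program are of the form `drawBelow _ (var y)`. -/
def drawsOnly (y : ℕ) : Cmd → Bool
  | .seq c c' => c.drawsOnly y && c'.drawsOnly y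
  | .ite _ c c' => c.drawsOnly y && c'.drawsOnly y
  | .while _ c => c.drawsOnly y
  | .drawUniform _ => false
  | .drawCauchy _ => false
  | .drawBelow _ (.var z) => z == y
  | .drawBelow _ _ => false
  | _ => true

end Cmd

/-- `τ` agrees with `σ` on all memory that `c` does not write. -/
structure Frame (c : Cmd) (σ τ : State) : Prop where
  nvar : ∀ x, c.wnv x = false → τ.nvar x = σ.nvar x
  rvar : ∀ x, c.wrv x = false → τ.rvar x = σ.rvar x
  narr : ∀ x, c.wna x = false → τ.narr x = σ.narr x
  rarr : ∀ x, c.wra x = false → τ.rarr x = σ.rarr x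
  pos : c.draws = false → τ.pos = σ.pos

theorem Frame.refl (c : Cmd) (σ : State) : Frame c σ σ :=
  ⟨fun _ _ => rfl, fun _ _ => rfl, fun _ _ => rfl, fun _ _ => rfl, fun _ => rfl⟩

theorem Frame.trans {c : Cmd} {σ τ υ : State} (h : Frame c σ τ) (h' : Frame c τ υ) :
    Frame c σ υ :=
  ⟨fun x hx => (h'.nvar x hx).trans (h.nvar x hx), fun x hx => (h'.rvar x hx).trans (h.rvar x hx),
    fun x hx => (h'.narr x hx).trans (h.narr x hx), fun x hx => (h'.rarr x hx).trans (h.rarr x hx),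
    fun hx => (h'.pos hx).trans (h.pos hx)⟩

theorem Frame.mono {c c' : Cmd} {σ τ : State} (h : Frame c σ τ)
    (h1 : ∀ x, c'.wnv x = false → c.wnv x = false) (h2 : ∀ x, c'.wrv x = false → c.wrv x = false)
    (h3 : ∀ x, c'.wna x = false → c.wna x = false) (h4 : ∀ x, c'.wra x = false → c.wra x = false)
    (h5 : c'.draws = false → c.draws = false) : Frame c' σ τ :=
  ⟨fun x hx => h.nvar x (h1 x hx), fun x hx => h.rvar x (h2 x hx), fun x hx => h.narr x (h3 x hx),
    fun x hx => h.rarr x (h4 x hx), fun hx => h.pos (h5 hx)⟩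

theorem Frame.seq {c c' : Cmd} {σ τ υ : State} (h : Frame c σ τ) (h' : Frame c' τ υ) :
    Frame (.seq c c') σ υ := by
  refine Frame.trans (h.mono ?_ ?_ ?_ ?_ ?_) (h'.mono ?_ ?_ ?_ ?_ ?_) <;>
    simp +contextual [Cmd.wnv, Cmd.wrv, Cmd.wna, Cmd.wra, Cmd.draws]

/-- The write sets are computable Booleans, so later on every claim that some memory is untouched is
discharged by `rfl`. -/
theorem Exec.frame {ω : Tape} {c : Cmd} {σ τ : State} {t : ℕ} (h : Exec ω c σ t τ) :
    Frame c σ τ := by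
  induction h with
  | skip σ => exact Frame.refl _ _
  | seq _ _ ih ih' => exact ih.seq ih'
  | iteTrue _ _ ih =>
    refine ih.mono ?_ ?_ ?_ ?_ ?_ <;>
      simp +contextual [Cmd.wnv, Cmd.wrv, Cmd.wna, Cmd.wra, Cmd.draws]
  | iteFalse _ _ ih =>
    refine ih.mono ?_ ?_ ?_ ?_ ?_ <;>
      simp +contextual [Cmd.wnv, Cmd.wrv, Cmd.wna, Cmd.wra, Cmd.draws]
  | whileFalse _ => exact Frame.refl _ _
  | whileTrue _ _ _ ih ih' =>
    refine Frame.trans (ih.mono ?_ ?_ ?_ ?_ ?_) ih' <;>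
      simp +contextual [Cmd.wnv, Cmd.wrv, Cmd.wna, Cmd.wra, Cmd.draws]
  | _ =>
    constructor <;>
    simp +contextual [Cmd.wnv, Cmd.wrv, Cmd.wna, Cmd.wra, Cmd.draws, State.setN, State.setR,
      State.storeN, State.storeR, State.advance]

theorem Exec.pos_le {ω : Tape} {c : Cmd} {σ τ : State} {t : ℕ} (h : Exec ω c σ t τ) :
    σ.pos ≤ τ.pos := by
  induction h with
  | seq _ _ ih ih' => exact ih.trans ih'
  | iteTrue _ _ ih => exact ih
  | iteFalse _ _ ih => exact ih
  | whileTrue _ _ _ ih ih' => exact ih.trans ih'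
  | _ => simp [State.setN, State.setR, State.storeN, State.storeR, State.advance]

/-- A run whose draws are all below a fixed modulus depends on the tape only through the drawn
values. -/
theorem Exec.transfer {ω ω' : Tape} {c : Cmd} {σ τ : State} {t y m : ℕ} (h : Exec ω c σ t τ)
    (hd : c.drawsOnly y = true) (hw : c.wnv y = false) (hm : σ.nvar y = m)
    (hag : ∀ p, σ.pos ≤ p → p < τ.pos → belowOf m (ω p) = belowOf m (ω' p)) :
    Exec ω' c σ t τ := by
  induction h with
  | skip σ => exact Exec.skip σ
  | seq h h' ih ih' =>
    simp only [Cmd.drawsOnly, Bool.and_eq_true, Cmd.wnv, Bool.or_eq_false_iff] at hd hw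
    refine Exec.seq (ih hd.1 hw.1 hm fun p hp hp' => hag p hp (hp'.trans_le h'.pos_le))
      (ih' hd.2 hw.2 ((h.frame.nvar y hw.1).trans hm) fun p hp hp' => hag p (h.pos_le.trans hp) hp')
  | iteTrue hb _ ih =>
    simp only [Cmd.drawsOnly, Bool.and_eq_true, Cmd.wnv, Bool.or_eq_false_iff] at hd hw
    exact Exec.iteTrue hb (ih hd.1 hw.1 hm hag)
  | iteFalse hb _ ih =>
    simp only [Cmd.drawsOnly, Bool.and_eq_true, Cmd.wnv, Bool.or_eq_false_iff] at hd hw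
    exact Exec.iteFalse hb (ih hd.2 hw.2 hm hag)
  | whileFalse hb => exact Exec.whileFalse hb
  | whileTrue hb h h' ih ih' =>
    have hd' := hd
    have hw' := hw
    simp only [Cmd.drawsOnly, Cmd.wnv] at hd hw
    refine Exec.whileTrue hb (ih hd hw hm fun p hp hp' => hag p hp (hp'.trans_le h'.pos_le))
      (ih' hd' hw' ((h.frame.nvar y hw).trans hm) fun p hp hp' => hag p (h.pos_le.trans hp) hp')
  | nset x e σ => exact Exec.nset x e σ
  | rset x e σ => exact Exec.rset x e σ
  | nstore a i e σ => exact Exec.nstore a i e σ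
  | rstore a i e σ => exact Exec.rstore a i e σ
  | drawUniform x σ => simp [Cmd.drawsOnly] at hd
  | drawCauchy x σ => simp [Cmd.drawsOnly] at hd
  | drawBelow x e σ =>
    cases e with
    | var z =>
      simp only [Cmd.drawsOnly, beq_iff_eq] at hd
      subst hd
      have := hag σ.pos le_rfl (by simp [State.setN, State.advance])
      have e1 : (NExp.var z).eval σ = m := hm
      have h2 := Exec.drawBelow (ω := ω') x (.var z) σ
      rw [e1, ← this, ← e1] at h2
      exact h2
    | _ => simp [Cmd.drawsOnly] at hd

/-! ### A logic for total correctness with time bounds. -/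

/-- Execution of loop-free programs as a function on states. -/
noncomputable def Cmd.run (ω : Tape) : Cmd → State → State
  | .skip, σ => σ
  | .seq c c', σ => c'.run ω (c.run ω σ)
  | .ite b c c', σ => open Classical in if b.holds σ then c.run ω σ else c'.run ω σ
  | .while _ _, σ => σ
  | .nset x e, σ => σ.setN x (e.eval σ)
  | .rset x e, σ => σ.setR x (e.eval σ)
  | .nstore a i e, σ => σ.storeN a (i.eval σ) (e.eval σ)
  | .rstore a i e, σ => σ.storeR a (i.eval σ) (e.eval σ)
  | .drawUniform x, σ => (σ.setR x (ω σ.pos : ℝ)).advance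
  | .drawCauchy x, σ => (σ.setR x (cauchyOf (ω σ.pos))).advance
  | .drawBelow x e, σ => (σ.setN x (belowOf (e.eval σ) (ω σ.pos))).advance

/-- Loop-free programs. -/
def Cmd.loopFree : Cmd → Bool
  | .seq c c' => c.loopFree && c'.loopFree
  | .ite _ c c' => c.loopFree && c'.loopFree
  | .while _ _ => false
  | _ => true

/-- A bound for the running time of loop-free programs. -/
def Cmd.steps : Cmd → ℕ
  | .skip => 1
  | .seq c c' => c.steps + c'.steps
  | .ite b c c' => b.cost + 1 + (c.steps + c'.steps)
  | .while _ _ => 0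
  | .nset _ e => e.cost + 1
  | .rset _ e => e.cost + 1
  | .nstore _ i e => i.cost + e.cost + 1
  | .rstore _ i e => i.cost + e.cost + 1
  | .drawUniform _ => 1
  | .drawCauchy _ => 1
  | .drawBelow _ e => e.cost + 1

theorem Exec.of_loopFree (ω : Tape) {c : Cmd} (hc : c.loopFree = true) (σ : State) :
    ∃ t, Exec ω c σ t (c.run ω σ) ∧ t ≤ c.steps := by
  induction c generalizing σ with
  | skip => exact ⟨_, Exec.skip σ, le_rfl⟩
  | seq c c' ih ih' =>
    simp only [Cmd.loopFree, Bool.and_eq_true] at hc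
    obtain ⟨t, h, ht⟩ := ih hc.1 σ
    obtain ⟨t', h', ht'⟩ := ih' hc.2 (c.run ω σ)
    exact ⟨_, Exec.seq h h', add_le_add ht ht'⟩
  | ite b c c' ih ih' =>
    simp only [Cmd.loopFree, Bool.and_eq_true] at hc
    obtain ⟨t, h, ht⟩ := ih hc.1 σ
    obtain ⟨t', h', ht'⟩ := ih' hc.2 σ
    by_cases hb : b.holds σ
    · refine ⟨b.cost + 1 + t, ?_, ?_⟩
      · rw [Cmd.run, if_pos hb]; exact Exec.iteTrue hb h
      · simp only [Cmd.steps]; omega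
    · refine ⟨b.cost + 1 + t', ?_, ?_⟩
      · rw [Cmd.run, if_neg hb]; exact Exec.iteFalse hb h'
      · simp only [Cmd.steps]; omega
  | nset x e => exact ⟨_, Exec.nset x e σ, le_rfl⟩
  | rset x e => exact ⟨_, Exec.rset x e σ, le_rfl⟩
  | nstore a i e => exact ⟨_, Exec.nstore a i e σ, le_rfl⟩
  | rstore a i e => exact ⟨_, Exec.rstore a i e σ, le_rfl⟩
  | drawUniform x => exact ⟨_, Exec.drawUniform x σ, le_rfl⟩
  | drawCauchy x => exact ⟨_, Exec.drawCauchy x σ, le_rfl⟩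
  | drawBelow x e => exact ⟨_, Exec.drawBelow x e σ, le_rfl⟩
  | _ => simp [Cmd.loopFree] at hc

/-- `c` started in `σ` halts within `B` steps in a state that satisfies `Q`. -/
def Runs (ω : Tape) (c : Cmd) (σ : State) (B : ℕ) (Q : State → Prop) : Prop :=
  ∃ t τ, Exec ω c σ t τ ∧ t ≤ B ∧ Q τ

theorem Runs.mono {ω : Tape} {c : Cmd} {σ : State} {B B' : ℕ} {Q Q' : State → Prop}
    (h : Runs ω c σ B Q) (hB : B ≤ B') (hQ : ∀ τ, Frame c σ τ → Q τ → Q' τ) :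
    Runs ω c σ B' Q' := by
  obtain ⟨t, τ, he, ht, hq⟩ := h
  exact ⟨t, τ, he, ht.trans hB, hQ τ he.frame hq⟩

theorem Runs.seq {ω : Tape} {c c' : Cmd} {σ : State} {B B' : ℕ} {P Q : State → Prop}
    (h : Runs ω c σ B P) (h' : ∀ τ, Frame c σ τ → P τ → Runs ω c' τ B' Q) :
    Runs ω (.seq c c') σ (B + B') Q := by
  obtain ⟨t, τ, he, ht, hp⟩ := h
  obtain ⟨t', τ', he', ht', hq⟩ := h' τ he.frame hp
  exact ⟨_, τ', Exec.seq he he', add_le_add ht ht', hq⟩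

theorem Runs.of_loopFree {ω : Tape} {c : Cmd} {σ : State} {B : ℕ} {Q : State → Prop}
    (hc : c.loopFree = true) (hB : c.steps ≤ B) (hQ : Q (c.run ω σ)) : Runs ω c σ B Q := by
  obtain ⟨t, h, ht⟩ := Exec.of_loopFree ω hc σ
  exact ⟨t, _, h, ht.trans hB, hQ⟩

theorem Runs.ite {ω : Tape} {b : BExp} {c c' : Cmd} {σ : State} {B : ℕ} {Q : State → Prop}
    (h : b.holds σ → Runs ω c σ B Q) (h' : ¬ b.holds σ → Runs ω c' σ B Q) :
    Runs ω (.ite b c c') σ (b.cost + 1 + B) Q := by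
  by_cases hb : b.holds σ
  · obtain ⟨t, τ, he, ht, hq⟩ := h hb
    exact ⟨_, τ, Exec.iteTrue hb he, by omega, hq⟩
  · obtain ⟨t, τ, he, ht, hq⟩ := h' hb
    exact ⟨_, τ, Exec.iteFalse hb he, by omega, hq⟩

/-- `for i in {0, …, e - 1}: body`. -/
def Cmd.forN (i : ℕ) (e : NExp) (body : Cmd) : Cmd :=
  .seq (.nset i (.const 0))
    (.while (.nlt (.var i) e) (.seq body (.nset i (.add (.var i) (.const 1)))))

/-- The invariant for the next index must hold after the counter has been advanced, which is why
`setN` occurs in it. The frame hypothesis handed to the body lets an invariant mention only memory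
that the loop writes. -/
theorem Runs.forN {ω : Tape} {i : ℕ} {e : NExp} {body : Cmd} {σ : State} {N B : ℕ}
    {Inv : ℕ → State → Prop} (hbody : body.wnv i = false)
    (he : ∀ τ, Frame (.forN i e body) σ τ → e.eval τ = N)
    (h0 : Inv 0 (σ.setN i 0))
    (hs : ∀ k < N, ∀ τ, Frame (.forN i e body) σ τ → τ.nvar i = k → Inv k τ →
      Runs ω body τ B (fun τ' => Inv (k + 1) (τ'.setN i (k + 1)))) :
    Runs ω (.forN i e body) σ (e.cost + 5 + N * (e.cost + 7 + B)) (Inv N) := by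
  have hset : Exec ω (.nset i (.const 0)) σ 2 (σ.setN i 0) := Exec.nset i (.const 0) σ
  -- Induction on the number `j` of remaining rounds.
  have key : ∀ j k, k + j = N → ∀ τ, Frame (.forN i e body) σ τ → τ.nvar i = k → Inv k τ →
      Runs ω (.while (.nlt (.var i) e) (.seq body (.nset i (.add (.var i) (.const 1))))) τ
        (e.cost + 3 + j * (e.cost + 7 + B)) (Inv N) := by
    intro j
    induction j with
    | zero =>
      intro k hk τ hF hi hI
      refine ⟨_, τ, Exec.whileFalse ?_, ?_, ?_⟩
      · simp [BExp.holds, NExp.eval, he τ hF, hi]; omega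
      · simp [BExp.cost, NExp.cost]; omega
      · rwa [← hk]
    | succ j ih =>
      intro k hk τ hF hi hI
      obtain ⟨t, τ', h1, ht, hI'⟩ := hs k (by omega) τ hF hi hI
      have hi' : τ'.nvar i = k := (h1.frame.nvar i hbody).trans hi
      have h2 : Exec ω (.nset i (.add (.var i) (.const 1))) τ' 4 (τ'.setN i (k + 1)) := by
        have := Exec.nset (ω := ω) i (.add (.var i) (.const 1)) τ'
        simpa [NExp.eval, NExp.cost, hi'] using this
      have h3 := Exec.seq h1 h2
      have hF' : Frame (.forN i e body) σ (τ'.setN i (k + 1)) := by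
        refine hF.trans (h3.frame.mono ?_ ?_ ?_ ?_ ?_) <;>
          simp +contextual [Cmd.forN, Cmd.wnv, Cmd.wrv, Cmd.wna, Cmd.wra, Cmd.draws]
      obtain ⟨t', τ'', h4, ht', hq⟩ := ih (k + 1) (by omega) _ hF'
        (by simp [State.setN]) hI'
      refine ⟨_, τ'', Exec.whileTrue ?_ h3 h4, ?_, hq⟩
      · simp [BExp.holds, NExp.eval, he τ hF, hi]; omega
      · simp only [BExp.cost, NExp.cost]
        have : (j + 1) * (e.cost + 7 + B) = j * (e.cost + 7 + B) + (e.cost + 7 + B) := by ring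
        omega
  have hF0 : Frame (.forN i e body) σ (σ.setN i 0) := by
    refine hset.frame.mono ?_ ?_ ?_ ?_ ?_ <;>
      simp +contextual [Cmd.forN, Cmd.wnv, Cmd.wrv, Cmd.wna, Cmd.wra, Cmd.draws]
  obtain ⟨t, τ, h1, ht, hq⟩ := key N 0 (by omega) _ hF0 (by simp [State.setN]) h0
  exact ⟨_, τ, Exec.seq hset h1, by omega, hq⟩

/-- Initialise the real variable `x` to `0`, then `for i in {0, …, e - 1}: x := x + r`. -/
def Cmd.sumTo (x i : ℕ) (e : NExp) (r : RExp) : Cmd :=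
  .seq (.rset x (.ofNat (.const 0))) (.forN i e (.rset x (.add (.var x) r)))

/-- The postcondition determines the final state completely. Only the counter and the accumulator
change, so the bound and the summand need to be known only on such states. -/
theorem Runs.sumTo {ω : Tape} {x i : ℕ} {e : NExp} {r : RExp} {σ : State} {N : ℕ}
    (g : ℕ → ℝ)
    (he : ∀ k v, e.eval ((σ.setN i k).setR x v) = N)
    (hr : ∀ k < N, ∀ v, r.eval ((σ.setN i k).setR x v) = g k) :
    Runs ω (.sumTo x i e r) σ (e.cost + 8 + N * (e.cost + r.cost + 10))
      (fun τ => τ = (σ.setN i N).setR x (∑ k ∈ Finset.range N, g k)) := by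
  refine (Runs.seq (B := 3) (P := fun τ => τ = σ.setR x 0) (Runs.of_loopFree rfl le_rfl ?_)
    (fun τ _ hτ => Runs.forN (N := N) (B := r.cost + 3)
      (Inv := fun k τ => τ = (σ.setN i k).setR x (∑ k ∈ Finset.range k, g k))
      rfl ?_ ?_ ?_)).mono ?_ (fun τ _ h => h)
  · simp [Cmd.run, RExp.eval, NExp.eval]
  · intro τ' hF
    have : τ' = (σ.setN i (τ'.nvar i)).setR x (τ'.rvar x) := by
      subst hτ
      ext y z
      · by_cases hy : y = i
        · simp [hy, State.setN, State.setR]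
        · have := hF.nvar y (by simp [Cmd.wnv, Cmd.forN, hy])
          simpa [State.setN, State.setR, hy] using this
      · by_cases hy : y = x
        · simp [hy, State.setN, State.setR]
        · have := hF.rvar y (by simp [Cmd.wrv, Cmd.forN, hy])
          simpa [State.setN, State.setR, hy] using this
      · have := congrFun (hF.narr y (by simp [Cmd.wna, Cmd.forN])) z
        simpa [State.setN, State.setR] using this
      · have := congrFun (hF.rarr y (by simp [Cmd.wra, Cmd.forN])) z
        simpa [State.setN, State.setR] using this
      · simpa [State.setN, State.setR] using hF.pos rfl
    rw [this]; exact he _ _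
  · subst hτ; simp [State.setN, State.setR]
  · intro k hk τ' hF hi hI
    subst hI
    refine Runs.of_loopFree rfl (by simp [Cmd.steps, RExp.cost]; omega) ?_
    simp only [Cmd.run, RExp.eval, hr k hk, Finset.sum_range_succ]
    simp [State.setN, State.setR]
  · have : N * (e.cost + 7 + (r.cost + 3)) = N * (e.cost + r.cost + 10) := by ring
    omega

end RealRAM

/-! ### Frames and Lewis weights -/

/-- The inner product of the first `d` coordinates. -/
def dot (d : ℕ) (a x : ℕ → ℝ) : ℝ := ∑ l ∈ Finset.range d, a l * x l

/-- The linear combination with coefficients `y` of the vectors `F 0, …, F (d - 1)`. -/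
def comb (d : ℕ) (F : ℕ → ℕ → ℝ) (y : ℕ → ℝ) : ℕ → ℝ := fun l => ∑ k ∈ Finset.range d, y k * F k l

/-- The `ℓ₁` norm of the vector of inner products of the rows `a i`, `i ∈ S`, with `x`. -/
def rowNorm (d : ℕ) (a : ℕ → ℕ → ℝ) (S : Finset ℕ) (x : ℕ → ℝ) : ℝ := ∑ i ∈ S, |dot d (a i) x|

theorem dot_comb (d : ℕ) (a : ℕ → ℝ) (F : ℕ → ℕ → ℝ) (y : ℕ → ℝ) :
    dot d a (comb d F y) = ∑ k ∈ Finset.range d, y k * dot d a (F k) := by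
  simp only [dot, comb, Finset.mul_sum]
  rw [Finset.sum_comm]
  exact Finset.sum_congr rfl fun k _ => Finset.sum_congr rfl fun l _ => by ring

theorem dot_congr {d : ℕ} (a : ℕ → ℝ) {x x' : ℕ → ℝ} (h : ∀ l < d, x l = x' l) :
    dot d a x = dot d a x' :=
  Finset.sum_congr rfl fun l hl => by rw [h l (Finset.mem_range.1 hl)]

theorem dot_congr_left {d : ℕ} {a a' : ℕ → ℝ} (x : ℕ → ℝ) (h : ∀ l < d, a l = a' l) :
    dot d a x = dot d a' x :=
  Finset.sum_congr rfl fun l hl => by rw [h l (Finset.mem_range.1 hl)]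

theorem rowNorm_congr {d : ℕ} (a : ℕ → ℕ → ℝ) (S : Finset ℕ) {x x' : ℕ → ℝ}
    (h : ∀ l < d, x l = x' l) : rowNorm d a S x = rowNorm d a S x' :=
  Finset.sum_congr rfl fun i _ => by rw [dot_congr (a i) h]

theorem rowNorm_nonneg (d : ℕ) (a : ℕ → ℕ → ℝ) (S : Finset ℕ) (x : ℕ → ℝ) :
    0 ≤ rowNorm d a S x :=
  Finset.sum_nonneg fun _ _ => abs_nonneg _

theorem rowNorm_mono (d : ℕ) (a : ℕ → ℕ → ℝ) {S T : Finset ℕ} (h : S ⊆ T) (x : ℕ → ℝ) :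
    rowNorm d a S x ≤ rowNorm d a T x :=
  Finset.sum_le_sum_of_subset_of_nonneg h fun _ _ _ => abs_nonneg _

theorem abs_dot_le_rowNorm (d : ℕ) (a : ℕ → ℕ → ℝ) {S : Finset ℕ} {i : ℕ} (h : i ∈ S)
    (x : ℕ → ℝ) : |dot d (a i) x| ≤ rowNorm d a S x :=
  Finset.single_le_sum (f := fun i => |dot d (a i) x|) (fun _ _ => abs_nonneg _) h

/-- The vectors `F k` span, and in the coordinates that they define the quadratic form
`∑ i ∈ S, (a i · x) ^ 2 / w i` is the sum of the squares of the coordinates in `J`. -/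
structure IsFrame (d : ℕ) (a : ℕ → ℕ → ℝ) (S : Finset ℕ) (w : ℕ → ℝ) (F : ℕ → ℕ → ℝ)
    (J : Finset ℕ) : Prop where
  sub : J ⊆ Finset.range d
  spans : ∀ x : ℕ → ℝ, ∃ y, ∀ l < d, x l = comb d F y l
  quad : ∀ y, ∑ i ∈ S, dot d (a i) (comb d F y) ^ 2 / w i = ∑ k ∈ J, y k ^ 2

namespace IsFrame

variable {d : ℕ} {a : ℕ → ℕ → ℝ} {S : Finset ℕ} {w : ℕ → ℝ} {F F' : ℕ → ℕ → ℝ} {J J' : Finset ℕ}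

theorem empty (hF : ∀ k < d, ∀ l < d, F k l = if k = l then 1 else 0) :
    IsFrame d a ∅ w F ∅ where
  sub := Finset.empty_subset _
  spans x := by
    refine ⟨x, fun l hl => ?_⟩
    rw [comb, Finset.sum_eq_single l]
    · simp [hF l hl l hl]
    · intro k hk hkl; simp [hF k (Finset.mem_range.1 hk) l hl, hkl]
    · intro h; exact absurd (Finset.mem_range.2 hl) h
  quad y := by simp

/-- Passing from F to (1 - μcᵀ)F replaces the coordinates y by (1 - cμᵀ)y. It remains to check that
the enlarged form is diagonal after this substitution (`hE`) and that the substitution is onto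
(`hs`). The pivot and the rank-one update are both of this shape, so one program `updateFrame`
serves both. -/
theorem insert_row {i : ℕ} {c μ : ℕ → ℝ} (h : IsFrame d a S w F J) (hi : i ∉ S)
    (hF' : ∀ k < d, ∀ l < d, F' k l = F k l - μ k * ∑ k' ∈ Finset.range d, c k' * F k' l)
    (hJ' : J' ⊆ Finset.range d)
    (hE : ∀ y : ℕ → ℝ, ∑ k ∈ J, (y k - c k * ∑ k' ∈ Finset.range d, μ k' * y k') ^ 2 +
      (∑ k ∈ Finset.range d, dot d (a i) (F k) *
        (y k - c k * ∑ k' ∈ Finset.range d, μ k' * y k')) ^ 2 / w i = ∑ k ∈ J', y k ^ 2)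
    (hs : ∀ z : ℕ → ℝ, ∃ y : ℕ → ℝ, ∀ k < d,
      y k - c k * ∑ k' ∈ Finset.range d, μ k' * y k' = z k) :
    IsFrame d a (insert i S) w F' J' := by
  have key : ∀ y : ℕ → ℝ, ∀ l < d, comb d F' y l =
      comb d F (fun k => y k - c k * ∑ k' ∈ Finset.range d, μ k' * y k') l := by
    intro y l hl
    have h1 : comb d F' y l = ∑ k ∈ Finset.range d, (y k * F k l -
        (μ k * y k) * ∑ k' ∈ Finset.range d, c k' * F k' l) :=
      Finset.sum_congr rfl fun k hk => by rw [hF' k (Finset.mem_range.1 hk) l hl]; ring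
    rw [h1, Finset.sum_sub_distrib, ← Finset.sum_mul, Finset.mul_sum, ← Finset.sum_sub_distrib]
    exact Finset.sum_congr rfl fun k _ => by ring
  refine ⟨hJ', fun x => ?_, fun y => ?_⟩
  · obtain ⟨z, hz⟩ := h.spans x
    obtain ⟨y, hy⟩ := hs z
    refine ⟨y, fun l hl => ?_⟩
    rw [hz l hl, key y l hl]
    exact Finset.sum_congr rfl fun k hk => by rw [← hy k (Finset.mem_range.1 hk)]
  · rw [Finset.sum_insert hi, ← hE y, ← h.quad, dot_congr (a i) (key y), dot_comb, add_comm]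
    congr 1
    · exact Finset.sum_congr rfl fun i _ => by rw [dot_congr (a i) (key y)]
    · congr 2
      exact Finset.sum_congr rfl fun k _ => by ring

/-- The null vector `F j` is scaled so that its product with the row is √w, and multiples of it are
subtracted from the others to make them orthogonal to the row. The row then contributes exactly the
square of the coordinate `j`, and the old form does not see the change. -/
theorem insert_pivot {i j : ℕ} {c μ : ℕ → ℝ} (h : IsFrame d a S w F J) (hi : i ∉ S)
    (hw : 0 < w i) (hj : j < d) (hjJ : j ∉ J) (hv : dot d (a i) (F j) ≠ 0)
    (hc : ∀ k < d, c k = if k = j then 1 else 0)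
    (hμ : ∀ k < d, μ k = if k = j then 1 - √(w i) / dot d (a i) (F j)
      else dot d (a i) (F k) / dot d (a i) (F j))
    (hF' : ∀ k < d, ∀ l < d, F' k l = F k l - μ k * ∑ k' ∈ Finset.range d, c k' * F k' l) :
    IsFrame d a (insert i S) w F' (insert j J) := by
  set v := fun k => dot d (a i) (F k) with hvdef
  have hv' : v j ≠ 0 := hv
  have hjr : j ∈ Finset.range d := Finset.mem_range.2 hj
  have hsum : ∀ y : ℕ → ℝ, v j * ∑ k ∈ Finset.range d, μ k * y k =
      ∑ k ∈ Finset.range d, v k * y k - √(w i) * y j := by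
    intro y
    have h1 : √(w i) * y j = ∑ k ∈ Finset.range d, if k = j then √(w i) * y k else 0 := by
      rw [Finset.sum_ite_eq' _ j, if_pos hjr]
    rw [h1, ← Finset.sum_sub_distrib, Finset.mul_sum]
    refine Finset.sum_congr rfl fun k hk => ?_
    rw [hμ k (Finset.mem_range.1 hk)]
    change v j * ((if k = j then 1 - √(w i) / v j else v k / v j) * y k) = _
    split_ifs with hkj
    · subst hkj; field_simp
    · field_simp; ring
  -- In the new coordinates the product with the row is √w times the coordinate `j`.
  have hvE : ∀ y : ℕ → ℝ, ∑ k ∈ Finset.range d, v k *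
      (y k - c k * ∑ k' ∈ Finset.range d, μ k' * y k') = √(w i) * y j := by
    intro y
    have h1 : ∑ k ∈ Finset.range d, v k * (y k - c k * ∑ k' ∈ Finset.range d, μ k' * y k') =
        ∑ k ∈ Finset.range d, v k * y k - ∑ k ∈ Finset.range d,
          if k = j then v k * ∑ k' ∈ Finset.range d, μ k' * y k' else 0 := by
      rw [← Finset.sum_sub_distrib]
      refine Finset.sum_congr rfl fun k hk => ?_
      rw [hc k (Finset.mem_range.1 hk)]
      split_ifs <;> ring
    rw [h1, Finset.sum_ite_eq' _ j, if_pos hjr, hsum]; ring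
  refine h.insert_row hi hF' ?_ ?_ ?_
  · exact Finset.insert_subset hjr h.sub
  · intro y
    have h2 := hvE y
    simp only [hvdef] at h2
    rw [h2, Finset.sum_insert hjJ, mul_pow, Real.sq_sqrt hw.le, mul_div_cancel_left₀ _ hw.ne',
      add_comm]
    congr 1
    refine Finset.sum_congr rfl fun k hk => ?_
    rw [hc k (Finset.mem_range.1 (h.sub hk)), if_neg (by rintro rfl; exact hjJ hk)]
    ring
  · intro z
    have hw' : √(w i) ≠ 0 := (Real.sqrt_pos.2 hw).ne'
    set y : ℕ → ℝ := fun k => if k = j then (∑ k' ∈ Finset.range d, v k' * z k') / √(w i) else z k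
      with hy
    have hyk : ∀ k, k ≠ j → y k = z k := fun k hk => by simp [hy, hk]
    refine ⟨y, fun k hk => ?_⟩
    by_cases hkj : k = j
    · subst hkj
      have h1 := hvE y
      have h2 : ∑ k' ∈ Finset.range d, v k' * (y k' - c k' * ∑ k' ∈ Finset.range d, μ k' * y k')
          - ∑ k' ∈ Finset.range d, v k' * z k' = v k *
            (y k - c k * ∑ k' ∈ Finset.range d, μ k' * y k' - z k) := by
        rw [← Finset.sum_sub_distrib, Finset.sum_eq_single k]
        · ring
        · intro b hb hbk
          rw [hc b (Finset.mem_range.1 hb), if_neg hbk, hyk b hbk]; ring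
        · intro h'; exact absurd hjr h'
      have h3 : √(w i) * y k = ∑ k' ∈ Finset.range d, v k' * z k' := by
        simp only [hy, if_true]; field_simp
      rw [h1, h3, sub_self] at h2
      rcases mul_eq_zero.1 h2.symm with h4 | h4
      · exact absurd h4 hv'
      · linarith
    · rw [hc k hk, if_neg hkj, hyk k hkj]; ring

/-- The enlarged form is 1 + vvᵀ/w on the coordinates in `J`, where v is supported. With ρ = √(1 +
s/w), its inverse square root is 1 - βvvᵀ, where β = 1/(w(ρ² + ρ)), and this is the substitution
used. -/
theorem insert_rankOne {i : ℕ} {c μ : ℕ → ℝ} {s : ℝ} (h : IsFrame d a S w F J) (hi : i ∉ S)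
    (hw : 0 < w i) (hnull : ∀ k < d, k ∉ J → dot d (a i) (F k) = 0)
    (hs : s = ∑ k ∈ Finset.range d, dot d (a i) (F k) * dot d (a i) (F k))
    (hc : ∀ k < d, c k = dot d (a i) (F k))
    (hμ : ∀ k < d, μ k = 1 / (w i * ((1 + s / w i) + √(1 + s / w i))) * dot d (a i) (F k))
    (hF' : ∀ k < d, ∀ l < d, F' k l = F k l - μ k * ∑ k' ∈ Finset.range d, c k' * F k' l) :
    IsFrame d a (insert i S) w F' J := by
  set v := fun k => dot d (a i) (F k) with hvdef
  set β := 1 / (w i * ((1 + s / w i) + √(1 + s / w i))) with hβ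
  set ρ := √(1 + s / w i) with hρ
  have hs0 : 0 ≤ s := by rw [hs]; exact Finset.sum_nonneg fun k _ => mul_self_nonneg _
  have hρpos : 0 < ρ := Real.sqrt_pos.2 (by positivity)
  have hρ2 : ρ ^ 2 = 1 + s / w i := Real.sq_sqrt (by positivity)
  have hsρ : s = w i * (ρ ^ 2 - 1) := by rw [hρ2]; field_simp; ring
  have hβρ : β = 1 / (w i * (ρ * (ρ + 1))) := by rw [hβ, ← hρ2]; congr 2; ring
  have hβs : 1 - β * s = 1 / ρ := by
    rw [hβρ, hsρ]; field_simp; ring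
  -- This is the coefficient of (v · y)² in the transformed form.
  have hquad : -2 * β + β ^ 2 * s + (1 - β * s) ^ 2 / w i = 0 := by
    rw [hβs, hβρ, hsρ]; field_simp; ring
  have hμ' : ∀ y : ℕ → ℝ, ∑ k ∈ Finset.range d, μ k * y k = β * ∑ k ∈ Finset.range d, v k * y k := by
    intro y
    rw [Finset.mul_sum]
    exact Finset.sum_congr rfl fun k hk => by rw [hμ k (Finset.mem_range.1 hk)]; ring
  have hJsum : ∀ y : ℕ → ℝ, ∑ k ∈ Finset.range d, v k * y k = ∑ k ∈ J, v k * y k := by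
    intro y
    refine (Finset.sum_subset h.sub fun k hk hkJ => ?_).symm
    rw [hvdef]; simp only; rw [hnull k (Finset.mem_range.1 hk) hkJ, zero_mul]
  have hsv : s = ∑ k ∈ Finset.range d, v k * v k := hs
  have hvE : ∀ (y : ℕ → ℝ) (q : ℝ), ∑ k ∈ Finset.range d, v k * (y k - c k * q) =
      ∑ k ∈ Finset.range d, v k * y k - s * q := by
    intro y q
    rw [hsv, Finset.sum_mul, ← Finset.sum_sub_distrib]
    exact Finset.sum_congr rfl fun k hk => by rw [hc k (Finset.mem_range.1 hk)]; ring
  refine h.insert_row hi hF' h.sub (fun y => ?_) fun z => ?_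
  · have h1 := hvE y (∑ k ∈ Finset.range d, μ k * y k)
    simp only [hvdef] at h1
    rw [h1]
    have e1 := hμ' y
    simp only [hvdef] at e1
    rw [e1]
    set p := ∑ k ∈ Finset.range d, dot d (a i) (F k) * y k with hp
    have hp' : p = ∑ k ∈ J, v k * y k := hJsum y
    have h2 : ∑ k ∈ J, (y k - c k * (β * p)) ^ 2 =
        ∑ k ∈ J, y k ^ 2 - 2 * β * p * p + β ^ 2 * p ^ 2 * s := by
      have e3 : 2 * β * p * p = ∑ k ∈ J, 2 * β * p * (v k * y k) := by
        rw [← Finset.mul_sum, ← hp']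
      have e4 : β ^ 2 * p ^ 2 * s = ∑ k ∈ J, β ^ 2 * p ^ 2 * (v k * v k) := by
        rw [hsv, hJsum v, Finset.mul_sum]
      rw [e3, e4, ← Finset.sum_sub_distrib, ← Finset.sum_add_distrib]
      exact Finset.sum_congr rfl fun k hk => by
        rw [hc k (Finset.mem_range.1 (h.sub hk))]; ring
    rw [h2]
    have h3 : (p - s * (β * p)) ^ 2 / w i = p ^ 2 * ((1 - β * s) ^ 2 / w i) := by ring
    rw [h3]
    linear_combination p ^ 2 * hquad
  · set q := ∑ k ∈ Finset.range d, v k * z k with hq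
    -- The inverse of 1 - βvvᵀ is 1 + βρvvᵀ, because 1 - βs = 1/ρ.
    set y : ℕ → ℝ := fun k => z k + β * ρ * q * v k with hy
    refine ⟨y, fun k hk => ?_⟩
    have h1 : ∑ k ∈ Finset.range d, v k * y k = q + β * ρ * q * s := by
      rw [hsv, hq, Finset.mul_sum, ← Finset.sum_add_distrib]
      exact Finset.sum_congr rfl fun k hk => by simp only [hy, hq]; ring
    have h4 : ρ * (1 - β * s) = 1 := by rw [hβs]; field_simp
    rw [hμ', h1, hc k hk]
    change z k + β * ρ * q * v k - v k * _ = _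
    linear_combination v k * β * q * h4

/-- Every weighted finite family of rows has a frame. -/
theorem exists_frame (d : ℕ) (a : ℕ → ℕ → ℝ) (w : ℕ → ℝ) (S : Finset ℕ) (hw : ∀ i ∈ S, 0 < w i) :
    ∃ F J, IsFrame d a S w F J := by
  induction S using Finset.induction_on with
  | empty => exact ⟨fun k l => if k = l then 1 else 0, ∅, empty fun _ _ _ _ => rfl⟩
  | insert i S hi ih =>
    obtain ⟨F, J, h⟩ := ih fun i hi' => hw i (Finset.mem_insert_of_mem hi')
    have hwi := hw i (Finset.mem_insert_self _ _)
    by_cases hn : ∀ k < d, k ∉ J → dot d (a i) (F k) = 0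
    · exact ⟨_, J, h.insert_rankOne hi hwi hn rfl (fun _ _ => rfl) (fun _ _ => rfl)
        (fun _ _ _ _ => rfl)⟩
    · push Not at hn
      obtain ⟨j, hj, hjJ, hv⟩ := hn
      exact ⟨_, insert j J, h.insert_pivot hi hwi hj hjJ hv (fun _ _ => rfl) (fun _ _ => rfl)
        (fun _ _ _ _ => rfl)⟩

theorem quad_nonneg (h : IsFrame d a S w F J) (x : ℕ → ℝ) :
    0 ≤ ∑ i ∈ S, dot d (a i) x ^ 2 / w i := by
  obtain ⟨y, hy⟩ := h.spans x
  rw [Finset.sum_congr rfl fun i _ => by rw [dot_congr (a i) hy], h.quad]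
  exact Finset.sum_nonneg fun _ _ => sq_nonneg _

/-- A row of `S` is orthogonal to the vectors outside `J`. -/
theorem null (h : IsFrame d a S w F J) (hw : ∀ i ∈ S, 0 < w i) {i k : ℕ} (hi : i ∈ S)
    (hk : k < d) (hkJ : k ∉ J) : dot d (a i) (F k) = 0 := by
  have h1 := h.quad (fun k' => if k' = k then 1 else 0)
  have h2 : ∑ k' ∈ J, (if k' = k then (1 : ℝ) else 0) ^ 2 = 0 :=
    Finset.sum_eq_zero fun k' hk' => by
      rw [if_neg (by rintro rfl; exact hkJ hk')]; simp
  rw [h2, Finset.sum_eq_zero_iff_of_nonneg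
    fun i hi => div_nonneg (sq_nonneg _) (hw i hi).le] at h1
  have h3 := h1 i hi
  rw [div_eq_zero_iff, or_iff_left (hw i hi).ne', sq_eq_zero_iff, dot_comb] at h3
  simpa [hk] using h3

/-- Cauchy–Schwarz in the coordinates of a frame. -/
theorem dot_sq_le (h : IsFrame d a S w F J) {b : ℕ → ℝ}
    (hb : ∀ k < d, k ∉ J → dot d b (F k) = 0) (x : ℕ → ℝ) :
    dot d b x ^ 2 ≤ (∑ k ∈ Finset.range d, dot d b (F k) ^ 2) *
      ∑ i ∈ S, dot d (a i) x ^ 2 / w i := by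
  obtain ⟨y, hy⟩ := h.spans x
  have e : ∑ i ∈ S, dot d (a i) x ^ 2 / w i = ∑ k ∈ J, y k ^ 2 := by
    rw [← h.quad]
    exact Finset.sum_congr rfl fun i _ => by rw [dot_congr (a i) hy]
  have e2 : dot d b x = ∑ k ∈ J, dot d b (F k) * y k := by
    rw [dot_congr b hy, dot_comb]
    rw [Finset.sum_subset h.sub fun k hk hkJ => by
      rw [hb k (Finset.mem_range.1 hk) hkJ, zero_mul]]
    exact Finset.sum_congr rfl fun k _ => mul_comm _ _
  rw [e, e2]
  refine (Finset.sum_mul_sq_le_sq_mul_sq J _ _).trans ?_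
  refine mul_le_mul_of_nonneg_right ?_ (Finset.sum_nonneg fun _ _ => sq_nonneg _)
  exact Finset.sum_le_sum_of_subset_of_nonneg h.sub fun _ _ _ => sq_nonneg _

/-- Exchanging the sums leaves, for each `k`, the value of the quadratic form at `F k`, which is 1
or 0. The total is the rank of the form. -/
theorem sum_leverage (h : IsFrame d a S w F J) :
    ∑ i ∈ S, (∑ k ∈ Finset.range d, dot d (a i) (F k) ^ 2) / w i ≤ d := by
  have h1 : ∀ k ∈ Finset.range d, ∑ i ∈ S, dot d (a i) (F k) ^ 2 / w i ≤ 1 := by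
    intro k hk
    have h2 := h.quad (fun k' => if k' = k then 1 else 0)
    have h3 : ∀ b, dot d b (comb d F fun k' => if k' = k then 1 else 0) = dot d b (F k) := by
      intro b; rw [dot_comb]; simp [Finset.mem_range.1 hk]
    simp only [h3] at h2
    rw [h2]
    calc ∑ k' ∈ J, (if k' = k then (1 : ℝ) else 0) ^ 2 = ∑ k' ∈ J, if k' = k then (1 : ℝ) else 0 :=
          Finset.sum_congr rfl fun _ _ => by split_ifs <;> simp
      _ ≤ 1 := by rw [Finset.sum_ite_eq']; split_ifs <;> simp
  calc ∑ i ∈ S, (∑ k ∈ Finset.range d, dot d (a i) (F k) ^ 2) / w i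
      = ∑ k ∈ Finset.range d, ∑ i ∈ S, dot d (a i) (F k) ^ 2 / w i := by
        rw [Finset.sum_comm]; exact Finset.sum_congr rfl fun i _ => Finset.sum_div _ _ _
    _ ≤ ∑ k ∈ Finset.range d, (1 : ℝ) := Finset.sum_le_sum h1
    _ = d := by simp

theorem exists_dot_ne_zero (h : IsFrame d a S w F J) {b : ℕ → ℝ} (hb : ∃ l < d, b l ≠ 0) :
    ∃ k < d, dot d b (F k) ≠ 0 := by
  by_contra hc
  push Not at hc
  obtain ⟨l, hl, hbl⟩ := hb
  obtain ⟨y, hy⟩ := h.spans (fun l' => if l' = l then 1 else 0)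
  have h1 := dot_congr b hy
  rw [dot_comb, Finset.sum_eq_zero fun k hk => by rw [hc k (Finset.mem_range.1 hk), mul_zero]] at h1
  simp [dot, hl] at h1
  exact hbl h1

end IsFrame

/-! ### Lewis weights and the Euclidean rounding of the ℓ₁ norm. -/

/-- Positive weights `w` whose square dominate the leverage of each row in the quadratic form that
they define. -/
structure Dominating (d : ℕ) (a : ℕ → ℕ → ℝ) (S : Finset ℕ) (w : ℕ → ℝ) : Prop where
  pos : ∀ i ∈ S, 0 < w i
  le : ∀ i ∈ S, ∀ x, dot d (a i) x ^ 2 ≤ w i ^ 2 * ∑ k ∈ S, dot d (a k) x ^ 2 / w k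

namespace Dominating

variable {d : ℕ} {a : ℕ → ℕ → ℝ} {S : Finset ℕ} {w w' : ℕ → ℝ} {F : ℕ → ℕ → ℝ} {J : Finset ℕ}

theorem one (hw : ∀ i ∈ S, w i = 1) : Dominating d a S w where
  pos i hi := by rw [hw i hi]; exact one_pos
  le i hi x := by
    rw [hw i hi, one_pow, one_mul]
    have h1 : ∀ k ∈ S, 0 ≤ dot d (a k) x ^ 2 / w k := fun k hk => by rw [hw k hk]; positivity
    have := Finset.single_le_sum h1 hi
    rwa [hw i hi, div_one] at this

/-- One Lewis iteration. The new weights are the square roots of the leverages and do not exceed the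
old ones, so the new quadratic form is at least the old one and domination persists. Cauchy–Schwarz
and the leverage sum of at most d give the bound on the total. -/
theorem step (h : Dominating d a S w) (hF : IsFrame d a S w F J)
    (hne : ∀ i ∈ S, ∃ l < d, a i l ≠ 0)
    (hw' : ∀ i ∈ S, w' i = √(∑ k ∈ Finset.range d, dot d (a i) (F k) * dot d (a i) (F k))) :
    Dominating d a S w' ∧ ∑ i ∈ S, w' i ≤ √(d * ∑ i ∈ S, w i) := by
  have hsq : ∀ i ∈ S, w' i ^ 2 = ∑ k ∈ Finset.range d, dot d (a i) (F k) ^ 2 := by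
    intro i hi
    rw [hw' i hi, Real.sq_sqrt (Finset.sum_nonneg fun _ _ => mul_self_nonneg _)]
    exact Finset.sum_congr rfl fun _ _ => (sq _).symm
  have hpos : ∀ i ∈ S, 0 < w' i := by
    intro i hi
    obtain ⟨k, hk, hv⟩ := hF.exists_dot_ne_zero (hne i hi)
    rw [hw' i hi]
    refine Real.sqrt_pos.2 (Finset.sum_pos' (fun _ _ => mul_self_nonneg _)
      ⟨k, Finset.mem_range.2 hk, mul_self_pos.2 hv⟩)
  have hle : ∀ i ∈ S, w' i ≤ w i := by
    intro i hi
    -- The vector with these coordinates is extremal in Cauchy–Schwarz; domination at it reads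
    -- (w'²)² ≤ w²w'².
    set y : ℕ → ℝ := fun k => dot d (a i) (F k) with hy
    have h1 := h.le i hi (comb d F y)
    rw [hF.quad] at h1
    have h2 : dot d (a i) (comb d F y) = w' i ^ 2 := by
      rw [dot_comb, hsq i hi]; exact Finset.sum_congr rfl fun _ _ => (sq _).symm
    have h3 : ∑ k ∈ J, y k ^ 2 ≤ w' i ^ 2 := by
      rw [hsq i hi]
      exact Finset.sum_le_sum_of_subset_of_nonneg hF.sub fun _ _ _ => sq_nonneg _
    rw [h2] at h1
    have h4 : (w' i ^ 2) ^ 2 ≤ w i ^ 2 * w' i ^ 2 :=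
      h1.trans (mul_le_mul_of_nonneg_left h3 (sq_nonneg _))
    have hp := hpos i hi
    have h5 : w' i ^ 2 ≤ w i ^ 2 := by
      rw [sq (w' i ^ 2)] at h4
      exact le_of_mul_le_mul_right h4 (by positivity)
    exact le_of_sq_le_sq h5 (h.pos i hi).le
  refine ⟨⟨hpos, fun i hi x => ?_⟩, ?_⟩
  · have h1 := hF.dot_sq_le (fun k hk hkJ => hF.null h.pos hi hk hkJ) x
    rw [← hsq i hi] at h1
    refine h1.trans (mul_le_mul_of_nonneg_left ?_ (sq_nonneg _))
    exact Finset.sum_le_sum fun k hk =>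
      div_le_div_of_nonneg_left (sq_nonneg _) (hpos k hk) (hle k hk)
  · refine Real.le_sqrt_of_sq_le ?_
    have h1 := Finset.sum_mul_sq_le_sq_mul_sq S (fun i => w' i / √(w i)) (fun i => √(w i))
    have e1 : ∑ i ∈ S, w' i / √(w i) * √(w i) = ∑ i ∈ S, w' i :=
      Finset.sum_congr rfl fun i hi => div_mul_cancel₀ _ (Real.sqrt_pos.2 (h.pos i hi)).ne'
    have e2 : ∑ i ∈ S, √(w i) ^ 2 = ∑ i ∈ S, w i :=
      Finset.sum_congr rfl fun i hi => Real.sq_sqrt (h.pos i hi).le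
    have e3 : ∑ i ∈ S, (w' i / √(w i)) ^ 2 =
        ∑ i ∈ S, (∑ k ∈ Finset.range d, dot d (a i) (F k) ^ 2) / w i :=
      Finset.sum_congr rfl fun i hi => by rw [div_pow, Real.sq_sqrt (h.pos i hi).le, hsq i hi]
    rw [e1, e2, e3] at h1
    exact h1.trans (mul_le_mul_of_nonneg_right hF.sum_leverage
      (Finset.sum_nonneg fun i hi => (h.pos i hi).le))

/-- Domination bounds one of the two factors |a · x| of each term by w√Q, whence Q ≤ ‖Ax‖₁√Q. -/
theorem quad_le (h : Dominating d a S w) (x : ℕ → ℝ) :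
    ∑ k ∈ S, dot d (a k) x ^ 2 / w k ≤ rowNorm d a S x ^ 2 := by
  set Q := ∑ k ∈ S, dot d (a k) x ^ 2 / w k with hQ
  have hQ0 : 0 ≤ Q := Finset.sum_nonneg fun k hk => div_nonneg (sq_nonneg _) (h.pos k hk).le
  have h1 : Q ≤ rowNorm d a S x * √Q := by
    rw [hQ, rowNorm, Finset.sum_mul, ← hQ]
    refine Finset.sum_le_sum fun k hk => ?_
    have hk0 := h.pos k hk
    have h2 : |dot d (a k) x| ≤ w k * √Q := by
      refine abs_le_of_sq_le_sq ?_ (by positivity)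
      rw [mul_pow, Real.sq_sqrt hQ0]; exact h.le k hk x
    rw [div_le_iff₀ hk0, ← sq_abs, sq, mul_assoc, mul_comm (√Q)]
    exact mul_le_mul_of_nonneg_left h2 (abs_nonneg _)
  by_cases hz : Q = 0
  · rw [hz]; positivity
  · have hs : 0 < √Q := Real.sqrt_pos.2 (lt_of_le_of_ne hQ0 (Ne.symm hz))
    have h3 : √Q ≤ rowNorm d a S x := by
      exact le_of_mul_le_mul_right ((Real.mul_self_sqrt hQ0).le.trans h1) hs
    rw [← Real.sq_sqrt hQ0]
    exact pow_le_pow_left₀ (Real.sqrt_nonneg _) h3 2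

/-- Cauchy–Schwarz with |a · x| = √w · |a · x|/√w. -/
theorem le_quad (h : Dominating d a S w) (x : ℕ → ℝ) :
    rowNorm d a S x ^ 2 ≤ (∑ i ∈ S, w i) * ∑ k ∈ S, dot d (a k) x ^ 2 / w k := by
  have h1 := Finset.sum_mul_sq_le_sq_mul_sq S (fun i => √(w i)) (fun i => |dot d (a i) x| / √(w i))
  have e1 : ∑ i ∈ S, √(w i) * (|dot d (a i) x| / √(w i)) = rowNorm d a S x :=
    Finset.sum_congr rfl fun i hi => mul_div_cancel₀ _ (Real.sqrt_pos.2 (h.pos i hi)).ne'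
  have e2 : ∑ i ∈ S, √(w i) ^ 2 = ∑ i ∈ S, w i :=
    Finset.sum_congr rfl fun i hi => Real.sq_sqrt (h.pos i hi).le
  have e3 : ∑ i ∈ S, (|dot d (a i) x| / √(w i)) ^ 2 = ∑ k ∈ S, dot d (a k) x ^ 2 / w k :=
    Finset.sum_congr rfl fun i hi => by rw [div_pow, Real.sq_sqrt (h.pos i hi).le, sq_abs]
  rwa [e1, e2, e3] at h1

/-- Thus dominating weights are upper bounds for the ℓ₁ sensitivities. -/
theorem abs_dot_le (h : Dominating d a S w) {i : ℕ} (hi : i ∈ S) (x : ℕ → ℝ) :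
    |dot d (a i) x| ≤ w i * rowNorm d a S x := by
  have hN := rowNorm_nonneg d a S x
  refine abs_le_of_sq_le_sq ?_ (mul_nonneg (h.pos i hi).le hN)
  rw [mul_pow]
  exact (h.le i hi x).trans (mul_le_mul_of_nonneg_left (h.quad_le x) (sq_nonneg _))

end Dominating

/-- The decay of the total weight under the Lewis iteration. -/
theorem lewis_total_step {d B W W' : ℝ} (hd : 0 ≤ d) (hW : W ≤ max (4 * d) B)
    (hB : 0 ≤ B) (h : W' ≤ √(d * W)) : W' ≤ max (4 * d) (B / 2) := by
  refine h.trans ?_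
  have h1 : d * W ≤ d * max (4 * d) B := mul_le_mul_of_nonneg_left hW hd
  refine (Real.sqrt_le_sqrt h1).trans ?_
  rcases le_total B (4 * d) with hb | hb
  · rw [max_eq_left hb]
    refine le_max_of_le_left (Real.sqrt_le_iff.2 ⟨by positivity, by nlinarith⟩)
  · rw [max_eq_right hb]
    refine le_max_of_le_right (Real.sqrt_le_iff.2 ⟨by positivity, by nlinarith⟩)

/-- Coordinates in which the `ℓ₁` norm of the rows in `S` is, up to a factor depending on `W`, the
Euclidean norm of the coordinates in `J`. -/
structure IsRounding (d : ℕ) (a : ℕ → ℕ → ℝ) (S : Finset ℕ) (W : ℝ) (F : ℕ → ℕ → ℝ)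
    (J : Finset ℕ) : Prop where
  sub : J ⊆ Finset.range d
  spans : ∀ x : ℕ → ℝ, ∃ y, ∀ l < d, x l = comb d F y l
  lower : ∀ y, ∑ k ∈ J, y k ^ 2 ≤ rowNorm d a S (comb d F y) ^ 2
  upper : ∀ y, rowNorm d a S (comb d F y) ^ 2 ≤ W * ∑ k ∈ J, y k ^ 2

theorem IsFrame.isRounding {d : ℕ} {a : ℕ → ℕ → ℝ} {S : Finset ℕ} {w : ℕ → ℝ} {F : ℕ → ℕ → ℝ}
    {J : Finset ℕ} {W : ℝ} (hF : IsFrame d a S w F J) (h : Dominating d a S w)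
    (hW : ∑ i ∈ S, w i ≤ W) : IsRounding d a S W F J where
  sub := hF.sub
  spans := hF.spans
  lower y := by rw [← hF.quad]; exact h.quad_le _
  upper y := by
    rw [← hF.quad]
    exact (h.le_quad _).trans (mul_le_mul_of_nonneg_right hW (hF.quad_nonneg _))

/-- Approximate Lewis weights exist. -/
theorem exists_dominating {d : ℕ} (hd : 1 ≤ d) (a : ℕ → ℕ → ℝ) (S : Finset ℕ)
    (hne : ∀ i ∈ S, ∃ l < d, a i l ≠ 0) :
    ∃ w, Dominating d a S w ∧ ∑ i ∈ S, w i ≤ 4 * d := by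
  have hd' : (1 : ℝ) ≤ d := by exact_mod_cast hd
  have key : ∀ k : ℕ, ∃ w, Dominating d a S w ∧ ∑ i ∈ S, w i ≤ max (4 * (d : ℝ)) (S.card / 2 ^ k) := by
    intro k
    induction k with
    | zero => exact ⟨fun _ => 1, Dominating.one fun _ _ => rfl, by simp⟩
    | succ k ih =>
      obtain ⟨w, hw, hW⟩ := ih
      obtain ⟨F, J, hF⟩ := IsFrame.exists_frame d a w S hw.pos
      obtain ⟨h1, h2⟩ := hw.step hF hne (w' := fun i =>
        √(∑ k ∈ Finset.range d, dot d (a i) (F k) * dot d (a i) (F k))) fun _ _ => rfl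
      refine ⟨_, h1, ?_⟩
      have := lewis_total_step (by positivity) hW (by positivity) h2
      rwa [div_div, ← pow_succ] at this
  -- For existence the number of rounds is irrelevant, and `S.card` halvings are more than enough.
  obtain ⟨w, hw, hW⟩ := key S.card
  refine ⟨w, hw, hW.trans (max_le le_rfl ?_)⟩
  have : (S.card : ℝ) ≤ 2 ^ S.card := by exact_mod_cast Nat.lt_two_pow_self.le
  rw [div_le_iff₀ (by positivity)]
  nlinarith [show (0:ℝ) < 2 ^ S.card by positivity]

theorem exists_isRounding {d : ℕ} (hd : 1 ≤ d) (a : ℕ → ℕ → ℝ) (S : Finset ℕ)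
    (hne : ∀ i ∈ S, ∃ l < d, a i l ≠ 0) : ∃ F J, IsRounding d a S (4 * d) F J := by
  obtain ⟨w, hw, hW⟩ := exists_dominating hd a S hne
  obtain ⟨F, J, hF⟩ := IsFrame.exists_frame d a w S hw.pos
  exact ⟨F, J, hF.isRounding hw hW⟩

/-! ### Sensitivities -/

/-- The `ℓ₁` sensitivity of the row `i` with respect to the rows in `S`. -/
noncomputable def sens (d : ℕ) (a : ℕ → ℕ → ℝ) (S : Finset ℕ) (i : ℕ) : ℝ :=
  ⨆ x : ℕ → ℝ, |dot d (a i) x| / rowNorm d a S x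

section sens

variable {d : ℕ} {a : ℕ → ℕ → ℝ} {S : Finset ℕ} {i : ℕ}

theorem sens_nonneg : 0 ≤ sens d a S i :=
  Real.iSup_nonneg fun x => div_nonneg (abs_nonneg _) (rowNorm_nonneg d a S x)

theorem sens_le {c : ℝ} (hc : 0 ≤ c) (h : ∀ x, |dot d (a i) x| ≤ c * rowNorm d a S x) :
    sens d a S i ≤ c :=
  ciSup_le fun x => div_le_of_le_mul₀ (rowNorm_nonneg d a S x) hc (h x)

/-- Membership of the row keeps the quotients at most 1, so that the supremum is not a default
value, and it covers the vectors of norm 0, where the quotient is 0 by convention. -/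
theorem abs_dot_le_sens (hi : i ∈ S) (x : ℕ → ℝ) :
    |dot d (a i) x| ≤ sens d a S i * rowNorm d a S x := by
  have hle := abs_dot_le_rowNorm d a hi
  rcases (rowNorm_nonneg d a S x).eq_or_lt with h | h
  · rw [← h, mul_zero, h]; exact hle x
  · rw [← div_le_iff₀ h]
    exact le_ciSup (f := fun x : ℕ → ℝ => |dot d (a i) x| / rowNorm d a S x)
      ⟨1, by rintro _ ⟨x, rfl⟩; exact div_le_one_of_le₀ (hle x) (rowNorm_nonneg d a S x)⟩ x

theorem sum_sens_le (hd : 1 ≤ d) (hne : ∀ i ∈ S, ∃ l < d, a i l ≠ 0) :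
    ∑ i ∈ S, sens d a S i ≤ 4 * d := by
  obtain ⟨w, hw, hW⟩ := exists_dominating hd a S hne
  exact (Finset.sum_le_sum fun i hi => sens_le (hw.pos i hi).le (hw.abs_dot_le hi)).trans hW

end sens

/-! ### Reading sensitivities off a rounding. -/

namespace IsRounding

variable {d : ℕ} {a : ℕ → ℕ → ℝ} {S : Finset ℕ} {W : ℝ} {F : ℕ → ℕ → ℝ} {J : Finset ℕ}

theorem rowNorm_basis (h : IsRounding d a S W F J) (hW : 0 ≤ W) {k : ℕ} (hk : k < d) :
    rowNorm d a S (F k) ≤ √W ∧ (k ∉ J → rowNorm d a S (F k) = 0) := by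
  have h3 : ∀ b, dot d b (comb d F fun k' => if k' = k then 1 else 0) = dot d b (F k) := by
    intro b; rw [dot_comb]; simp [hk]
  have h2 := h.upper (fun k' => if k' = k then 1 else 0)
  simp only [rowNorm, h3] at h2
  have h4 : ∑ k' ∈ J, (if k' = k then (1 : ℝ) else 0) ^ 2 = if k ∈ J then 1 else 0 := by
    rw [Finset.sum_congr rfl fun k' _ => show (if k' = k then (1 : ℝ) else 0) ^ 2 =
      if k' = k then 1 else 0 by split_ifs <;> simp, Finset.sum_ite_eq']
  rw [h4] at h2
  refine ⟨Real.le_sqrt_of_sq_le (h2.trans ?_), fun hkJ => ?_⟩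
  · split_ifs <;> simp [hW]
  · rw [if_neg hkJ, mul_zero] at h2
    exact pow_eq_zero_iff two_ne_zero |>.1 (le_antisymm h2 (sq_nonneg _))

/-- The vector `F k` is annihilated by `S` but not by the row `i`, which therefore carries the whole
norm at `F k`. -/
theorem one_le_sens (h : IsRounding d a S W F J) (hW : 0 ≤ W) {i k : ℕ} (hk : k < d) (hkJ : k ∉ J)
    (hv : dot d (a i) (F k) ≠ 0) : 1 ≤ sens d a (insert i S) i := by
  have h0 := (h.rowNorm_basis hW hk).2 hkJ
  have hpos := abs_pos.2 hv
  have hi : i ∉ S := fun hi => by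
    have := abs_dot_le_rowNorm d a hi (F k)
    rw [h0] at this; linarith
  have h1 := abs_dot_le_sens (d := d) (a := a) (Finset.mem_insert_self i S) (F k)
  have h2 : rowNorm d a (insert i S) (F k) = |dot d (a i) (F k)| := by
    rw [rowNorm, Finset.sum_insert hi]
    rw [rowNorm] at h0; rw [h0, add_zero]
  rw [h2] at h1
  exact le_of_mul_le_mul_right (by rwa [one_mul]) hpos

/-- The sensitivity σ is tested on the vector whose coordinates are the products v themselves. There
the row has the value ν² = |v|², while the norm of `S` is at most 2√d · ν; hence ν ≤ σ(2√d + ν). The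
sum of the |v k| is at most √d · ν. -/
theorem sum_abs_le_sens (h : IsRounding d a S (4 * d) F J) (hd : 1 ≤ d) (i : ℕ) :
    min 1 (∑ k ∈ Finset.range d, |dot d (a i) (F k)|) ≤ 3 * d * sens d a (insert i S) i := by
  have hd' : (1 : ℝ) ≤ d := by exact_mod_cast hd
  set v : ℕ → ℝ := fun k => dot d (a i) (F k) with hv
  set ν := √(∑ k ∈ Finset.range d, v k ^ 2) with hν
  have hν0 : 0 ≤ ν := Real.sqrt_nonneg _
  have hν2 : ν ^ 2 = ∑ k ∈ Finset.range d, v k ^ 2 :=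
    Real.sq_sqrt (Finset.sum_nonneg fun _ _ => sq_nonneg _)
  have hsum : ∑ k ∈ Finset.range d, |v k| ≤ √d * ν := by
    rw [hν, ← Real.sqrt_mul (by positivity)]
    refine Real.le_sqrt_of_sq_le ?_
    have := Finset.sum_mul_sq_le_sq_mul_sq (Finset.range d) (fun _ => (1 : ℝ)) (fun k => |v k|)
    simpa using this
  set σ := sens d a (insert i S) i with hσ
  have hσ0 : 0 ≤ σ := sens_nonneg
  set r := √(d : ℝ) with hr
  have hr1 : 1 ≤ r := Real.one_le_sqrt.2 hd'
  have hr2 : r ^ 2 = d := Real.sq_sqrt (by positivity)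
  have hdot : dot d (a i) (comb d F v) = ν ^ 2 := by
    rw [dot_comb, hν2]; exact Finset.sum_congr rfl fun _ _ => (sq _).symm
  have hup : rowNorm d a S (comb d F v) ≤ 2 * r * ν := by
    refine le_of_sq_le_sq ((h.upper v).trans ?_) (by positivity)
    rw [mul_pow, mul_pow, hr2, hν2]
    have h2 : ∑ k ∈ J, v k ^ 2 ≤ ∑ k ∈ Finset.range d, v k ^ 2 :=
      Finset.sum_le_sum_of_subset_of_nonneg h.sub fun _ _ _ => sq_nonneg _
    nlinarith
  have hins : rowNorm d a (insert i S) (comb d F v) ≤ 2 * r * ν + ν ^ 2 := by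
    by_cases hi : i ∈ S
    · rw [Finset.insert_eq_of_mem hi]; nlinarith [sq_nonneg ν]
    · rw [rowNorm, Finset.sum_insert hi, hdot, abs_of_nonneg (sq_nonneg ν), add_comm]
      exact add_le_add_left hup _
  have h1 := abs_dot_le_sens (d := d) (a := a) (Finset.mem_insert_self i S) (comb d F v)
  rw [hdot, abs_of_nonneg (sq_nonneg ν)] at h1
  have h2 : ν ^ 2 ≤ σ * (2 * r * ν + ν ^ 2) := h1.trans (mul_le_mul_of_nonneg_left hins hσ0)
  rcases hν0.eq_or_lt with hz | hz
  · refine (min_le_right _ _).trans (hsum.trans ?_)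
    rw [← hz, mul_zero]; positivity
  have h3 : ν ≤ σ * (2 * r + ν) := by
    have : ν * ν ≤ (σ * (2 * r + ν)) * ν := by nlinarith
    exact le_of_mul_le_mul_right this hz
  rw [← hr2]
  -- For large ν only σ(2√d + 1) ≥ 1 is available, which accounts for the minimum with 1.
  rcases le_total ν 1 with hle | hle
  · refine (min_le_right _ _).trans (hsum.trans ?_)
    have h4 : ν ≤ σ * (2 * r + 1) := h3.trans (mul_le_mul_of_nonneg_left (by linarith) hσ0)
    have h5 : r * ν ≤ r * (σ * (2 * r + 1)) := mul_le_mul_of_nonneg_left h4 (by linarith)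
    nlinarith [mul_nonneg hσ0 (mul_nonneg (by linarith : (0:ℝ) ≤ r) (by linarith : (0:ℝ) ≤ r - 1))]
  · refine (min_le_left _ _).trans ?_
    have h4 : 1 ≤ σ * (2 * r + 1) := by
      have : ν ≤ (σ * (2 * r + 1)) * ν := h3.trans (by
        nlinarith [mul_nonneg (mul_nonneg hσ0 (by linarith : (0 : ℝ) ≤ r)) (sub_nonneg.2 hle)])
      exact le_of_mul_le_mul_right (by rwa [one_mul]) hz
    nlinarith [mul_nonneg hσ0 (mul_nonneg (by linarith : (0:ℝ) ≤ r) (by linarith : (0:ℝ) ≤ r - 1)),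
      mul_nonneg hσ0 (by linarith : (0:ℝ) ≤ r - 1)]

/-- By the lower bound of the rounding, each coordinate in `J` is at most the norm of `S`. Only the
products with the basis are needed, so this applies to every row and not only to those of `S`. -/
theorem abs_dot_le {T : Finset ℕ} (h : IsRounding d a S W F J) (hST : S ⊆ T) {i : ℕ} {u : ℝ}
    (hu : 0 ≤ u) (hnull : ∀ k < d, k ∉ J → dot d (a i) (F k) = 0)
    (hv : ∀ k < d, |dot d (a i) (F k)| ≤ 2 * u) (x : ℕ → ℝ) :
    |dot d (a i) x| ≤ 2 * d * u * rowNorm d a T x := by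
  obtain ⟨y, hy⟩ := h.spans x
  rw [dot_congr (a i) hy, rowNorm_congr a T hy]
  set N := rowNorm d a S (comb d F y) with hN
  have hN0 : 0 ≤ N := rowNorm_nonneg _ _ _ _
  have hyk : ∀ k ∈ J, |y k| ≤ N := by
    intro k hk
    refine abs_le_of_sq_le_sq ?_ hN0
    exact (Finset.single_le_sum (f := fun k => y k ^ 2) (fun _ _ => sq_nonneg _) hk).trans
      (h.lower y)
  calc |dot d (a i) (comb d F y)| = |∑ k ∈ Finset.range d, y k * dot d (a i) (F k)| := by
        rw [dot_comb]
    _ ≤ ∑ k ∈ Finset.range d, |y k * dot d (a i) (F k)| := Finset.abs_sum_le_sum_abs _ _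
    _ ≤ ∑ k ∈ Finset.range d, N * (2 * u) := by
        refine Finset.sum_le_sum fun k hk => ?_
        have hk' := Finset.mem_range.1 hk
        by_cases hkJ : k ∈ J
        · rw [abs_mul]; exact mul_le_mul (hyk k hkJ) (hv k hk') (abs_nonneg _) hN0
        · rw [hnull k hk' hkJ, mul_zero, abs_zero]; positivity
    _ = 2 * d * u * N := by rw [Finset.sum_const, Finset.card_range, nsmul_eq_mul]; ring
    _ ≤ _ := mul_le_mul_of_nonneg_left (rowNorm_mono d a hST _) (by positivity)

end IsRounding

/-! ### Counting -/

/-- Leaving one out: adding `i` to a random set that contains it with probability `1 / D`. -/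
theorem leave_one_out {R D : ℕ} (f : (Fin R → Fin (D + 1)) → Fin R → ℝ) :
    ∑ b : Fin R → Fin (D + 1), ∑ i, f (Function.update b i 0) i =
      (D + 1 : ℕ) * ∑ b : Fin R → Fin (D + 1), ∑ i with b i = 0, f b i := by
  rw [Finset.sum_comm, Finset.mul_sum]
  simp_rw [Finset.sum_filter, Finset.mul_sum]
  rw [Finset.sum_comm (s := (Finset.univ : Finset (Fin R → Fin (D + 1))))]
  refine Finset.sum_congr rfl fun i _ => ?_
  -- Splitting off the coordinate `i`: the left summand does not depend on it and is counted `D + 1`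
  -- times, whereas on the right only its value 0 survives.
  rw [← Equiv.sum_comp (Equiv.funSplitAt i (Fin (D + 1))).symm,
    ← Equiv.sum_comp (Equiv.funSplitAt i (Fin (D + 1))).symm, Fintype.sum_prod_type,
    Fintype.sum_prod_type, Finset.sum_eq_card_nsmul (b := ∑ r : {j // j ≠ i} → Fin (D + 1),
      f ((Equiv.funSplitAt i (Fin (D + 1))).symm (0, r)) i)]
  · symm
    rw [Finset.sum_eq_single 0]
    · simp [Equiv.funSplitAt, Equiv.piSplitAt, Finset.mul_sum]
    · intro v _ hv
      simp [Equiv.funSplitAt, Equiv.piSplitAt, hv]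
    · simp
  · intro v _
    refine Finset.sum_congr rfl fun r _ => ?_
    congr 1
    ext j
    by_cases hj : j = i
    · subst hj; simp [Equiv.funSplitAt, Equiv.piSplitAt]
    · simp [Equiv.funSplitAt, Equiv.piSplitAt, hj]

/-- A random `0`-`1` combination of numbers is at least half as large as any one of them, with
probability at least one half. -/
theorem card_small_combination {d : ℕ} (v : Fin d → ℝ) (j : Fin d) :
    2 * (Finset.univ.filter fun g : Fin d → Fin 2 =>
      |∑ k, v k * ((g k : ℕ) : ℝ)| < |v j| / 2).card ≤ 2 ^ d := by
  set B := Finset.univ.filter fun g : Fin d → Fin 2 =>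
      |∑ k, v k * ((g k : ℕ) : ℝ)| < |v j| / 2 with hB
  -- Flipping the bit `j` moves the combination by exactly |v j|, so that `g` and its flip cannot
  -- both be small.
  set φ : (Fin d → Fin 2) → (Fin d → Fin 2) := fun g => Function.update g j (g j + 1) with hφ
  have hinv : ∀ g, φ (φ g) = g := by
    intro g
    ext k
    by_cases hk : k = j
    · subst hk
      simp only [hφ, Function.update_self]
      generalize g k = x
      fin_cases x <;> rfl
    · simp [hφ, hk]
  have hdiff : ∀ g, |∑ k, v k * ((φ g k : ℕ) : ℝ) - ∑ k, v k * ((g k : ℕ) : ℝ)| = |v j| := by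
    intro g
    rw [← Finset.sum_sub_distrib, Finset.sum_eq_single j]
    · simp only [hφ, Function.update_self]
      generalize g j = x
      fin_cases x <;> simp
    · intro k _ hk; simp [hφ, hk]
    · simp
  have hdisj : Disjoint B (B.image φ) := by
    rw [Finset.disjoint_left]
    intro g hg hg'
    obtain ⟨g', hgB, rfl⟩ := Finset.mem_image.1 hg'
    have h1 := (Finset.mem_filter.1 hg).2
    have h2 := (Finset.mem_filter.1 hgB).2
    have h3 := hdiff g'
    have h4 := abs_sub (∑ k, v k * ((φ g' k : ℕ) : ℝ)) (∑ k, v k * ((g' k : ℕ) : ℝ))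
    linarith
  have hcard : (B.image φ).card = B.card :=
    Finset.card_image_of_injective _ (Function.LeftInverse.injective hinv)
  calc 2 * B.card = (B ∪ B.image φ).card := by
        rw [Finset.card_union_of_disjoint hdisj, hcard]; ring
    _ ≤ (Finset.univ : Finset (Fin d → Fin 2)).card := Finset.card_le_univ _
    _ = 2 ^ d := by simp

theorem card_all_small {d T : ℕ} (v : Fin d → ℝ) (j : Fin d) :
    2 ^ T * (Finset.univ.filter fun g : Fin T → Fin d → Fin 2 =>
      ∀ t, |∑ k, v k * ((g t k : ℕ) : ℝ)| < |v j| / 2).card ≤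
      Fintype.card (Fin T → Fin d → Fin 2) := by
  have h1 : (Finset.univ.filter fun g : Fin T → Fin d → Fin 2 =>
      ∀ t, |∑ k, v k * ((g t k : ℕ) : ℝ)| < |v j| / 2) =
      Fintype.piFinset fun _ : Fin T => Finset.univ.filter fun g : Fin d → Fin 2 =>
        |∑ k, v k * ((g k : ℕ) : ℝ)| < |v j| / 2 := by
    ext g; simp
  rw [h1, Fintype.card_piFinset_const, ← mul_pow]
  refine (Nat.pow_le_pow_left (card_small_combination v j) T).trans ?_
  simp

/-! ### Uniform sampling -/

/-- The exponential moment: eᵗ ≤ 1 + t + t² for |t| ≤ 1, then X² ≤ βX, and 1 + t ≤ eᵗ after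
averaging. -/
theorem sum_exp_le {M : ℕ} {X : Fin M → ℝ} {β l : ℝ} (hX : ∀ z, 0 ≤ X z) (hβ : ∀ z, X z ≤ β)
    (hsum : ∑ z, X z = M) (hl : |l| * β ≤ 1) :
    ∑ z, Real.exp (l * X z) ≤ M * Real.exp (l + l ^ 2 * β) := by
  have h1 : ∀ z, Real.exp (l * X z) ≤ 1 + (l + l ^ 2 * β) * X z := by
    intro z
    have h2 : |l * X z| ≤ 1 := by
      rw [abs_mul, abs_of_nonneg (hX z)]
      exact (mul_le_mul_of_nonneg_left (hβ z) (abs_nonneg _)).trans hl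
    have h3 := (abs_le.1 (Real.abs_exp_sub_one_sub_id_le h2)).2
    have h4 : (l * X z) ^ 2 ≤ l ^ 2 * β * X z := by
      have : X z * X z ≤ β * X z := mul_le_mul_of_nonneg_right (hβ z) (hX z)
      nlinarith [sq_nonneg l]
    linarith
  calc ∑ z, Real.exp (l * X z) ≤ ∑ z, (1 + (l + l ^ 2 * β) * X z) :=
        Finset.sum_le_sum fun z _ => h1 z
    _ = M * (1 + (l + l ^ 2 * β)) := by
        rw [Finset.sum_add_distrib, ← Finset.mul_sum, hsum]; simp; ring
    _ ≤ _ := by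
        refine mul_le_mul_of_nonneg_left ?_ (Nat.cast_nonneg _)
        have := Real.add_one_le_exp (l + l ^ 2 * β)
        linarith

/-- The exponential Markov inequality in counting form. The sign of `l` is free, so both tails are
covered. -/
theorem card_le_of_exp {M s : ℕ} {X : Fin M → ℝ} {β l θ : ℝ} (hX : ∀ z, 0 ≤ X z)
    (hβ : ∀ z, X z ≤ β) (hsum : ∑ z, X z = M) (hl : |l| * β ≤ 1)
    {p : (Fin s → Fin M) → Prop} [DecidablePred p] (hp : ∀ Z, p Z → s * θ ≤ l * ∑ t, X (Z t)) :
    ((Finset.univ.filter p).card : ℝ) ≤ Real.exp (s * (l + l ^ 2 * β - θ)) * (M : ℝ) ^ s := by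
  have h1 : ∑ Z : Fin s → Fin M, Real.exp (l * ∑ t, X (Z t)) = (∑ z, Real.exp (l * X z)) ^ s := by
    rw [← Fintype.piFinset_univ (α := Fin s) (β := fun _ => Fin M)]
    rw [← Fin.prod_const, Finset.prod_univ_sum]
    refine Finset.sum_congr rfl fun Z _ => ?_
    rw [Finset.mul_sum, Real.exp_sum]
  have h2 : ((Finset.univ.filter p).card : ℝ) * Real.exp (s * θ) ≤
      ∑ Z : Fin s → Fin M, Real.exp (l * ∑ t, X (Z t)) := by
    calc ((Finset.univ.filter p).card : ℝ) * Real.exp (s * θ)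
        = ∑ Z ∈ Finset.univ.filter p, Real.exp (s * θ) := by
          rw [Finset.sum_const, nsmul_eq_mul]
      _ ≤ ∑ Z ∈ Finset.univ.filter p, Real.exp (l * ∑ t, X (Z t)) :=
          Finset.sum_le_sum fun Z hZ => Real.exp_le_exp.2 (hp Z (Finset.mem_filter.1 hZ).2)
      _ ≤ _ := Finset.sum_le_sum_of_subset_of_nonneg (Finset.filter_subset _ _)
          fun _ _ _ => (Real.exp_pos _).le
  have h3 := pow_le_pow_left₀ (Finset.sum_nonneg fun z _ => (Real.exp_pos (l * X z)).le)
    (sum_exp_le hX hβ hsum hl) s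
  rw [← h1, mul_pow, ← Real.exp_nat_mul] at h3
  have h4 := h2.trans h3
  rw [← le_div_iff₀ (Real.exp_pos _)] at h4
  refine h4.trans (le_of_eq ?_)
  rw [mul_sub, Real.exp_sub]; ring

/-- The Chernoff bound for uniform sampling with replacement. -/
theorem chernoff {M s : ℕ} {X : Fin M → ℝ} {β η : ℝ} (hX : ∀ z, 0 ≤ X z) (hβ : ∀ z, X z ≤ β)
    (hsum : ∑ z, X z = M) (hβ0 : 0 < β) (hη : 0 < η) (hη1 : η ≤ 1) :
    ((Finset.univ.filter fun Z : Fin s → Fin M => s * η < |∑ t, X (Z t) - s|).card : ℝ) ≤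
      2 * Real.exp (-(s * η ^ 2 / (4 * β))) * (M : ℝ) ^ s := by
  -- This value minimises l²β - lη; the minimum is -η²/(4β).
  set l := η / (2 * β) with hl
  have hl0 : 0 < l := by positivity
  have hlβ : l * β = η / 2 := by rw [hl]; field_simp
  have e1 : l + l ^ 2 * β - l * (1 + η) = -(η ^ 2 / (4 * β)) := by rw [hl]; field_simp; ring
  have e2 : -l + (-l) ^ 2 * β - -l * (1 - η) = -(η ^ 2 / (4 * β)) := by rw [hl]; field_simp; ring
  have h1 := card_le_of_exp (s := s) (l := l) (θ := l * (1 + η)) hX hβ hsum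
    (by rw [abs_of_pos hl0]; linarith) (p := fun Z => s * (1 + η) ≤ ∑ t, X (Z t))
    (fun Z hZ => by nlinarith)
  have h2 := card_le_of_exp (s := s) (l := -l) (θ := -l * (1 - η)) hX hβ hsum
    (by rw [abs_neg, abs_of_pos hl0]; linarith) (p := fun Z => ∑ t, X (Z t) ≤ s * (1 - η))
    (fun Z hZ => by nlinarith)
  rw [e1] at h1
  rw [e2] at h2
  have h3 : (Finset.univ.filter fun Z : Fin s → Fin M => s * η < |∑ t, X (Z t) - s|) ⊆
      (Finset.univ.filter fun Z : Fin s → Fin M => s * (1 + η) ≤ ∑ t, X (Z t)) ∪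
      (Finset.univ.filter fun Z : Fin s → Fin M => ∑ t, X (Z t) ≤ s * (1 - η)) := by
    intro Z hZ
    have hZ := (Finset.mem_filter.1 hZ).2
    simp only [Finset.mem_union, Finset.mem_filter, Finset.mem_univ, true_and]
    rcases lt_abs.1 hZ with h | h
    · left; linarith
    · right; linarith
  have h4 : ((Finset.univ.filter fun Z : Fin s → Fin M => s * η < |∑ t, X (Z t) - s|).card : ℝ) ≤
      ((Finset.univ.filter fun Z : Fin s → Fin M => s * (1 + η) ≤ ∑ t, X (Z t)).card : ℝ) +
      ((Finset.univ.filter fun Z : Fin s → Fin M => ∑ t, X (Z t) ≤ s * (1 - η)).card : ℝ) := by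
    exact_mod_cast (Finset.card_le_card h3).trans (Finset.card_union_le _ _)
  refine h4.trans ((add_le_add h1 h2).trans (le_of_eq ?_))
  rw [show (s : ℝ) * -(η ^ 2 / (4 * β)) = -(s * η ^ 2 / (4 * β)) by ring]
  ring

/-- The Chernoff bound for |b · x|/N. For N = 0 all summands vanish and nothing deviates. -/
theorem card_deviation {M s d : ℕ} {b : Fin M → ℕ → ℝ} {x : ℕ → ℝ} {N β η : ℝ} (hN : 0 ≤ N)
    (hmean : ∑ z, |dot d (b z) x| = M * N) (hb : ∀ z, |dot d (b z) x| ≤ β * N)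
    (hβ0 : 0 < β) (hη : 0 < η) (hη1 : η ≤ 1) :
    ((Finset.univ.filter fun Z : Fin s → Fin M =>
      s * (η * N) < |∑ t, |dot d (b (Z t)) x| - s * N|).card : ℝ) ≤
      2 * Real.exp (-(s * η ^ 2 / (4 * β))) * (M : ℝ) ^ s := by
  rcases hN.eq_or_lt with h0 | h0
  · have h1 : ∀ z, |dot d (b z) x| = 0 := fun z =>
      le_antisymm (by have := hb z; rwa [← h0, mul_zero] at this) (abs_nonneg _)
    rw [Finset.filter_eq_empty_iff.2 fun Z _ => by simp [h1, ← h0]]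
    simp only [Finset.card_empty, Nat.cast_zero]
    positivity
  · have h1 := chernoff (s := s) (X := fun z => |dot d (b z) x| / N) (β := β) (η := η)
      (fun z => by positivity) (fun z => (div_le_iff₀ h0).2 (hb z))
      (by rw [← Finset.sum_div, hmean]; field_simp) hβ0 hη hη1
    refine le_trans (le_of_eq ?_) h1
    congr 2
    refine Finset.filter_congr fun Z _ => ?_
    rw [← Finset.sum_div]
    have e : ∑ t, |dot d (b (Z t)) x| - s * N = ((∑ t, |dot d (b (Z t)) x|) / N - s) * N := by
      field_simp
    rw [e, abs_mul, abs_of_pos h0, ← mul_assoc]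
    exact mul_lt_mul_iff_left₀ h0

/-- A Lipschitz estimate in frame coordinates, applied both to the true norm and to the sampled one.
-/
theorem abs_sum_dot_sub_le {ι : Type*} (I : Finset ι) (b : ι → ℕ → ℝ) (d : ℕ) (F : ℕ → ℕ → ℝ)
    (y y' : ℕ → ℝ) :
    |(∑ i ∈ I, |dot d (b i) (comb d F y)|) - (∑ i ∈ I, |dot d (b i) (comb d F y')|)| ≤
      ∑ k ∈ Finset.range d, |y k - y' k| * ∑ i ∈ I, |dot d (b i) (F k)| := by
  rw [← Finset.sum_sub_distrib]
  refine (Finset.abs_sum_le_sum_abs _ _).trans ?_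
  have h1 : ∀ i ∈ I, |(|dot d (b i) (comb d F y)| - |dot d (b i) (comb d F y')|)| ≤
      ∑ k ∈ Finset.range d, |y k - y' k| * |dot d (b i) (F k)| := by
    intro i _
    refine (abs_abs_sub_abs_le_abs_sub _ _).trans ?_
    rw [dot_comb, dot_comb, ← Finset.sum_sub_distrib]
    refine (Finset.abs_sum_le_sum_abs _ _).trans (le_of_eq ?_)
    exact Finset.sum_congr rfl fun k _ => by rw [← abs_mul]; congr 1; ring
  refine (Finset.sum_le_sum h1).trans (le_of_eq ?_)
  rw [Finset.sum_comm]
  exact Finset.sum_congr rfl fun k _ => by rw [Finset.mul_sum]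

/-- The point of `[-1, 1]ᵈ` given by grid coordinates. -/
noncomputable def gridPoint (G d : ℕ) (g : Fin d → Fin (2 * G + 1)) : ℕ → ℝ := fun k =>
  if h : k < d then (((g ⟨k, h⟩ : ℕ) : ℝ) - G) / G else 0

theorem exists_gridPoint {G d : ℕ} (hG : 0 < G) (J : Finset ℕ) (y : ℕ → ℝ) (N : ℝ) (hN : 0 < N)
    (hy : ∀ k ∈ J, |y k| ≤ N) :
    ∃ g : Fin d → Fin (2 * G + 1), ∀ k < d, k ∈ J → |y k - N * gridPoint G d g k| ≤ N / G := by
  have hG' : (0 : ℝ) < G := by exact_mod_cast hG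
  have key : ∀ k : ℕ, ∃ m : Fin (2 * G + 1), k ∈ J → |y k - N * (((m : ℕ) : ℝ) - G) / G| ≤ N / G := by
    intro k
    by_cases hk : k ∈ J
    · have h1 := abs_le.1 (hy k hk)
      -- Grid coordinates are shifted by `G` to be natural numbers; the coordinate is rounded down
      -- to mesh N/G.
      set r := G * (y k / N) + G with hr
      have h2 : -1 ≤ y k / N := by rw [le_div_iff₀ hN]; linarith
      have h3 : y k / N ≤ 1 := by rw [div_le_one hN]; exact h1.2
      have hr0 : 0 ≤ r := by nlinarith
      have hr1 : r ≤ 2 * G := by nlinarith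
      have hm : ⌊r⌋₊ < 2 * G + 1 := by
        have : (⌊r⌋₊ : ℝ) ≤ (2 * G : ℕ) := (Nat.floor_le hr0).trans (by push_cast; exact hr1)
        have := Nat.cast_le.1 this
        omega
      refine ⟨⟨⌊r⌋₊, hm⟩, fun _ => ?_⟩
      have h4 := Nat.floor_le hr0
      have h5 := Nat.lt_floor_add_one r
      have e : y k - N * ((⌊r⌋₊ : ℝ) - G) / G = N / G * (r - ⌊r⌋₊) := by
        rw [hr]; field_simp; ring
      change |y k - N * ((⌊r⌋₊ : ℝ) - G) / G| ≤ N / G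
      rw [e, abs_of_nonneg (mul_nonneg (by positivity) (by linarith))]
      exact mul_le_of_le_one_right (by positivity) (by linarith)
    · exact ⟨0, fun h => absurd h hk⟩
  choose m hm using key
  refine ⟨fun k => m k, fun k hk hkJ => ?_⟩
  simp only [gridPoint, hk, dif_pos]
  rw [← mul_div_assoc]
  exact hm k hkJ

/-- A family of rows whose sum of absolute inner products is close to `N` at all grid points is
close everywhere. -/
theorem IsRounding.close_of_grid {d s G : ℕ} {a : ℕ → ℕ → ℝ} {S : Finset ℕ} {F : ℕ → ℕ → ℝ}
    {J : Finset ℕ} {b : Fin s → ℕ → ℝ} {ε β : ℝ} (h : IsRounding d a S (4 * d) F J) (hd : 1 ≤ d)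
    (hε : 0 < ε) (hε1 : ε < 1) (hG : 16 * (d : ℝ) ^ 2 ≤ ε * G)
    (hb : ∀ t x, |dot d (b t) x| ≤ β * rowNorm d a S x)
    (hgrid : ∀ g : Fin d → Fin (2 * G + 1),
      |∑ t, |dot d (b t) (comb d F (gridPoint G d g))| -
        s * rowNorm d a S (comb d F (gridPoint G d g))| ≤
      s * (ε / 4 * rowNorm d a S (comb d F (gridPoint G d g)))) (x : ℕ → ℝ) :
    |∑ t, |dot d (b t) x| - s * rowNorm d a S x| ≤ s * (ε * rowNorm d a S x) := by
  have hd' : (1 : ℝ) ≤ d := by exact_mod_cast hd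
  have hG0 : (0 : ℝ) < G := by
    by_contra hc
    have : ε * G ≤ 0 := mul_nonpos_of_nonneg_of_nonpos hε.le (not_lt.1 hc)
    nlinarith
  have hGn : 0 < G := by exact_mod_cast hG0
  obtain ⟨y, hy⟩ := h.spans x
  rw [rowNorm_congr a S hy, Finset.sum_congr rfl fun t _ => by rw [dot_congr (b t) hy]]
  set N := rowNorm d a S (comb d F y) with hN
  rcases (rowNorm_nonneg d a S (comb d F y)).eq_or_lt with h0 | h0
  · have h1 : ∀ t, |dot d (b t) (comb d F y)| = 0 := fun t =>
      le_antisymm (by have := hb t (comb d F y); rwa [← h0, mul_zero] at this) (abs_nonneg _)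
    rw [← hN] at h0
    simp [h1, ← h0]
  rw [← hN] at h0
  have hyk : ∀ k ∈ J, |y k| ≤ N := by
    intro k hk
    refine abs_le_of_sq_le_sq ?_ h0.le
    exact (Finset.single_le_sum (f := fun k => y k ^ 2) (fun _ _ => sq_nonneg _) hk).trans
      (h.lower y)
  obtain ⟨g, hg⟩ := exists_gridPoint (d := d) hGn J y N h0 hyk
  have hbasis : ∀ k < d, rowNorm d a S (F k) ≤ 2 * d ∧ (k ∉ J → rowNorm d a S (F k) = 0) := by
    intro k hk
    have h1 := h.rowNorm_basis (by positivity) hk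
    refine ⟨h1.1.trans ?_, h1.2⟩
    rw [Real.sqrt_le_iff]
    exact ⟨by positivity, by nlinarith⟩
  -- The basis vectors are grid points themselves (index 2G is the coordinate 1, index G the
  -- coordinate 0), which controls the sampled norm of each of them before anything is known off the
  -- grid.
  have hsbasis : ∀ k < d, ∑ t, |dot d (b t) (F k)| ≤ s * (2 * rowNorm d a S (F k)) := by
    intro k hk
    set e : Fin d → Fin (2 * G + 1) := fun k' => if (k' : ℕ) = k then ⟨2 * G, by omega⟩
      else ⟨G, by omega⟩ with he
    have h3 : ∀ c, dot d c (comb d F (gridPoint G d e)) = dot d c (F k) := by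
      intro c
      rw [dot_comb, Finset.sum_eq_single k]
      · simp only [gridPoint, hk, dif_pos, he, if_true]
        push_cast
        field_simp; ring
      · intro k' hk' hne
        simp [gridPoint, Finset.mem_range.1 hk', he, hne]
      · intro h'; exact absurd (Finset.mem_range.2 hk) h'
    have h4 := hgrid e
    simp only [rowNorm, h3] at h4
    have h5 := (abs_le.1 h4).2
    have h6 : 0 ≤ (s : ℝ) * rowNorm d a S (F k) :=
      mul_nonneg (Nat.cast_nonneg _) (rowNorm_nonneg _ _ _ _)
    simp only [rowNorm] at h6 ⊢
    nlinarith
  set y' : ℕ → ℝ := fun k => N * gridPoint G d g k with hy'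
  have hscale : ∀ c, |dot d c (comb d F y')| = N * |dot d c (comb d F (gridPoint G d g))| := by
    intro c
    have : dot d c (comb d F y') = N * dot d c (comb d F (gridPoint G d g)) := by
      rw [dot_comb, dot_comb, Finset.mul_sum]
      exact Finset.sum_congr rfl fun k _ => by simp only [hy']; ring
    rw [this, abs_mul, abs_of_pos h0]
  have hterm : ∀ k ∈ Finset.range d, |y k - y' k| * rowNorm d a S (F k) ≤ N / G * (2 * d) := by
    intro k hk
    have hk' := Finset.mem_range.1 hk
    by_cases hkJ : k ∈ J
    · exact mul_le_mul (hg k hk' hkJ) (hbasis k hk').1 (rowNorm_nonneg _ _ _ _) (by positivity)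
    · rw [(hbasis k hk').2 hkJ, mul_zero]; positivity
  -- Coordinates outside `J` cost nothing since their vectors are null; each of the others costs at
  -- most (N/G) · 2d. The sum 2d²N/G is at most εN/8 by the choice of `G`.
  have hsumterm : ∑ k ∈ Finset.range d, |y k - y' k| * rowNorm d a S (F k) ≤ ε / 8 * N := by
    refine (Finset.sum_le_sum hterm).trans ?_
    rw [Finset.sum_const, Finset.card_range, nsmul_eq_mul]
    have : (d : ℝ) * (N / G * (2 * d)) = 2 * d ^ 2 * N / G := by ring
    rw [this, div_le_iff₀ hG0]
    nlinarith
  have hA := (abs_sum_dot_sub_le S a d F y y').trans hsumterm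
  have hB := (abs_sum_dot_sub_le Finset.univ b d F y y').trans
    ((Finset.sum_le_sum fun k hk => mul_le_mul_of_nonneg_left
      (hsbasis k (Finset.mem_range.1 hk)) (abs_nonneg (y k - y' k))).trans
      (le_of_eq (Finset.sum_congr rfl fun k _ =>
        show |y k - y' k| * (s * (2 * rowNorm d a S (F k))) =
          2 * s * (|y k - y' k| * rowNorm d a S (F k)) by ring)))
  rw [← Finset.mul_sum] at hB
  have hB' := hB.trans (mul_le_mul_of_nonneg_left hsumterm (by positivity : (0:ℝ) ≤ 2 * s))
  have hC := hgrid g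
  have e1 : ∑ i ∈ S, |dot d (a i) (comb d F y')| =
      N * rowNorm d a S (comb d F (gridPoint G d g)) := by
    rw [rowNorm, Finset.mul_sum]; exact Finset.sum_congr rfl fun i _ => hscale _
  have e2 : ∑ t, |dot d (b t) (comb d F y')| =
      N * ∑ t, |dot d (b t) (comb d F (gridPoint G d g))| := by
    rw [Finset.mul_sum]; exact Finset.sum_congr rfl fun i _ => hscale _
  set P := rowNorm d a S (comb d F (gridPoint G d g)) with hP
  set Q := ∑ t, |dot d (b t) (comb d F (gridPoint G d g))| with hQ
  rw [e1] at hA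
  rw [e2] at hB'
  change |N - N * P| ≤ ε / 8 * N at hA
  set q := ∑ t, |dot d (b t) (comb d F y)| with hq
  have hs0 : (0 : ℝ) ≤ s := Nat.cast_nonneg _
  have hP2 : N * P ≤ 2 * N := by
    have := (abs_le.1 hA).1
    nlinarith
  -- Rounding in the sampled norm, deviation at the grid point, and rounding in the true norm
  -- contribute 1/4, 1/2 and 1/8 of sεN.
  have t1 : |q - s * N| ≤ |q - N * Q| + |N * (Q - s * P)| + |s * (N * P - N)| := by
    have : q - s * N = (q - N * Q) + N * (Q - s * P) + s * (N * P - N) := by ring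
    rw [this]; exact abs_add_three _ _ _
  have t2 : |N * (Q - s * P)| ≤ s * (ε / 2 * N) := by
    rw [abs_mul, abs_of_pos h0]
    calc N * |Q - s * P| ≤ N * (s * (ε / 4 * P)) := mul_le_mul_of_nonneg_left hC h0.le
      _ = s * (ε / 4) * (N * P) := by ring
      _ ≤ s * (ε / 4) * (2 * N) := mul_le_mul_of_nonneg_left hP2 (by positivity)
      _ = _ := by ring
  have t3 : |s * (N * P - N)| ≤ s * (ε / 8 * N) := by
    rw [abs_mul, abs_of_nonneg hs0, abs_sub_comm]
    exact mul_le_mul_of_nonneg_left hA hs0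
  have t4 : 0 ≤ s * (ε * N) := by positivity
  have t5 : 2 * s * (ε / 8 * N) = (s * (ε * N)) / 4 := by ring
  have t6 : s * (ε / 2 * N) = (s * (ε * N)) / 2 := by ring
  have t7 : s * (ε / 8 * N) = (s * (ε * N)) / 8 := by ring
  linarith

open Classical in
/-- Uniform sampling of rows of bounded sensitivity embeds the `ℓ₁` column space, except on few
samples. -/
theorem card_not_embeds {d M s q ℓ : ℕ} {a : ℕ → ℕ → ℝ} {S : Finset ℕ} {b : Fin M → ℕ → ℝ} {ε : ℝ}
    (hd : 1 ≤ d) (hne : ∀ i ∈ S, ∃ l < d, a i l ≠ 0) (hε : 0 < ε) (hε1 : ε < 1)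
    (hq : 1 ≤ q * ε * ε) (hℓ : 2 ≤ 2 ^ ℓ * ε) (hs : s = 1000000 * d ^ 7 * ℓ * q)
    (hmean : ∀ x, ∑ z, |dot d (b z) x| = M * rowNorm d a S x)
    (hb : ∀ z x, |dot d (b z) x| ≤ 960 * d ^ 5 * rowNorm d a S x) :
    20 * ((Finset.univ.filter fun Z : Fin s → Fin M => ¬ ∀ x,
      |∑ t, |dot d (b (Z t)) x| - s * rowNorm d a S x| ≤ s * (ε * rowNorm d a S x)).card : ℝ) ≤
      (M : ℝ) ^ s := by
  have hd' : (1 : ℝ) ≤ d := by exact_mod_cast hd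
  obtain ⟨F, J, h⟩ := exists_isRounding hd a S hne
  set G := ⌈16 * (d : ℝ) ^ 2 / ε⌉₊ with hG
  have hG1 : 16 * (d : ℝ) ^ 2 ≤ ε * G := by
    have := Nat.le_ceil (16 * (d : ℝ) ^ 2 / ε)
    rw [div_le_iff₀ hε] at this
    linarith
  have hℓ1 : 1 ≤ ℓ := by
    rcases Nat.eq_zero_or_pos ℓ with h0 | h0
    · rw [h0, pow_zero, one_mul] at hℓ; linarith
    · exact h0
  set E := 2 * Real.exp (-(s * (ε / 4) ^ 2 / (4 * (960 * (d : ℝ) ^ 5)))) * (M : ℝ) ^ s with hE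
  have hsub : (Finset.univ.filter fun Z : Fin s → Fin M => ¬ ∀ x,
      |∑ t, |dot d (b (Z t)) x| - s * rowNorm d a S x| ≤ s * (ε * rowNorm d a S x)) ⊆
      Finset.univ.biUnion fun g : Fin d → Fin (2 * G + 1) =>
        Finset.univ.filter fun Z : Fin s → Fin M =>
          s * (ε / 4 * rowNorm d a S (comb d F (gridPoint G d g))) <
            |∑ t, |dot d (b (Z t)) (comb d F (gridPoint G d g))| -
              s * rowNorm d a S (comb d F (gridPoint G d g))| := by
    intro Z hZ
    have hZ := (Finset.mem_filter.1 hZ).2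
    by_contra hc
    simp only [Finset.mem_biUnion, Finset.mem_filter, Finset.mem_univ, true_and, not_exists,
      not_lt] at hc
    exact hZ (h.close_of_grid (b := fun t => b (Z t)) hd hε hε1 hG1 (fun t x => hb (Z t) x) hc)
  have h1 : ((Finset.univ.filter fun Z : Fin s → Fin M => ¬ ∀ x,
      |∑ t, |dot d (b (Z t)) x| - s * rowNorm d a S x| ≤ s * (ε * rowNorm d a S x)).card : ℝ) ≤
      (2 * G + 1 : ℕ) ^ d * E := by
    have h2 : ((Finset.univ.biUnion fun g : Fin d → Fin (2 * G + 1) =>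
        Finset.univ.filter fun Z : Fin s → Fin M =>
          s * (ε / 4 * rowNorm d a S (comb d F (gridPoint G d g))) <
            |∑ t, |dot d (b (Z t)) (comb d F (gridPoint G d g))| -
              s * rowNorm d a S (comb d F (gridPoint G d g))|).card : ℝ) ≤
        ∑ g : Fin d → Fin (2 * G + 1), E := by
      refine le_trans (Nat.cast_le.2 Finset.card_biUnion_le) ?_
      rw [Nat.cast_sum]
      refine Finset.sum_le_sum fun g _ => ?_
      exact card_deviation (rowNorm_nonneg _ _ _ _) (hmean _) (fun z => hb z _) (by positivity)
        (by positivity) (by linarith)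
    refine le_trans (Nat.cast_le.2 (Finset.card_le_card hsub)) (h2.trans (le_of_eq ?_))
    rw [Finset.sum_const, nsmul_eq_mul]
    simp
  -- The constant 1000000 in `s` exceeds 16 · 4² · 4 · 960 = 983040.
  have hexp : 16 * (d : ℝ) ^ 2 * ℓ ≤ s * (ε / 4) ^ 2 / (4 * (960 * (d : ℝ) ^ 5)) := by
    rw [le_div_iff₀ (by positivity), hs]
    push_cast
    have h3 : (0 : ℝ) ≤ (d : ℝ) ^ 7 * ℓ := by positivity
    nlinarith [mul_le_mul_of_nonneg_left hq h3]
  have hGb : ((2 * G + 1 : ℕ) : ℝ) ≤ 2 ^ (5 + 2 * d + ℓ) := by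
    have h3 : (G : ℝ) < 16 * (d : ℝ) ^ 2 / ε + 1 := Nat.ceil_lt_add_one (by positivity)
    have h4 : 1 / ε ≤ 2 ^ ℓ / 2 := by rw [div_le_div_iff₀ hε two_pos]; linarith
    have h5 : (d : ℝ) ^ 2 ≤ 2 ^ (2 * d) := by
      rw [mul_comm 2 d, pow_mul]
      exact pow_le_pow_left₀ (by positivity) (by exact_mod_cast Nat.lt_two_pow_self.le) 2
    have h6 : (1 : ℝ) ≤ 1 / ε := by rw [le_div_iff₀ hε]; linarith
    have h7 : (0 : ℝ) < 2 ^ ℓ := by positivity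
    have h8 : (d : ℝ) ^ 2 * (1 / ε) ≤ 2 ^ (2 * d) * (2 ^ ℓ / 2) := by gcongr
    have h9 : (1 : ℝ) ≤ (d : ℝ) ^ 2 * (1 / ε) := by nlinarith
    rw [pow_add, pow_add]
    push_cast
    have h10 : 16 * (d : ℝ) ^ 2 / ε = 16 * ((d : ℝ) ^ 2 * (1 / ε)) := by ring
    rw [h10] at h3
    nlinarith
  -- The number of grid points is at most 2 to the power (5 + 2d + ℓ)d. The factor 40 is 20 for the
  -- failure rate times 2 for the two tails.
  have hpow : 40 * ((2 * G + 1 : ℕ) : ℝ) ^ d ≤ Real.exp (16 * (d : ℝ) ^ 2 * ℓ) := by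
    calc 40 * ((2 * G + 1 : ℕ) : ℝ) ^ d ≤ 2 ^ 6 * (2 ^ (5 + 2 * d + ℓ)) ^ d := by
          gcongr; norm_num
      _ = 2 ^ (6 + (5 + 2 * d + ℓ) * d) := by rw [← pow_mul, ← pow_add]
      _ ≤ 2 ^ (16 * d ^ 2 * ℓ) := by
          refine pow_le_pow_right₀ one_le_two ?_
          have a1 : d ≤ d ^ 2 * ℓ := by nlinarith [Nat.mul_le_mul hd hℓ1, Nat.mul_le_mul hd hd]
          have a2 : d * ℓ ≤ d ^ 2 * ℓ := Nat.mul_le_mul_right _ (by nlinarith)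
          have a3 : d ^ 2 ≤ d ^ 2 * ℓ := Nat.le_mul_of_pos_right _ hℓ1
          nlinarith
      _ ≤ Real.exp 1 ^ (16 * d ^ 2 * ℓ) := by
          refine pow_le_pow_left₀ zero_le_two ?_ _
          have := Real.add_one_le_exp (1 : ℝ)
          linarith
      _ = Real.exp (16 * (d : ℝ) ^ 2 * ℓ) := by
          rw [← Real.exp_nat_mul]; push_cast; ring_nf
  have hM : (0 : ℝ) ≤ (M : ℝ) ^ s := by positivity
  have hfin : 40 * ((2 * G + 1 : ℕ) : ℝ) ^ d *
      Real.exp (-(s * (ε / 4) ^ 2 / (4 * (960 * (d : ℝ) ^ 5)))) ≤ 1 := by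
    calc _ ≤ Real.exp (16 * (d : ℝ) ^ 2 * ℓ) * Real.exp (-(16 * (d : ℝ) ^ 2 * ℓ)) :=
          mul_le_mul hpow (Real.exp_le_exp.2 (neg_le_neg hexp)) (Real.exp_pos _).le
            (Real.exp_pos _).le
      _ = 1 := by rw [← Real.exp_add]; simp
  calc _ ≤ 20 * (((2 * G + 1 : ℕ) : ℝ) ^ d * E) := mul_le_mul_of_nonneg_left h1 (by norm_num)
    _ = 40 * ((2 * G + 1 : ℕ) : ℝ) ^ d *
      Real.exp (-(s * (ε / 4) ^ 2 / (4 * (960 * (d : ℝ) ^ 5)))) * (M : ℝ) ^ s := by rw [hE]; ring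
    _ ≤ 1 * (M : ℝ) ^ s := mul_le_mul_of_nonneg_right hfin hM
    _ = _ := one_mul _

namespace RealRAM

/-! ### The random tape -/

theorem belowOf_lt (m : ℕ) (u : unitInterval) : belowOf (m + 1) u < m + 1 :=
  lt_of_le_of_lt (min_le_right _ _) (by omega)

/-- A number of the unit interval that yields the drawn value `v`. -/
theorem exists_belowOf_eq {m v : ℕ} (h : v < m) : ∃ u : unitInterval, belowOf m u = v := by
  have hm : (0 : ℝ) < m := by exact_mod_cast (by omega : 0 < m)
  refine ⟨⟨v / m, by positivity, ?_⟩, ?_⟩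
  · rw [div_le_one hm]; exact_mod_cast h.le
  · simp only [belowOf]
    rw [mul_div_cancel₀ _ hm.ne', Nat.floor_natCast]
    omega

/-- The interval of the numbers that yield the drawn value `v`. -/
def belowSet (m v : ℕ) : Set unitInterval :=
  Subtype.val ⁻¹' Set.Icc ((v : ℝ) / m) ((v + 1) / m)

theorem mem_belowSet {m v : ℕ} (hm : 0 < m) {u : unitInterval} (h : belowOf m u = v) :
    u ∈ belowSet m v := by
  have hm' : (0 : ℝ) < m := by exact_mod_cast hm
  have hmu : 0 ≤ (m : ℝ) * u := mul_nonneg hm'.le u.2.1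
  have h1 : (v : ℝ) ≤ m * u := by
    rw [← h]
    exact (Nat.cast_le.2 (min_le_left _ _)).trans (Nat.floor_le hmu)
  have h2 : m * (u : ℝ) ≤ v + 1 := by
    rcases le_total ⌊(m : ℝ) * u⌋₊ (m - 1) with hle | hle
    · have : v = ⌊(m : ℝ) * u⌋₊ := by rw [← h, belowOf, min_eq_left hle]
      rw [this]; exact (Nat.lt_floor_add_one _).le
    · have : v = m - 1 := by rw [← h, belowOf, min_eq_right hle]
      have hv : ((v + 1 : ℕ) : ℝ) = m := by congr 1; omega
      push_cast at hv
      rw [hv]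
      exact mul_le_of_le_one_right hm'.le u.2.2
  exact ⟨by rw [div_le_iff₀ hm']; linarith, by rw [le_div_iff₀ hm']; linarith⟩

theorem measurableSet_belowSet (m v : ℕ) : MeasurableSet (belowSet m v) :=
  measurable_subtype_coe measurableSet_Icc

theorem volume_belowSet_le (m v : ℕ) : volume (belowSet m v) ≤ (m : ENNReal)⁻¹ := by
  rw [unitInterval.volume_apply]
  refine (measure_mono (Set.image_preimage_subset _ _)).trans ?_
  rw [Real.volume_Icc, ← sub_div, add_sub_cancel_left, one_div]
  rcases Nat.eq_zero_or_pos m with rfl | hm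
  · simp
  · rw [ENNReal.ofReal_inv_of_pos (by exact_mod_cast hm), ENNReal.ofReal_natCast]

/-- Draws at distinct positions are independent. An upper bound suffices, so closed intervals can be
used without regard to their endpoints. -/
theorem tapeMeasure_cylinder_le {ι : Type*} [Fintype ι] {pos : ι → ℕ}
    (hpos : Function.Injective pos) {m x : ι → ℕ} (hm : ∀ i, 0 < m i) :
    tapeMeasure {ω | ∀ i, belowOf (m i) (ω (pos i)) = x i} ≤ ∏ i, (m i : ENNReal)⁻¹ := by
  classical
  set t : ℕ → Set unitInterval :=
    Function.extend pos (fun i => belowSet (m i) (x i)) (fun _ => Set.univ) with ht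
  have hti : ∀ i, t (pos i) = belowSet (m i) (x i) := fun i => hpos.extend_apply _ _ i
  have h1 : {ω : Tape | ∀ i, belowOf (m i) (ω (pos i)) = x i} ⊆
      Set.pi (Finset.univ.image pos : Finset ℕ) t := by
    intro ω hω p hp
    obtain ⟨i, _, rfl⟩ := Finset.mem_image.1 hp
    rw [hti]
    exact mem_belowSet (hm i) (hω i)
  refine (measure_mono h1).trans ?_
  rw [tapeMeasure, Measure.infinitePi_pi, Finset.prod_image fun i _ j _ h => hpos h]
  · exact Finset.prod_le_prod' fun i _ => by rw [hti]; exact volume_belowSet_le _ _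
  · intro p hp
    obtain ⟨i, _, rfl⟩ := Finset.mem_image.1 hp
    rw [hti]; exact measurableSet_belowSet _ _

/-- The values below `m + 1` drawn at the `n` positions from `p` on. -/
noncomputable def drawn (m p n : ℕ) (ω : Tape) : Fin n → Fin (m + 1) :=
  fun i => ⟨belowOf (m + 1) (ω (p + i)), belowOf_lt _ _⟩

/-- The values below `m + 1` drawn in `T` consecutive groups of `d` positions from `p` on. -/
noncomputable def drawnGroups (m p T d : ℕ) (ω : Tape) : Fin T → Fin d → Fin (m + 1) :=
  fun t k => ⟨belowOf (m + 1) (ω (p + (t * d + k))), belowOf_lt _ _⟩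

/-- The three stages read consecutive, disjoint blocks of the tape, so a prescribed outcome has at
most its uniform probability. -/
theorem tapeMeasure_fiber_le {R D T d s M : ℕ} (x : Fin R → Fin (D + 1))
    (y : Fin T → Fin d → Fin 2) (z : Fin s → Fin (M + 1)) :
    tapeMeasure {ω | drawn D 0 R ω = x ∧ drawnGroups 1 R T d ω = y ∧
      drawn M (R + T * d) s ω = z} ≤
      ((((D + 1) ^ R * (2 ^ d) ^ T * (M + 1) ^ s : ℕ)) : ENNReal)⁻¹ := by
  have hlt : ∀ (t : Fin T) (k : Fin d), (t : ℕ) * d + k < T * d := by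
    intro t k
    calc (t : ℕ) * d + k < t * d + d := by omega
      _ = (t + 1) * d := by ring
      _ ≤ T * d := Nat.mul_le_mul_right _ t.2
  set pos : Fin R ⊕ (Fin T × Fin d) ⊕ Fin s → ℕ :=
    Sum.elim (fun i => (i : ℕ)) (Sum.elim (fun p => R + ((p.1 : ℕ) * d + p.2))
      (fun j => R + T * d + j)) with hposdef
  set m : Fin R ⊕ (Fin T × Fin d) ⊕ Fin s → ℕ :=
    Sum.elim (fun _ => D + 1) (Sum.elim (fun _ => 2) (fun _ => M + 1)) with hmdef
  set v : Fin R ⊕ (Fin T × Fin d) ⊕ Fin s → ℕ :=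
    Sum.elim (fun i => (x i : ℕ)) (Sum.elim (fun p => (y p.1 p.2 : ℕ)) (fun j => (z j : ℕ)))
    with hvdef
  have hinj : Function.Injective pos := by
    rintro (i | ⟨t, k⟩ | j) (i' | ⟨t', k'⟩ | j') h
    · simp only [hposdef, Sum.elim_inl] at h; rw [Fin.ext h]
    · simp only [hposdef, Sum.elim_inl, Sum.elim_inr] at h; omega
    · simp only [hposdef, Sum.elim_inl, Sum.elim_inr] at h; omega
    · simp only [hposdef, Sum.elim_inl, Sum.elim_inr] at h; omega
    · simp only [hposdef, Sum.elim_inl, Sum.elim_inr] at h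
      have h' : (t : ℕ) * d + k = t' * d + k' := by omega
      -- Within the middle block a position determines its group and its place by division with
      -- remainder.
      have hk : (k : ℕ) = k' := by
        have := congrArg (· % d) h'
        simpa [Nat.mod_eq_of_lt k.2, Nat.mod_eq_of_lt k'.2] using this
      have hd : 0 < d := by have := k.2; omega
      have ht : (t : ℕ) = t' := by
        rw [hk] at h'
        exact Nat.eq_of_mul_eq_mul_right hd (by omega)
      rw [Fin.ext hk, Fin.ext ht]
    · simp only [hposdef, Sum.elim_inl, Sum.elim_inr] at h
      have := hlt t k; omega
    · simp only [hposdef, Sum.elim_inl, Sum.elim_inr] at h; omega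
    · simp only [hposdef, Sum.elim_inl, Sum.elim_inr] at h
      have := hlt t' k'; omega
    · simp only [hposdef, Sum.elim_inr] at h
      have : j = j' := Fin.ext (by omega)
      rw [this]
  have hm : ∀ i, 0 < m i := by
    rintro (i | ⟨t, k⟩ | j) <;> simp [hmdef]
  have h1 := tapeMeasure_cylinder_le hinj (m := m) (x := v) hm
  refine (measure_mono ?_).trans (h1.trans (le_of_eq ?_))
  · rintro ω ⟨rfl, rfl, rfl⟩
    rintro (i | ⟨t, k⟩ | j)
    · simp [hmdef, hvdef, hposdef, drawn]
    · simp [hmdef, hvdef, hposdef, drawnGroups]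
    · simp [hmdef, hvdef, hposdef, drawn]
  · rw [Fintype.prod_sum_type, Fintype.prod_sum_type]
    simp only [hmdef, Sum.elim_inl, Sum.elim_inr, Finset.prod_const, Finset.card_univ,
      Fintype.card_fin, Fintype.card_prod]
    push_cast
    rw [← ENNReal.inv_pow, ← ENNReal.inv_pow, ← ENNReal.inv_pow, ← pow_mul, mul_comm d T,
      ENNReal.mul_inv (by simp) (by simp), ENNReal.mul_inv (by simp) (by simp), mul_assoc]

-- Each stage only has to be good with respect to good outcomes of the earlier ones. The rates 1/20
-- and 1/20 of the last two stages add up to 1/10, and with the first stage to 1/5, which is below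
-- 1/3.
open Classical in
theorem card_three_stages {X Y Z : Type*} [Fintype X] [Fintype Y] [Fintype Z] (B₁ : X → Prop)
    (B₂ : X → Y → Prop) (B₃ : X → Y → Z → Prop)
    (h₁ : 10 * (Finset.univ.filter B₁).card ≤ Fintype.card X)
    (h₂ : ∀ x, ¬ B₁ x → 20 * (Finset.univ.filter (B₂ x)).card ≤ Fintype.card Y)
    (h₃ : ∀ x y, ¬ B₁ x → ¬ B₂ x y →
      20 * (Finset.univ.filter (B₃ x y)).card ≤ Fintype.card Z) :
    3 * (Finset.univ.filter fun p : X × Y × Z =>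
      B₁ p.1 ∨ B₂ p.1 p.2.1 ∨ B₃ p.1 p.2.1 p.2.2).card ≤
      Fintype.card X * (Fintype.card Y * Fintype.card Z) := by
  set bad : X × Y × Z → Prop := fun p => B₁ p.1 ∨ B₂ p.1 p.2.1 ∨ B₃ p.1 p.2.1 p.2.2 with hbad
  have e1 : (Finset.univ.filter bad).card =
      ∑ x : X, (Finset.univ.filter fun q : Y × Z => bad (x, q)).card := by
    rw [Finset.card_filter, Fintype.sum_prod_type]
    exact Finset.sum_congr rfl fun x _ => (Finset.card_filter _ _).symm
  have e2 : ∀ x : X, ¬ B₁ x → 10 * (Finset.univ.filter fun q : Y × Z => bad (x, q)).card ≤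
      Fintype.card Y * Fintype.card Z := by
    intro x hx
    have e3 : (Finset.univ.filter fun q : Y × Z => bad (x, q)).card =
        ∑ y : Y, (Finset.univ.filter fun z : Z => bad (x, y, z)).card := by
      rw [Finset.card_filter, Fintype.sum_prod_type]
      exact Finset.sum_congr rfl fun y _ => (Finset.card_filter _ _).symm
    have e4 : ∀ y : Y, 20 * (Finset.univ.filter fun z : Z => bad (x, y, z)).card ≤
        Fintype.card Z + if B₂ x y then 20 * Fintype.card Z else 0 := by
      intro y
      by_cases hy : B₂ x y
      · rw [if_pos hy]
        have := Finset.card_le_univ (Finset.univ.filter fun z : Z => bad (x, y, z))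
        omega
      · rw [if_neg hy, add_zero]
        refine le_trans (le_of_eq ?_) (h₃ x y hx hy)
        congr 2
        ext z
        simp [hbad, hx, hy]
    have e5 : 20 * ∑ y : Y, (Finset.univ.filter fun z : Z => bad (x, y, z)).card ≤
        Fintype.card Y * Fintype.card Z +
          (Finset.univ.filter (B₂ x)).card * (20 * Fintype.card Z) := by
      rw [Finset.mul_sum]
      refine (Finset.sum_le_sum fun y _ => e4 y).trans (le_of_eq ?_)
      rw [Finset.sum_add_distrib, ← Finset.sum_filter, Finset.sum_const, Finset.sum_const,
        Finset.card_univ, smul_eq_mul, smul_eq_mul]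
    rw [e3]
    have := Nat.mul_le_mul_right (Fintype.card Z) (h₂ x hx)
    nlinarith
  have e6 : ∀ x : X, 10 * (Finset.univ.filter fun q : Y × Z => bad (x, q)).card ≤
      Fintype.card Y * Fintype.card Z +
        if B₁ x then 10 * (Fintype.card Y * Fintype.card Z) else 0 := by
    intro x
    by_cases hx : B₁ x
    · rw [if_pos hx]
      have := Finset.card_le_univ (Finset.univ.filter fun q : Y × Z => bad (x, q))
      rw [Fintype.card_prod] at this
      omega
    · rw [if_neg hx, add_zero]; exact e2 x hx
  have e7 : 10 * ∑ x : X, (Finset.univ.filter fun q : Y × Z => bad (x, q)).card ≤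
      Fintype.card X * (Fintype.card Y * Fintype.card Z) +
        (Finset.univ.filter B₁).card * (10 * (Fintype.card Y * Fintype.card Z)) := by
    rw [Finset.mul_sum]
    refine (Finset.sum_le_sum fun x _ => e6 x).trans (le_of_eq ?_)
    rw [Finset.sum_add_distrib, ← Finset.sum_filter, Finset.sum_const, Finset.sum_const,
      Finset.card_univ, smul_eq_mul, smul_eq_mul]
  rw [e1]
  have := Nat.mul_le_mul_right (Fintype.card Y * Fintype.card Z) h₁
  nlinarith

open Classical in
/-- A union bound over three stages of independent draws. -/
theorem tapeMeasure_three_stages {R D T d s M : ℕ} (B₁ : (Fin R → Fin (D + 1)) → Prop)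
    (B₂ : (Fin R → Fin (D + 1)) → (Fin T → Fin d → Fin 2) → Prop)
    (B₃ : (Fin R → Fin (D + 1)) → (Fin T → Fin d → Fin 2) → (Fin s → Fin (M + 1)) → Prop)
    (h₁ : 10 * (Finset.univ.filter B₁).card ≤ Fintype.card (Fin R → Fin (D + 1)))
    (h₂ : ∀ x, ¬ B₁ x → 20 * (Finset.univ.filter (B₂ x)).card ≤ Fintype.card (Fin T → Fin d → Fin 2))
    (h₃ : ∀ x y, ¬ B₁ x → ¬ B₂ x y →
      20 * (Finset.univ.filter (B₃ x y)).card ≤ Fintype.card (Fin s → Fin (M + 1))) :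
    tapeMeasure {ω | B₁ (drawn D 0 R ω) ∨ B₂ (drawn D 0 R ω) (drawnGroups 1 R T d ω) ∨
      B₃ (drawn D 0 R ω) (drawnGroups 1 R T d ω) (drawn M (R + T * d) s ω)} ≤ 1 / 3 := by
  have hcard := card_three_stages B₁ B₂ B₃ h₁ h₂ h₃
  set bad : (Fin R → Fin (D + 1)) × (Fin T → Fin d → Fin 2) × (Fin s → Fin (M + 1)) → Prop :=
    fun p => B₁ p.1 ∨ B₂ p.1 p.2.1 ∨ B₃ p.1 p.2.1 p.2.2 with hbad
  set K : ℕ := (D + 1) ^ R * (2 ^ d) ^ T * (M + 1) ^ s with hK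
  have hKc : Fintype.card (Fin R → Fin (D + 1)) * (Fintype.card (Fin T → Fin d → Fin 2) *
      Fintype.card (Fin s → Fin (M + 1))) = K := by
    simp only [Fintype.card_fun, Fintype.card_fin, hK]; ring
  have hK0 : 0 < K := by positivity
  rw [hKc] at hcard
  have hsub : {ω | B₁ (drawn D 0 R ω) ∨ B₂ (drawn D 0 R ω) (drawnGroups 1 R T d ω) ∨
      B₃ (drawn D 0 R ω) (drawnGroups 1 R T d ω) (drawn M (R + T * d) s ω)} ⊆
      ⋃ p ∈ Finset.univ.filter bad, {ω | drawn D 0 R ω = p.1 ∧ drawnGroups 1 R T d ω = p.2.1 ∧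
        drawn M (R + T * d) s ω = p.2.2} := by
    intro ω hω
    refine Set.mem_biUnion (x := (drawn D 0 R ω, drawnGroups 1 R T d ω,
      drawn M (R + T * d) s ω)) ?_ ⟨rfl, rfl, rfl⟩
    exact Finset.mem_coe.2 (Finset.mem_filter.2 ⟨Finset.mem_univ _, hω⟩)
  refine (measure_mono hsub).trans ((measure_biUnion_finset_le _ _).trans ?_)
  refine (Finset.sum_le_sum fun p _ => tapeMeasure_fiber_le p.1 p.2.1 p.2.2).trans ?_
  rw [Finset.sum_const, nsmul_eq_mul, ← hK, ← div_eq_mul_inv]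
  refine ENNReal.div_le_of_le_mul ?_
  rw [one_div, ← ENNReal.div_eq_inv_mul,
    ENNReal.le_div_iff_mul_le (Or.inl (by norm_num)) (Or.inl (by norm_num))]
  calc ((Finset.univ.filter bad).card : ENNReal) * 3
      = ((3 * (Finset.univ.filter bad).card : ℕ) : ENNReal) := by push_cast; ring
    _ ≤ K := by exact_mod_cast hcard

end RealRAM

namespace RealRAM

attribute [local simp] Cmd.run NExp.eval RExp.eval BExp.holds State.setN State.setR State.storeN
  State.storeR State.advance Function.update_apply

/-! ### Numbering the nonempty rows -/

/-- Number the row indices that occur in the input: natural variable `4` counts them, array `4`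
lists them, and array `5` gives the number of the row of each entry. -/
def compactRows : Cmd :=
  .forN 13 (.var 2)
    (.seq (.nset 17 (.read 0 (.var 13)))
      (.seq (.ite (.nlt (.const 0) (.read 3 (.var 17))) .skip
          (.seq (.nstore 4 (.var 4) (.var 17))
            (.seq (.nset 4 (.add (.var 4) (.const 1))) (.nstore 3 (.var 17) (.var 4)))))
        (.nstore 5 (.var 13) (.sub (.read 3 (.var 17)) (.const 1)))))

/-- `rowOf` lists the `R` values that `row` takes below `N`, and `rid` gives their positions. -/
structure IsNumbering (N : ℕ) (row : ℕ → ℕ) (R : ℕ) (rowOf rid : ℕ → ℕ) : Prop where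
  le : R ≤ N
  lt : ∀ t < N, rid t < R
  rowOf_rid : ∀ t < N, rowOf (rid t) = row t
  surj : ∀ r < R, ∃ t < N, rid t = r
  inj : ∀ r < R, ∀ r' < R, rowOf r = rowOf r' → r = r'

/-- Array 3 holds the number of a row plus one, so that zero memory means unseen; array 4 is its
inverse. Only indices that occur are touched, and the time depends on the number of entries rather
than on n. -/
theorem compactRows_runs (ω : Tape) {σ : State} {N : ℕ} (hN : σ.nvar 2 = N) (h4 : σ.nvar 4 = 0)
    (h3 : ∀ i, σ.narr 3 i = 0) :
    Runs ω compactRows σ (100 * (N + 1)) (fun τ =>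
      IsNumbering N (σ.narr 0) (τ.nvar 4) (τ.narr 4) (τ.narr 5)) := by
  refine (Runs.forN (N := N) (B := 40) (Inv := fun k τ =>
    IsNumbering k (σ.narr 0) (τ.nvar 4) (τ.narr 4) (τ.narr 5) ∧ (∀ i, τ.narr 3 i ≤ τ.nvar 4) ∧
    (∀ i, 0 < τ.narr 3 i → τ.narr 4 (τ.narr 3 i - 1) = i) ∧
    (∀ r < τ.nvar 4, τ.narr 3 (τ.narr 4 r) = r + 1)) rfl ?_ ?_ ?_).mono ?_ ?_
  · intro τ hF
    exact (hF.nvar 2 rfl).trans hN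
  · simp only [State.setN, Function.update_apply, h4, h3]
    refine ⟨⟨?_, ?_, ?_, ?_, ?_⟩, ?_, ?_, ?_⟩ <;> simp
  · rintro k hk τ hF hi ⟨hnum, h3le, h3pos, h34⟩
    have hrow : τ.narr 0 = σ.narr 0 := hF.narr 0 rfl
    refine Runs.of_loopFree rfl (by decide) ?_
    by_cases hz : 0 < τ.narr 3 (σ.narr 0 k)
    · have hr := h3pos _ hz
      have hle := h3le (σ.narr 0 k)
      simp [hi, hrow, hz]
      refine ⟨⟨by have := hnum.le; omega, ?_, ?_, ?_, hnum.inj⟩, h3le, h3pos, h34⟩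
      · intro t ht
        simp only [Function.update_apply]
        split_ifs with h
        · omega
        · exact hnum.lt t (by omega)
      · intro t ht
        simp only [Function.update_apply]
        split_ifs with h
        · rw [h, hr]
        · exact hnum.rowOf_rid t (by omega)
      · intro r hr
        obtain ⟨t, ht, rfl⟩ := hnum.surj r hr
        exact ⟨t, by omega, by rw [Function.update_of_ne (by omega)]⟩
    · have hz0 : τ.narr 3 (σ.narr 0 k) = 0 := by omega
      have hnew : ∀ r < τ.nvar 4, τ.narr 4 r ≠ σ.narr 0 k := by
        intro r hr h
        have := h34 r hr
        rw [h] at this; omega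
      simp [hi, hrow, hz0]
      refine ⟨⟨?_, ?_, ?_, ?_, ?_⟩, ?_, ?_, ?_⟩
      · have := hnum.le; omega
      · intro t ht
        simp only [Function.update_apply]
        split_ifs with h
        · omega
        · have := hnum.lt t (by omega); omega
      · intro t ht
        simp only [Function.update_apply]
        split_ifs with h h' h'
        · rw [h]
        · exact absurd rfl h'
        · have := hnum.lt t (by omega); omega
        · exact hnum.rowOf_rid t (by omega)
      · intro r hr
        by_cases h : r < τ.nvar 4
        · obtain ⟨t, ht, rfl⟩ := hnum.surj r h
          exact ⟨t, by omega, by rw [Function.update_of_ne (by omega)]⟩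
        · exact ⟨k, by omega, by rw [Function.update_self]; omega⟩
      · intro r hr r' hr'
        simp only [Function.update_apply]
        split_ifs with h h' h'
        · intro _; omega
        · intro h''; exact absurd h''.symm (hnew r' (by omega))
        · intro h''; exact absurd h'' (hnew r (by omega))
        · exact hnum.inj r (by omega) r' (by omega)
      · intro i
        split_ifs
        · omega
        · have := h3le i; omega
      · intro i
        by_cases hik : i = σ.narr 0 k
        · simp [hik]
        · simp [hik]
          intro hpos
          have := h3le i
          rw [if_neg (by omega)]
          exact h3pos i hpos
      · intro r hr
        by_cases h : r = τ.nvar 4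
        · simp [h]
        · have := hnew r (by omega)
          simp only [h, not_false_eq_true, this, imp_false, not_true, if_false]
          exact h34 r (by omega)
  · simp only [NExp.cost]; omega
  · intro τ _ h
    exact h.1

/-! ### Parameters -/

/-- The least `q` with `q ε² ≥ 1`, searched for up to `N + 1`, in natural variable `5`. -/
def findQ : Cmd :=
  .seq (.nset 5 (.const 0)) (.forN 13 (.add (.var 2) (.const 1))
    (.ite (.rlt (.mul (.mul (.ofNat (.var 5)) (.var 0)) (.var 0)) (.ofNat (.const 1)))
      (.nset 5 (.add (.var 5) (.const 1))) .skip))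

/-- The cutoff keeps the search linear in N. A value above N is useless for sampling but makes the
sample count exceed N, which selects the exact output. The second conclusion is minimality, needed
for the bound on the number of samples. -/
theorem findQ_runs (ω : Tape) {σ : State} {N : ℕ} {ε : ℝ} (hN : σ.nvar 2 = N) (hε : σ.rvar 0 = ε) :
    Runs ω findQ σ (100 * (N + 1)) (fun τ =>
      (τ.nvar 5 ≤ N → 1 ≤ (τ.nvar 5 : ℝ) * ε * ε) ∧ ((τ.nvar 5 : ℝ) - 1) * ε * ε < 1) := by
  refine (Runs.seq (B := 2) (P := fun τ => τ = σ.setN 5 0) (Runs.of_loopFree rfl le_rfl rfl)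
    fun τ' _ hτ' => Runs.forN (N := N + 1) (B := 30) (Inv := fun k τ =>
      (τ.nvar 5 = k ∨ 1 ≤ (τ.nvar 5 : ℝ) * ε * ε) ∧ τ.nvar 5 ≤ k ∧
        ((τ.nvar 5 : ℝ) - 1) * ε * ε < 1) rfl ?_ ?_ ?_).mono ?_ ?_
  · intro τ hF
    have := hF.nvar 2 rfl
    subst hτ'
    simp_all
  · subst hτ'
    simp
    nlinarith [sq_nonneg ε]
  · rintro k hk τ hF hi ⟨h1, h2, h3⟩
    have hr : τ.rvar 0 = ε := by rw [hF.rvar 0 rfl, hτ']; exact hε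
    refine Runs.of_loopFree rfl (by decide) ?_
    -- A successful test both advances the counter and proves minimality of the advanced value.
    by_cases hlt : (τ.nvar 5 : ℝ) * ε * ε < 1
    · simp [hr, hlt]
      rcases h1 with h1 | h1
      · omega
      · linarith
    · simp [hr, hlt]
      exact ⟨Or.inr (not_lt.1 hlt), by omega, h3⟩
  · simp only [NExp.cost]; omega
  · rintro τ _ ⟨h1, h2, h3⟩
    refine ⟨fun h => ?_, h3⟩
    rcases h1 with h1 | h1
    · omega
    · exact h1

/-- The least `ℓ` with `2 ^ ℓ ε ≥ 2`, searched for up to `N + 1`, in natural variable `6`. -/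
def findLogEps : Cmd :=
  .seq (.seq (.nset 6 (.const 0)) (.rset 1 (.var 0))) (.forN 13 (.add (.var 2) (.const 1))
    (.ite (.rlt (.var 1) (.ofNat (.const 2)))
      (.seq (.rset 1 (.add (.var 1) (.var 1))) (.nset 6 (.add (.var 6) (.const 1)))) .skip))

theorem findLogEps_runs (ω : Tape) {σ : State} {N : ℕ} {ε : ℝ} (hN : σ.nvar 2 = N)
    (hε : σ.rvar 0 = ε) (hε1 : ε < 1) :
    Runs ω findLogEps σ (100 * (N + 1)) (fun τ =>
      (τ.nvar 6 ≤ N → 2 ≤ 2 ^ τ.nvar 6 * ε) ∧ 2 ^ τ.nvar 6 * ε < 4) := by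
  refine (Runs.seq (B := 4) (P := fun τ => τ = (σ.setN 6 0).setR 1 ε)
    (Runs.of_loopFree rfl le_rfl (by simp [hε]))
    fun τ' _ hτ' => Runs.forN (N := N + 1) (B := 30) (Inv := fun k τ =>
      (τ.nvar 6 = k ∨ 2 ≤ 2 ^ τ.nvar 6 * ε) ∧ τ.nvar 6 ≤ k ∧
        2 ^ τ.nvar 6 * ε < 4 ∧ τ.rvar 1 = 2 ^ τ.nvar 6 * ε) rfl ?_ ?_ ?_).mono ?_ ?_
  · intro τ hF
    have := hF.nvar 2 rfl
    subst hτ'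
    simp_all
  · subst hτ'
    simp
    linarith
  · rintro k hk τ hF hi ⟨h1, h2, h3, h4⟩
    refine Runs.of_loopFree rfl (by decide) ?_
    by_cases hlt : 2 ^ τ.nvar 6 * ε < 2
    · simp [h4, hlt]
      rw [pow_succ]
      refine ⟨?_, h2, by linarith, by ring⟩
      rcases h1 with h1 | h1
      · exact Or.inl h1
      · linarith
    · simp [h4, hlt]
      exact ⟨Or.inr (not_lt.1 hlt), by omega, h3⟩
  · simp only [NExp.cost]; omega
  · rintro τ _ ⟨h1, h2, h3, _⟩
    refine ⟨fun h => ?_, h3⟩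
    rcases h1 with h1 | h1
    · omega
    · exact h1

/-- The least `L` with `2 ^ L ≥ R`, in natural variable `7`. -/
def findLogRows : Cmd :=
  .seq (.seq (.nset 7 (.const 0)) (.nset 8 (.const 1))) (.forN 13 (.var 4)
    (.ite (.nlt (.var 8) (.var 4))
      (.seq (.nset 8 (.add (.var 8) (.var 8))) (.nset 7 (.add (.var 7) (.const 1)))) .skip))

theorem findLogRows_runs (ω : Tape) {σ : State} {R : ℕ} (hR : σ.nvar 4 = R) :
    Runs ω findLogRows σ (100 * (R + 1)) (fun τ =>
      R ≤ 2 ^ τ.nvar 7 ∧ 2 ^ τ.nvar 7 ≤ 2 * R + 1) := by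
  refine (Runs.seq (B := 4) (P := fun τ => τ = (σ.setN 7 0).setN 8 1)
    (Runs.of_loopFree rfl le_rfl (by simp))
    fun τ' _ hτ' => Runs.forN (N := R) (B := 30) (Inv := fun k τ =>
      (τ.nvar 7 = k ∨ R ≤ 2 ^ τ.nvar 7) ∧ 2 ^ τ.nvar 7 ≤ 2 * R + 1 ∧ τ.nvar 8 = 2 ^ τ.nvar 7)
      rfl ?_ ?_ ?_).mono ?_ ?_
  · intro τ hF
    have := hF.nvar 4 rfl
    subst hτ'
    simp_all
  · subst hτ'
    simp
  · rintro k hk τ hF hi ⟨h1, h2, h4⟩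
    have hr : τ.nvar 4 = R := by rw [hF.nvar 4 rfl, hτ']; exact hR
    refine Runs.of_loopFree rfl (by decide) ?_
    by_cases hlt : 2 ^ τ.nvar 7 < R
    · simp [h4, hr, hlt]
      rw [pow_succ]
      refine ⟨?_, by omega, by ring⟩
      rcases h1 with h1 | h1
      · exact Or.inl h1
      · omega
    · simp [h4, hr, hlt]
      exact ⟨Or.inr (not_lt.1 hlt), h2⟩
  · simp only [NExp.cost]; omega
  · rintro τ _ ⟨h1, h2, _⟩
    refine ⟨?_, h2⟩
    rcases h1 with h1 | h1
    · rw [h1]; exact Nat.lt_two_pow_self.le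
    · exact h1

/-- The number of samples and the moduli of the random draws. -/
def setParams : Cmd :=
  .seq (.nset 9 (.mul (.mul (.mul (.const 1000000) (.mul (.mul (.mul (.var 1) (.var 1))
    (.mul (.var 1) (.var 1))) (.mul (.mul (.var 1) (.var 1)) (.var 1)))) (.var 6)) (.var 5)))
  (.seq (.nset 10 (.mul (.var 1) (.var 1)))
  (.seq (.nset 11 (.const 2))
  (.seq (.nset 12 (.add (.var 4) (.var 4)))
  (.nset 22 (.add (.var 7) (.const 5))))))

/-- Everything that precedes the random choices. -/
def prepare : Cmd :=
  .seq compactRows (.seq findQ (.seq findLogEps (.seq findLogRows setParams)))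

/-- The result of `prepare` for an input `σ` with `N` entries. -/
structure Prepared (σ τ : State) (d N : ℕ) (ε : ℝ) : Prop where
  frame : Frame prepare σ τ
  num : IsNumbering N (σ.narr 0) (τ.nvar 4) (τ.narr 4) (τ.narr 5)
  one_le_q : τ.nvar 5 ≤ N → 1 ≤ (τ.nvar 5 : ℝ) * ε * ε
  q_lt : ((τ.nvar 5 : ℝ) - 1) * ε * ε < 1
  two_le_l : τ.nvar 6 ≤ N → 2 ≤ 2 ^ τ.nvar 6 * ε
  l_lt : 2 ^ τ.nvar 6 * ε < 4
  rows_le : τ.nvar 4 ≤ 2 ^ τ.nvar 7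
  le_rows : 2 ^ τ.nvar 7 ≤ 2 * τ.nvar 4 + 1
  samples : τ.nvar 9 = 1000000 * d ^ 7 * τ.nvar 6 * τ.nvar 5
  mod₁ : τ.nvar 10 = d * d
  mod₂ : τ.nvar 11 = 2
  mod₃ : τ.nvar 12 = 2 * τ.nvar 4
  trials : τ.nvar 22 = τ.nvar 7 + 5

theorem prepare_runs (ω : Tape) {σ : State} {d N : ℕ} {ε : ℝ} (hd : σ.nvar 1 = d)
    (hN : σ.nvar 2 = N) (h4 : σ.nvar 4 = 0) (h3 : ∀ i, σ.narr 3 i = 0) (hε : σ.rvar 0 = ε)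
    (hε1 : ε < 1) :
    Runs ω prepare σ (500 * (N + 1)) (fun τ => Prepared σ τ d N ε) := by
  refine Runs.mono (B := 100 * (N + 1) + (100 * (N + 1) + (100 * (N + 1) + (100 * (N + 1) + 100))))
    (Q := fun τ => Frame prepare σ τ → Prepared σ τ d N ε) ?_ (by omega) (fun τ hF h => h hF)
  refine (compactRows_runs ω hN h4 h3).seq fun τ₁ F₁ h₁ => ?_
  have hN₁ : τ₁.nvar 2 = N := (F₁.nvar 2 rfl).trans hN
  refine (findQ_runs ω hN₁ ((F₁.rvar 0 rfl).trans hε)).seq fun τ₂ F₂ h₂ => ?_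
  have hN₂ : τ₂.nvar 2 = N := (F₂.nvar 2 rfl).trans hN₁
  refine (findLogEps_runs ω hN₂ ((F₂.rvar 0 rfl).trans ((F₁.rvar 0 rfl).trans hε)) hε1).seq
    fun τ₃ F₃ h₃ => ?_
  refine ((findLogRows_runs ω (σ := τ₃) rfl).mono (B' := 100 * (N + 1)) ?_ fun τ _ h => h).seq
    fun τ₄ F₄ h₄ => ?_
  · have : τ₃.nvar 4 = τ₁.nvar 4 := (F₃.nvar 4 rfl).trans (F₂.nvar 4 rfl)
    rw [this]
    have := h₁.le
    omega
  have e4 : τ₄.nvar 4 = τ₁.nvar 4 :=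
    (F₄.nvar 4 rfl).trans ((F₃.nvar 4 rfl).trans (F₂.nvar 4 rfl))
  have e4' : τ₃.nvar 4 = τ₁.nvar 4 := (F₃.nvar 4 rfl).trans (F₂.nvar 4 rfl)
  have e5 : τ₄.nvar 5 = τ₂.nvar 5 := (F₄.nvar 5 rfl).trans (F₃.nvar 5 rfl)
  have e6 : τ₄.nvar 6 = τ₃.nvar 6 := F₄.nvar 6 rfl
  have e1 : τ₄.nvar 1 = d := (F₄.nvar 1 rfl).trans ((F₃.nvar 1 rfl).trans
    ((F₂.nvar 1 rfl).trans ((F₁.nvar 1 rfl).trans hd)))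
  have en4 : τ₄.narr 4 = τ₁.narr 4 :=
    (F₄.narr 4 rfl).trans ((F₃.narr 4 rfl).trans (F₂.narr 4 rfl))
  have en5 : τ₄.narr 5 = τ₁.narr 5 :=
    (F₄.narr 5 rfl).trans ((F₃.narr 5 rfl).trans (F₂.narr 5 rfl))
  refine Runs.of_loopFree rfl (by decide) fun hF => ?_
  refine ⟨hF, ?_, ?_, ?_, ?_, ?_, ?_, ?_, ?_, ?_, ?_, ?_, ?_⟩
  · simpa [setParams, e4, en4, en5] using h₁
  · simpa [setParams, e5] using h₂.1
  · simpa [setParams, e5] using h₂.2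
  · simpa [setParams, e6] using h₃.1
  · simpa [setParams, e6] using h₃.2
  · simpa [setParams, e4, e4'] using h₄.1
  · simpa [setParams, e4, e4'] using h₄.2
  · simp [setParams, e1]
    left; left; ring
  · simp [setParams, e1]
  · simp [setParams]
  · simp [setParams]; ring
  · simp [setParams]

end RealRAM

namespace RealRAM

attribute [local simp] Cmd.run NExp.eval RExp.eval BExp.holds State.setN State.setR State.storeN
  State.storeR State.advance Function.update_apply

/-! ### Choosing a random set of rows -/

/-- Put each row into the random set with probability `1 / D`, up to a bound for its size. The
members are numbered from `1` on in array `6`. -/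
def sampleRows : Cmd :=
  .forN 13 (.var 4) (.seq (.drawBelow 18 (.var 10))
    (.ite (.and (.nlt (.var 18) (.const 1))
      (.not (.nlt (.mul (.const 20) (.var 4)) (.mul (.add (.var 19) (.const 1)) (.var 10)))))
      (.seq (.nset 19 (.add (.var 19) (.const 1))) (.nstore 6 (.var 13) (.var 19))) .skip))

/-- The map `num` numbers a set of `cnt` rows `r < R` with `b r = 0`; all such rows, unless there
are too many. -/
structure IsSelection (R D K : ℕ) (b : ℕ → ℕ) (cnt : ℕ) (num : ℕ → ℕ) : Prop where
  cnt_le : cnt * D ≤ K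
  num_le : ∀ r, num r ≤ cnt
  zero : ∀ r, 0 < num r → r < R ∧ b r = 0
  surj : ∀ c < cnt, ∃ r, num r = c + 1
  inj : ∀ r r', 0 < num r → num r = num r' → r = r'
  cnt_le_card : cnt ≤ ((Finset.range R).filter fun r => b r = 0).card
  all : K < ((Finset.range R).filter fun r => b r = 0).card * D ∨ ∀ r < R, b r = 0 → 0 < num r

/-- The cap on the size makes the running time bound hold on every tape. It alters the random set
only when that set has more than 20R/D members. -/
theorem sampleRows_runs (ω : Tape) {σ : State} {R D : ℕ} (hR : σ.nvar 4 = R) (hD : σ.nvar 10 = D)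
    (h19 : σ.nvar 19 = 0) (h6 : ∀ i, σ.narr 6 i = 0) (hpos : σ.pos = 0) :
    Runs ω sampleRows σ (100 * (R + 1)) (fun τ => τ.pos = R ∧
      IsSelection R D (20 * R) (fun r => belowOf D (ω r)) (τ.nvar 19) (τ.narr 6)) := by
  refine (Runs.forN (N := R) (B := 40) (Inv := fun k τ => τ.pos = k ∧
      IsSelection k D (20 * R) (fun r => belowOf D (ω r)) (τ.nvar 19) (τ.narr 6))
      rfl ?_ ?_ ?_).mono ?_ ?_
  · intro τ hF
    exact (hF.nvar 4 rfl).trans hR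
  · simp only [State.setN, Function.update_apply]
    refine ⟨hpos, ⟨?_, ?_, ?_, ?_, ?_, ?_, ?_⟩⟩ <;> simp [h19, h6]
  · rintro k hk τ hF hi ⟨hp, hsel⟩
    have h4 : τ.nvar 4 = R := (hF.nvar 4 rfl).trans hR
    have h10 : τ.nvar 10 = D := (hF.nvar 10 rfl).trans hD
    refine Runs.of_loopFree rfl (by decide) ?_
    have hnk : τ.narr 6 k = 0 := by
      by_contra h
      have := (hsel.zero k (Nat.pos_of_ne_zero h)).1
      omega
    have hcard : ((Finset.range (k + 1)).filter fun r => belowOf D (ω r) = 0).card =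
        ((Finset.range k).filter fun r => belowOf D (ω r) = 0).card +
          if belowOf D (ω k) = 0 then 1 else 0 := by
      rw [Finset.range_add_one, Finset.filter_insert]
      split_ifs with h
      · rw [Finset.card_insert_of_notMem (by simp)]
      · rfl
    by_cases hb : belowOf D (ω k) = 0
    · rw [if_pos hb] at hcard
      by_cases hc : (τ.nvar 19 + 1) * D ≤ 20 * R
      · simp [hp, h4, h10, hi, hb, hc]
        refine ⟨hc, ?_, ?_, ?_, ?_, ?_, ?_⟩
        · intro r
          simp only [Function.update_apply]
          split_ifs
          · exact le_rfl
          · have := hsel.num_le r; omega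
        · intro r hr
          simp only [Function.update_apply] at hr
          split_ifs at hr with h
          · rw [h]; exact ⟨by omega, hb⟩
          · have := hsel.zero r hr; exact ⟨by omega, this.2⟩
        · intro c hc'
          by_cases h : c < τ.nvar 19
          · obtain ⟨r, hr⟩ := hsel.surj c h
            refine ⟨r, ?_⟩
            rw [Function.update_of_ne (by rintro rfl; omega), hr]
          · exact ⟨k, by rw [Function.update_self]; omega⟩
        · intro r r' hr
          simp only [Function.update_apply] at hr ⊢
          have h1 := hsel.num_le r
          have h2 := hsel.num_le r'
          split_ifs at hr ⊢ with h h' h'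
          · intro _; rw [h, h']
          · intro _; omega
          · intro _; omega
          · intro h3; exact hsel.inj r r' hr h3
        · rw [hcard]; have := hsel.cnt_le_card; omega
        · rcases hsel.all with h | h
          · left; rw [hcard]; exact h.trans_le (Nat.mul_le_mul_right _ (by omega))
          · right
            intro r hr hbr
            simp only [Function.update_apply]
            split_ifs with h'
            · omega
            · exact h r (by omega) hbr
      · simp [hp, h4, h10, hb, hc]
        refine ⟨hsel.cnt_le, hsel.num_le, ?_, hsel.surj, hsel.inj, ?_, ?_⟩
        · intro r hr
          have := hsel.zero r hr; exact ⟨by omega, this.2⟩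
        · rw [hcard]; have := hsel.cnt_le_card; omega
        -- A refused row shows that the true number of eligible rows exceeds the cap already.
        · left
          rw [hcard]
          have := hsel.cnt_le_card
          exact (not_le.1 hc).trans_le (Nat.mul_le_mul_right _ (by omega))
    · rw [if_neg hb, add_zero] at hcard
      simp [hp, h4, h10, hb]
      refine ⟨hsel.cnt_le, hsel.num_le, ?_, hsel.surj, hsel.inj, ?_, ?_⟩
      · intro r hr
        have := hsel.zero r hr; exact ⟨by omega, this.2⟩
      · rw [hcard]; exact hsel.cnt_le_card
      · rw [hcard]
        refine hsel.all.imp id fun h r hr hbr => ?_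
        rcases Nat.lt_succ_iff_lt_or_eq.1 hr with h' | h'
        · exact h r h' hbr
        · subst h'; exact absurd hbr hb
  · simp only [NExp.cost]; omega
  · intro τ _ h
    exact h

/-! ### The dense matrix of the chosen rows -/

theorem index_inj {d c l c' l' : ℕ} (hl : l < d) (hl' : l' < d) :
    c * d + l = c' * d + l' ↔ c = c' ∧ l = l' := by
  constructor
  · intro h
    have h1 : l = l' := by
      have := congrArg (· % d) h
      simpa [Nat.mod_eq_of_lt hl, Nat.mod_eq_of_lt hl'] using this
    subst h1
    exact ⟨Nat.eq_of_mul_eq_mul_right (by omega) (by omega : c * d = c' * d), rfl⟩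
  · rintro ⟨rfl, rfl⟩; rfl

/-- The rows that the first `N` entries of a list of entries describe. -/
noncomputable def rowVec (N : ℕ) (rid col : ℕ → ℕ) (val : ℕ → ℝ) (r l : ℕ) : ℝ :=
  ∑ t ∈ Finset.range N, if rid t = r ∧ col t = l then val t else 0

/-- Copy the chosen rows to the dense matrix in array `2`, and set their weights to `1`. -/
def denseRows : Cmd :=
  .seq (.forN 13 (.var 2) (.seq (.nset 17 (.read 6 (.read 5 (.var 13))))
    (.ite (.nlt (.const 0) (.var 17))
      (.rstore 2 (.add (.mul (.sub (.var 17) (.const 1)) (.var 1)) (.read 1 (.var 13)))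
        (.add (.read 2 (.add (.mul (.sub (.var 17) (.const 1)) (.var 1)) (.read 1 (.var 13))))
          (.read 0 (.var 13)))) .skip)))
  (.forN 13 (.var 19) (.rstore 3 (.var 13) (.ofNat (.const 1))))

/-- Entries are added onto zero memory, so their order is irrelevant; injectivity of the numbering
keeps different rows apart. -/
theorem denseRows_runs (ω : Tape) {σ : State} {N d : ℕ} (hN : σ.nvar 2 = N) (hd : σ.nvar 1 = d)
    (hcol : ∀ t < N, σ.narr 1 t < d) (h2 : ∀ i, σ.rarr 2 i = 0)
    (hinj : ∀ r r', 0 < σ.narr 6 r → σ.narr 6 r = σ.narr 6 r' → r = r') :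
    Runs ω denseRows σ (100 * (N + 1) + 100 * (σ.nvar 19 + 1)) (fun τ =>
      (∀ r, 0 < σ.narr 6 r → ∀ l < d, τ.rarr 2 ((σ.narr 6 r - 1) * d + l) =
        rowVec N (σ.narr 5) (σ.narr 1) (σ.rarr 0) r l) ∧
      ∀ c < σ.nvar 19, τ.rarr 3 c = 1) := by
  refine (Runs.seq (B := 100 * (N + 1)) (P := fun τ =>
      ∀ r, 0 < σ.narr 6 r → ∀ l < d, τ.rarr 2 ((σ.narr 6 r - 1) * d + l) =
        rowVec N (σ.narr 5) (σ.narr 1) (σ.rarr 0) r l) ?_ fun τ₁ F₁ h₁ => ?_).mono le_rfl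
    fun τ _ h => h
  · refine (Runs.forN (N := N) (B := 40) (Inv := fun k τ =>
      ∀ r, 0 < σ.narr 6 r → ∀ l < d, τ.rarr 2 ((σ.narr 6 r - 1) * d + l) =
        rowVec k (σ.narr 5) (σ.narr 1) (σ.rarr 0) r l) rfl ?_ ?_ ?_).mono ?_ fun τ _ h => h
    · intro τ hF
      exact (hF.nvar 2 rfl).trans hN
    · intro r _ l _
      simp [rowVec, h2]
    · intro k hk τ hF hi hI
      have e0 : τ.rarr 0 = σ.rarr 0 := hF.rarr 0 rfl
      have e1 : τ.narr 1 = σ.narr 1 := hF.narr 1 rfl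
      have e5 : τ.narr 5 = σ.narr 5 := hF.narr 5 rfl
      have e6 : τ.narr 6 = σ.narr 6 := hF.narr 6 rfl
      have ed : τ.nvar 1 = d := (hF.nvar 1 rfl).trans hd
      refine Runs.of_loopFree rfl (by decide) ?_
      intro r hr l hl
      have hsum : rowVec (k + 1) (σ.narr 5) (σ.narr 1) (σ.rarr 0) r l =
          rowVec k (σ.narr 5) (σ.narr 1) (σ.rarr 0) r l +
            if σ.narr 5 k = r ∧ σ.narr 1 k = l then σ.rarr 0 k else 0 :=
        Finset.sum_range_succ _ _
      rw [hsum]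
      by_cases hz : 0 < σ.narr 6 (σ.narr 5 k)
      · simp [hi, e0, e1, e5, e6, ed, hz]
        simp only [index_inj hl (hcol k hk)]
        by_cases hc : σ.narr 5 k = r ∧ σ.narr 1 k = l
        · obtain ⟨rfl, rfl⟩ := hc
          simp [hI _ hr _ hl]
        · rw [if_neg, if_neg hc, add_zero, hI r hr l hl]
          rintro ⟨h3, h4⟩
          exact hc ⟨(hinj r _ hr (by omega)).symm, h4.symm⟩
      · have hne : ¬ (σ.narr 5 k = r ∧ σ.narr 1 k = l) := by
          rintro ⟨rfl, _⟩; exact hz hr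
        simp [hi, e5, e6, hz, hne, hI r hr l hl]
    · simp only [NExp.cost]; omega
  · have e19 : τ₁.nvar 19 = σ.nvar 19 := F₁.nvar 19 rfl
    refine (Runs.forN (N := σ.nvar 19) (B := 40) (Inv := fun k τ => ∀ c < k, τ.rarr 3 c = 1)
      rfl ?_ ?_ ?_).mono ?_ fun τ hF h => ⟨?_, h⟩
    · intro τ hF
      exact (hF.nvar 19 rfl).trans e19
    · intro c hc; omega
    · intro k hk τ hF hi hI
      refine Runs.of_loopFree rfl (by decide) ?_
      intro c hc
      simp [hi]
      intro h
      exact hI c (by omega)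
    · simp only [NExp.cost]; omega
    · rw [show τ.rarr 2 = τ₁.rarr 2 from hF.rarr 2 rfl]
      exact h₁

end RealRAM

namespace RealRAM

attribute [local simp] Cmd.run NExp.eval RExp.eval BExp.holds State.setN State.setR State.storeN
  State.storeR State.advance Function.update_apply

/-! ### Computing a frame -/

/-- The index of the entry `(k, l)` of a matrix with `d` columns. -/
abbrev idx (k l : ℕ) : NExp := .add (.mul (.var k) (.var 1)) (.var l)

/-- The vector `k` of the frame in array `4`. -/
def frameOf (d : ℕ) (τ : State) (k l : ℕ) : ℝ := τ.rarr 4 (k * d + l)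

/-- The row `c` of the dense matrix in array `2`. -/
def denseOf (d : ℕ) (τ : State) (c l : ℕ) : ℝ := τ.rarr 2 (c * d + l)

/-- The set of coordinates marked in array `7`. -/
def activeOf (d : ℕ) (τ : State) : Finset ℕ := (Finset.range d).filter fun k => τ.narr 7 k ≠ 0

theorem mem_activeOf {d : ℕ} {τ : State} {k : ℕ} :
    k ∈ activeOf d τ ↔ k < d ∧ τ.narr 7 k ≠ 0 := by simp [activeOf]

/-- The inner products of the current row with the frame. -/
def computeV : Cmd :=
  .forN 16 (.var 1) (.seq (.sumTo 2 23 (.var 1) (.mul (.read 2 (idx 15 23)) (.read 4 (idx 16 23))))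
    (.rstore 5 (.var 16) (.var 2)))

theorem computeV_runs (ω : Tape) {σ : State} {d : ℕ} (hd : σ.nvar 1 = d) (hd1 : 1 ≤ d) :
    Runs ω computeV σ (100 * (d * d)) (fun τ => ∀ k < d, τ.rarr 5 k =
      dot d (denseOf d σ (σ.nvar 15)) (frameOf d σ k)) := by
  refine (Runs.forN (N := d) (B := 15 + d * 25) (Inv := fun k τ => ∀ j < k, τ.rarr 5 j =
      dot d (denseOf d σ (σ.nvar 15)) (frameOf d σ j)) rfl ?_ ?_ ?_).mono ?_ fun τ _ h => h
  · intro τ hF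
    exact (hF.nvar 1 rfl).trans hd
  · intro j hj; omega
  · intro k hk τ hF hi hI
    have e1 : τ.nvar 1 = d := (hF.nvar 1 rfl).trans hd
    have e15 : τ.nvar 15 = σ.nvar 15 := hF.nvar 15 rfl
    have e2 : τ.rarr 2 = σ.rarr 2 := hF.rarr 2 rfl
    have e4 : τ.rarr 4 = σ.rarr 4 := hF.rarr 4 rfl
    refine ((Runs.sumTo (N := d) (fun l => denseOf d σ (σ.nvar 15) l * frameOf d σ k l)
      ?_ ?_).seq (B' := 3) fun τ' _ hτ' => ?_).mono ?_ fun τ _ h => h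
    · intro k v; simp [e1]
    · intro k _ v; simp [e1, e15, e2, e4, hi, denseOf, frameOf]
    · subst hτ'
      refine Runs.of_loopFree rfl (by decide) ?_
      intro j hj
      simp [hi]
      split_ifs with h
      · rw [h]; rfl
      · exact hI j (by omega)
    · simp only [NExp.cost, RExp.cost]; omega
  · simp only [NExp.cost]
    nlinarith

/-- Search for an unmarked coordinate in which the current row does not vanish. -/
def findPivot : Cmd :=
  .seq (.nset 20 (.var 1)) (.forN 16 (.var 1)
    (.ite (.and (.nlt (.read 7 (.var 16)) (.const 1))
      (.not (.and (.not (.rlt (.read 5 (.var 16)) (.ofNat (.const 0))))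
        (.not (.rlt (.ofNat (.const 0)) (.read 5 (.var 16)))))))
      (.nset 20 (.var 16)) .skip))

/-- The value `d` signals that no pivot exists; the two alternatives are the hypotheses of
`insert_rankOne` and `insert_pivot`. -/
theorem findPivot_runs (ω : Tape) {σ : State} {d : ℕ} (hd : σ.nvar 1 = d) (hd1 : 1 ≤ d) :
    Runs ω findPivot σ (100 * d) (fun τ =>
      (τ.nvar 20 = d ∧ ∀ k < d, σ.narr 7 k = 0 → σ.rarr 5 k = 0) ∨
      (τ.nvar 20 < d ∧ σ.narr 7 (τ.nvar 20) = 0 ∧ σ.rarr 5 (τ.nvar 20) ≠ 0)) := by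
  refine (Runs.seq (B := 2) (P := fun τ => τ = σ.setN 20 d) (Runs.of_loopFree rfl le_rfl
    (by simp [hd])) fun τ' F' hτ' => Runs.forN (N := d) (B := 30) (Inv := fun k τ =>
      (τ.nvar 20 = d ∧ ∀ j < k, σ.narr 7 j = 0 → σ.rarr 5 j = 0) ∨
      (τ.nvar 20 < d ∧ σ.narr 7 (τ.nvar 20) = 0 ∧ σ.rarr 5 (τ.nvar 20) ≠ 0))
      rfl ?_ ?_ ?_).mono ?_ fun τ _ h => h
  · intro τ hF
    exact (hF.nvar 1 rfl).trans ((F'.nvar 1 rfl).trans hd)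
  · subst hτ'; left; simp
  · intro k hk τ hF hi hI
    have e7 : τ.narr 7 = σ.narr 7 := (hF.narr 7 rfl).trans (F'.narr 7 rfl)
    have e5 : τ.rarr 5 = σ.rarr 5 := (hF.rarr 5 rfl).trans (F'.rarr 5 rfl)
    refine Runs.of_loopFree rfl (by decide) ?_
    by_cases hc : σ.narr 7 k = 0 ∧ σ.rarr 5 k ≠ 0
    · have hne : 0 ≤ σ.rarr 5 k → 0 < σ.rarr 5 k := fun h => lt_of_le_of_ne h hc.2.symm
      simp [hi, e7, e5, hc.1]
      rw [if_pos hne]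
      right
      simpa using ⟨hk, hc⟩
    · have hcond : ¬ (σ.narr 7 k = 0 ∧ (0 ≤ σ.rarr 5 k → 0 < σ.rarr 5 k)) := by
        rintro ⟨h1, h2⟩
        refine hc ⟨h1, fun h3 => ?_⟩
        rw [h3] at h2
        exact lt_irrefl _ (h2 le_rfl)
      simp [hi, e7, e5, hcond]
      refine hI.imp (fun h => ⟨h.1, fun j hj h7 => ?_⟩) id
      rcases hj.lt_or_eq with h' | h'
      · exact h.2 j h' h7
      · subst h'; by_contra h5; exact hc ⟨h7, h5⟩
  · simp only [NExp.cost]; omega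

/-- The coefficients of the frame update when a new coordinate gets marked. -/
def pivotCoeffs : Cmd :=
  .seq (.forN 16 (.var 1) (.seq (.rstore 6 (.var 16) (.ofNat (.const 0)))
      (.rstore 7 (.var 16) (.div (.read 5 (.var 16)) (.read 5 (.var 20))))))
    (.seq (.rstore 6 (.var 20) (.ofNat (.const 1)))
    (.seq (.rstore 7 (.var 20) (.sub (.ofNat (.const 1))
      (.div (.sqrt (.read 3 (.var 15))) (.read 5 (.var 20)))))
      (.nstore 7 (.var 20) (.const 1))))

theorem pivotCoeffs_runs (ω : Tape) {σ : State} {d : ℕ} (hd : σ.nvar 1 = d) (hd1 : 1 ≤ d) :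
    Runs ω pivotCoeffs σ (100 * d) (fun τ =>
      (∀ k < d, τ.rarr 6 k = if k = σ.nvar 20 then 1 else 0) ∧
      (∀ k < d, τ.rarr 7 k = if k = σ.nvar 20 then
        1 - √(σ.rarr 3 (σ.nvar 15)) / σ.rarr 5 (σ.nvar 20)
        else σ.rarr 5 k / σ.rarr 5 (σ.nvar 20)) ∧
      ∀ k, τ.narr 7 k = if k = σ.nvar 20 then 1 else σ.narr 7 k) := by
  refine ((Runs.forN (N := d) (B := 30) (Inv := fun k τ =>
      (∀ j < k, τ.rarr 6 j = 0) ∧ ∀ j < k, τ.rarr 7 j = σ.rarr 5 j / σ.rarr 5 (σ.nvar 20))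
      rfl ?_ ?_ ?_).seq (B' := 30) fun τ hF h => ?_).mono ?_ fun τ _ h => h
  · intro τ hF
    exact (hF.nvar 1 rfl).trans hd
  · constructor <;> intro j hj <;> omega
  · rintro k hk τ hF hi ⟨h1, h2⟩
    have e5 : τ.rarr 5 = σ.rarr 5 := hF.rarr 5 rfl
    have e20 : τ.nvar 20 = σ.nvar 20 := hF.nvar 20 rfl
    refine Runs.of_loopFree rfl (by decide) ⟨?_, ?_⟩
    · intro j hj
      simp [hi]
      intro h; exact h1 j (by omega)
    · intro j hj
      simp [hi, e5, e20]
      split_ifs with h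
      · rw [h]
      · exact h2 j (by omega)
  · have e5 : τ.rarr 5 = σ.rarr 5 := hF.rarr 5 rfl
    have e3 : τ.rarr 3 = σ.rarr 3 := hF.rarr 3 rfl
    have e7 : τ.narr 7 = σ.narr 7 := hF.narr 7 rfl
    have e20 : τ.nvar 20 = σ.nvar 20 := hF.nvar 20 rfl
    have e15 : τ.nvar 15 = σ.nvar 15 := hF.nvar 15 rfl
    refine Runs.of_loopFree rfl (by decide) ⟨?_, ?_, ?_⟩
    · intro k hk
      simp [e20]
      split_ifs
      · rfl
      · exact h.1 k hk
    · intro k hk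
      simp [e20, e5, e3, e15]
      split_ifs
      · rfl
      · exact h.2 k hk
    · intro k
      simp [e20, e7]
  · simp only [NExp.cost]; omega

/-- The coefficients of the frame update when no new coordinate gets marked. -/
def rankOneCoeffs : Cmd :=
  .seq (.sumTo 2 16 (.var 1) (.mul (.read 5 (.var 16)) (.read 5 (.var 16))))
    (.seq (.rset 3 (.div (.ofNat (.const 1)) (.mul (.read 3 (.var 15)) (.add
        (.add (.ofNat (.const 1)) (.div (.var 2) (.read 3 (.var 15))))
        (.sqrt (.add (.ofNat (.const 1)) (.div (.var 2) (.read 3 (.var 15)))))))))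
      (.forN 16 (.var 1) (.seq (.rstore 6 (.var 16) (.read 5 (.var 16)))
        (.rstore 7 (.var 16) (.mul (.var 3) (.read 5 (.var 16)))))))

theorem rankOneCoeffs_runs (ω : Tape) {σ : State} {d : ℕ} (hd : σ.nvar 1 = d) (hd1 : 1 ≤ d)
    {s w : ℝ} (hs : s = ∑ k ∈ Finset.range d, σ.rarr 5 k * σ.rarr 5 k)
    (hw : w = σ.rarr 3 (σ.nvar 15)) :
    Runs ω rankOneCoeffs σ (200 * d) (fun τ =>
      (∀ k < d, τ.rarr 6 k = σ.rarr 5 k) ∧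
      (∀ k < d, τ.rarr 7 k = 1 / (w * ((1 + s / w) + √(1 + s / w))) * σ.rarr 5 k)) := by
  refine ((Runs.sumTo (N := d) (fun k => σ.rarr 5 k * σ.rarr 5 k) ?_ ?_).seq
    (B' := 40 + 100 * d) fun τ₁ F₁ h₁ => (Runs.seq (B := 40) (B' := 100 * d)
      (P := fun τ => τ.rvar 3 = 1 / (w * ((1 + s / w) + √(1 + s / w))))
      (Runs.of_loopFree rfl (by decide) ?_) fun τ₂ F₂ h₂ => ?_)).mono ?_ fun τ _ h => h
  · intro k v; simp [hd]
  · intro k _ v; simp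
  · subst h₁
    simp [hw, hs]
  · refine (Runs.forN (N := d) (B := 30) (Inv := fun k τ =>
      (∀ j < k, τ.rarr 6 j = σ.rarr 5 j) ∧
        ∀ j < k, τ.rarr 7 j = 1 / (w * ((1 + s / w) + √(1 + s / w))) * σ.rarr 5 j)
      rfl ?_ ?_ ?_).mono ?_ fun τ _ h => h
    · intro τ hF
      exact (hF.nvar 1 rfl).trans ((F₂.nvar 1 rfl).trans ((F₁.nvar 1 rfl).trans hd))
    · constructor <;> intro j hj <;> omega
    · rintro k hk τ hF hi ⟨h3, h4⟩
      have e5 : τ.rarr 5 = σ.rarr 5 :=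
        (hF.rarr 5 rfl).trans ((F₂.rarr 5 rfl).trans (F₁.rarr 5 rfl))
      have er : τ.rvar 3 = _ := (hF.rvar 3 rfl).trans h₂
      refine Runs.of_loopFree rfl (by decide) ⟨?_, ?_⟩
      · intro j hj
        simp [hi, e5]
        split_ifs with h
        · rw [h]
        · exact h3 j (by omega)
      · intro j hj
        simp [hi, e5, er]
        split_ifs with h
        · rw [h]
        · rw [h4 j (by omega)]; simp
    · simp only [NExp.cost]; omega
  · simp only [NExp.cost, RExp.cost]; omega

/-- Subtract multiples of one combination of the frame vectors from all of them. -/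
def updateFrame : Cmd :=
  .seq (.forN 23 (.var 1) (.seq
      (.sumTo 2 16 (.var 1) (.mul (.read 6 (.var 16)) (.read 4 (idx 16 23))))
      (.rstore 8 (.var 23) (.var 2))))
    (.forN 16 (.var 1) (.forN 23 (.var 1) (.rstore 4 (idx 16 23)
      (.sub (.read 4 (idx 16 23)) (.mul (.read 7 (.var 16)) (.read 8 (.var 23)))))))

theorem updateFrame_runs (ω : Tape) {σ : State} {d : ℕ} (hd : σ.nvar 1 = d) (hd1 : 1 ≤ d) :
    Runs ω updateFrame σ (200 * (d * d)) (fun τ => ∀ k < d, ∀ l < d, frameOf d τ k l =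
      frameOf d σ k l - σ.rarr 7 k * ∑ k' ∈ Finset.range d, σ.rarr 6 k' * frameOf d σ k' l) := by
  -- The common combination is stored in array 8 before any frame vector is overwritten.
  refine (Runs.seq (B := 100 * (d * d)) (B' := 100 * (d * d)) (P := fun τ => ∀ l < d,
    τ.rarr 8 l = ∑ k' ∈ Finset.range d, σ.rarr 6 k' * frameOf d σ k' l) ?_
    fun τ₁ F₁ h₁ => ?_).mono (by omega) fun τ _ h => h
  · refine (Runs.forN (N := d) (B := 15 + d * 25) (Inv := fun k τ => ∀ l < k, τ.rarr 8 l =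
      ∑ k' ∈ Finset.range d, σ.rarr 6 k' * frameOf d σ k' l) rfl ?_ ?_ ?_).mono ?_
      fun τ _ h => h
    · intro τ hF
      exact (hF.nvar 1 rfl).trans hd
    · intro j hj; omega
    · intro l hl τ hF hi hI
      have e1 : τ.nvar 1 = d := (hF.nvar 1 rfl).trans hd
      have e6 : τ.rarr 6 = σ.rarr 6 := hF.rarr 6 rfl
      have e4 : τ.rarr 4 = σ.rarr 4 := hF.rarr 4 rfl
      refine ((Runs.sumTo (N := d) (fun k' => σ.rarr 6 k' * frameOf d σ k' l)
        ?_ ?_).seq (B' := 3) fun τ' _ hτ' => ?_).mono ?_ fun τ _ h => h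
      · intro k v; simp [e1]
      · intro k _ v; simp [e1, e6, e4, hi, frameOf]
      · subst hτ'
        refine Runs.of_loopFree rfl (by decide) ?_
        intro j hj
        simp [hi]
        split_ifs with h
        · rw [h]
        · exact hI j (by omega)
      · simp only [NExp.cost, RExp.cost]; omega
    · simp only [NExp.cost]
      nlinarith
  · have hd₁ : τ₁.nvar 1 = d := (F₁.nvar 1 rfl).trans hd
    have e4 : τ₁.rarr 4 = σ.rarr 4 := F₁.rarr 4 rfl
    have e7 : τ₁.rarr 7 = σ.rarr 7 := F₁.rarr 7 rfl
    set h := fun l => ∑ k' ∈ Finset.range d, σ.rarr 6 k' * frameOf d σ k' l with hh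
    refine (Runs.forN (N := d) (B := 6 + d * 38) (Inv := fun k τ => ∀ k' < d, ∀ l < d,
      frameOf d τ k' l = frameOf d σ k' l - if k' < k then σ.rarr 7 k' * h l else 0)
      rfl ?_ ?_ ?_).mono ?_ fun τ _ hI k hk l hl => by rw [hI k hk l hl, if_pos hk]
    · intro τ hF
      exact (hF.nvar 1 rfl).trans hd₁
    · intro k' _ l _
      simp [frameOf, e4]
    · intro k hk τ hF hi hI
      have hdτ : τ.nvar 1 = d := (hF.nvar 1 rfl).trans hd₁
      -- The entries already updated are those before (k, j) in lexicographic order.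
      refine (Runs.forN (N := d) (B := 30) (Inv := fun j τ' => ∀ k' < d, ∀ l < d,
        frameOf d τ' k' l = frameOf d σ k' l -
          if k' < k ∨ (k' = k ∧ l < j) then σ.rarr 7 k' * h l else 0)
        rfl ?_ ?_ ?_).mono ?_ ?_
      · intro τ' hF'
        exact (hF'.nvar 1 rfl).trans hdτ
      · intro k' hk' l hl
        simpa [frameOf] using hI k' hk' l hl
      · intro j hj τ' hF' hi' hI'
        have e1 : τ'.nvar 1 = d := (hF'.nvar 1 rfl).trans hdτ
        have e16 : τ'.nvar 16 = k := (hF'.nvar 16 rfl).trans hi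
        have e7' : τ'.rarr 7 = σ.rarr 7 := (hF'.rarr 7 rfl).trans ((hF.rarr 7 rfl).trans e7)
        have e8' : τ'.rarr 8 j = h j := by
          rw [show τ'.rarr 8 = τ₁.rarr 8 from (hF'.rarr 8 rfl).trans (hF.rarr 8 rfl), h₁ j hj]
        refine Runs.of_loopFree rfl (by decide) ?_
        intro k' hk' l hl
        have h2 := hI' k' hk' l hl
        simp only [frameOf] at h2 ⊢
        simp only [Cmd.run, NExp.eval, RExp.eval, State.storeR, State.setN, e1, e16, e7', e8', hi',
          Function.update_self]
        by_cases hc : k' = k ∧ l = j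
        · obtain ⟨rfl, rfl⟩ := hc
          rw [Function.update_self, h2]
          simp
        · rw [Function.update_of_ne (by rw [Ne, index_inj hl hj]; exact hc), h2]
          congr 1
          refine if_congr ?_ rfl rfl
          constructor
          · rintro (h3 | ⟨h3, h4⟩)
            · exact Or.inl h3
            · exact Or.inr ⟨h3, by omega⟩
          · rintro (h3 | ⟨h3, h4⟩)
            · exact Or.inl h3
            · refine Or.inr ⟨h3, ?_⟩
              by_contra h5
              exact hc ⟨h3, by omega⟩
      · simp only [NExp.cost]; omega
      · intro τ' _ hI' k' hk' l hl
        have h2 := hI' k' hk' l hl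
        simp only [frameOf, State.setN] at h2 ⊢
        rw [h2]
        congr 1
        refine if_congr ?_ rfl rfl
        omega
    · simp only [NExp.cost]
      nlinarith

/-- Add the current row to the quadratic form of the frame. -/
def addRow : Cmd :=
  .seq computeV (.seq findPivot
    (.seq (.ite (.nlt (.var 20) (.var 1)) pivotCoeffs rankOneCoeffs) updateFrame))

theorem addRow_runs (ω : Tape) {σ : State} {d c : ℕ} (hd : σ.nvar 1 = d) (hd1 : 1 ≤ d)
    (hc : σ.nvar 15 = c) (hw : 0 < σ.rarr 3 c)
    (hF : IsFrame d (denseOf d σ) (Finset.range c) (σ.rarr 3) (frameOf d σ) (activeOf d σ)) :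
    Runs ω addRow σ (1000 * (d * d)) (fun τ =>
      IsFrame d (denseOf d σ) (Finset.range (c + 1)) (σ.rarr 3) (frameOf d τ) (activeOf d τ)) := by
  have hdd : d ≤ d * d := Nat.le_mul_self d
  refine Runs.mono (B := 100 * (d * d) + (100 * d + ((10 + 200 * d) + 200 * (d * d)))) ?_
    (by omega) fun τ _ h => h
  refine (computeV_runs ω hd hd1).seq fun τ₁ F₁ h₁ => ?_
  have hd₁ : τ₁.nvar 1 = d := (F₁.nvar 1 rfl).trans hd
  refine (findPivot_runs ω hd₁ hd1).seq fun τ₂ F₂ h₂ => ?_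
  have hd₂ : τ₂.nvar 1 = d := (F₂.nvar 1 rfl).trans hd₁
  have e15 : τ₂.nvar 15 = c := (F₂.nvar 15 rfl).trans ((F₁.nvar 15 rfl).trans hc)
  have e3 : τ₂.rarr 3 = σ.rarr 3 := (F₂.rarr 3 rfl).trans (F₁.rarr 3 rfl)
  have e5 : τ₂.rarr 5 = τ₁.rarr 5 := F₂.rarr 5 rfl
  have e7₁ : τ₁.narr 7 = σ.narr 7 := F₁.narr 7 rfl
  have e7 : τ₂.narr 7 = σ.narr 7 := (F₂.narr 7 rfl).trans e7₁
  have e4 : τ₂.rarr 4 = σ.rarr 4 := (F₂.rarr 4 rfl).trans (F₁.rarr 4 rfl)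
  have hfr : frameOf d τ₂ = frameOf d σ := by funext k l; simp [frameOf, e4]
  rw [hc] at h₁
  rw [e7₁] at h₂
  have hnotin : c ∉ Finset.range c := by simp
  rw [Finset.range_add_one]
  -- After the coefficients are set the frame is still the old one, so the postcondition speaks of
  -- any `F'` that the update formula yields.
  refine Runs.seq (B := 10 + 200 * d) (P := fun τ => frameOf d τ = frameOf d σ ∧ τ.nvar 1 = d ∧
    ∀ F', (∀ k < d, ∀ l < d, F' k l = frameOf d σ k l - τ.rarr 7 k *
      ∑ k' ∈ Finset.range d, τ.rarr 6 k' * frameOf d σ k' l) →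
      IsFrame d (denseOf d σ) (insert c (Finset.range c)) (σ.rarr 3) F' (activeOf d τ)) ?_ ?_
  · refine (Runs.ite (B := 200 * d) (fun hlt => ?_) (fun hlt => ?_)).mono
      (by simp only [BExp.cost, NExp.cost]; omega) fun τ _ h => h
    · simp only [BExp.holds, NExp.eval, hd₂] at hlt
      have hp := h₂.resolve_left fun h => by omega
      refine (pivotCoeffs_runs ω hd₂ hd1).mono (by omega) fun τ F₃ h => ?_
      refine ⟨?_, (F₃.nvar 1 rfl).trans hd₂, fun F' hF' => ?_⟩
      · rw [← hfr]; funext k l; simp [frameOf, show τ.rarr 4 = τ₂.rarr 4 from F₃.rarr 4 rfl]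
      · have hact : activeOf d τ = insert (τ₂.nvar 20) (activeOf d σ) := by
          ext k
          rw [Finset.mem_insert, mem_activeOf, mem_activeOf, h.2.2 k, e7]
          split_ifs with hk
          · simp [hk, hlt]
          · simp [hk]
        rw [hact]
        refine hF.insert_pivot (j := τ₂.nvar 20) hnotin hw hlt ?_ ?_ h.1 ?_ hF'
        · rw [mem_activeOf]; simp [hp.2.1]
        · rw [← h₁ _ hlt]; exact hp.2.2
        · intro k hk
          rw [h.2.1 k hk, e15, e3, e5, h₁ k hk, h₁ _ hlt]
    · simp only [BExp.holds, NExp.eval, hd₂] at hlt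
      have hp := h₂.resolve_right fun h => by omega
      refine (rankOneCoeffs_runs ω hd₂ hd1 rfl rfl).mono le_rfl fun τ F₃ h => ?_
      refine ⟨?_, (F₃.nvar 1 rfl).trans hd₂, fun F' hF' => ?_⟩
      · rw [← hfr]; funext k l; simp [frameOf, show τ.rarr 4 = τ₂.rarr 4 from F₃.rarr 4 rfl]
      · have hact : activeOf d τ = activeOf d σ := by
          simp only [activeOf, show τ.narr 7 = τ₂.narr 7 from F₃.narr 7 rfl, e7]
        rw [hact]
        refine hF.insert_rankOne (s := ∑ k ∈ Finset.range d, τ₂.rarr 5 k * τ₂.rarr 5 k)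
          hnotin hw ?_ ?_ ?_ ?_ hF'
        · intro k hk hkn
          rw [← h₁ k hk]
          refine hp.2 k hk ?_
          by_contra h0
          exact hkn (mem_activeOf.2 ⟨hk, h0⟩)
        · refine Finset.sum_congr rfl fun k hk => ?_
          rw [e5, h₁ k (Finset.mem_range.1 hk)]
        · intro k hk
          rw [h.1 k hk, e5, h₁ k hk]
        · intro k hk
          rw [h.2 k hk, e15, e3, e5, h₁ k hk]
  · rintro τ F₃ ⟨h3, hd₃, h4⟩
    refine (updateFrame_runs ω hd₃ hd1).mono le_rfl fun τ' F₄ h5 => ?_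
    have hact : activeOf d τ' = activeOf d τ := by
      simp only [activeOf, show τ'.narr 7 = τ.narr 7 from F₄.narr 7 rfl]
    rw [hact]
    rw [h3] at h5
    exact h4 _ h5

end RealRAM

namespace RealRAM

attribute [local simp] Cmd.run NExp.eval RExp.eval BExp.holds State.setN State.setR State.storeN
  State.storeR State.advance Function.update_apply

/-! ### The Lewis iteration -/

/-- Set the frame to the unit vectors and unmark all coordinates. -/
def initFrame : Cmd :=
  .forN 16 (.var 1) (.seq (.forN 23 (.var 1) (.rstore 4 (idx 16 23) (.ofNat (.const 0))))
    (.seq (.rstore 4 (idx 16 16) (.ofNat (.const 1))) (.nstore 7 (.var 16) (.const 0))))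

theorem initFrame_runs (ω : Tape) {σ : State} {d : ℕ} (hd : σ.nvar 1 = d) (hd1 : 1 ≤ d) :
    Runs ω initFrame σ (100 * (d * d)) (fun τ =>
      (∀ k < d, ∀ l < d, frameOf d τ k l = if k = l then 1 else 0) ∧ activeOf d τ = ∅) := by
  refine (Runs.forN (N := d) (B := 40 + d * 20) (Inv := fun k τ =>
      (∀ k' < k, ∀ l < d, frameOf d τ k' l = if k' = l then 1 else 0) ∧
      ∀ k' < k, τ.narr 7 k' = 0) rfl ?_ ?_ ?_).mono ?_ ?_
  · intro τ hF
    exact (hF.nvar 1 rfl).trans hd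
  · constructor <;> intro k' hk' <;> omega
  · rintro k hk τ hF hi ⟨h1, h2⟩
    have hd' : τ.nvar 1 = d := (hF.nvar 1 rfl).trans hd
    refine ((Runs.forN (N := d) (B := 10) (Inv := fun j τ' =>
      (∀ k' < k, ∀ l < d, frameOf d τ' k' l = if k' = l then 1 else 0) ∧
        ∀ l < j, frameOf d τ' k l = 0) rfl ?_ ?_ ?_).seq (B' := 20) ?_).mono ?_ fun τ _ h => h
    · intro τ' hF'
      exact (hF'.nvar 1 rfl).trans hd'
    · exact ⟨fun k' hk' l hl => h1 k' hk' l hl, fun l hl => by omega⟩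
    · rintro j hj τ' hF' hi' ⟨h3, h4⟩
      have e1 : τ'.nvar 1 = d := (hF'.nvar 1 rfl).trans hd'
      have e16 : τ'.nvar 16 = k := (hF'.nvar 16 rfl).trans hi
      refine Runs.of_loopFree rfl (by decide) ⟨fun k' hk' l hl => ?_, fun l hl => ?_⟩
      · have := h3 k' hk' l hl
        simp only [frameOf] at this ⊢
        simp only [Cmd.run, NExp.eval, RExp.eval, State.storeR, State.setN, e1, e16, hi',
          Function.update_self]
        rw [Function.update_of_ne (by rw [Ne, index_inj hl hj]; omega), this]
      · have := h4 l
        simp only [frameOf] at this ⊢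
        simp only [Cmd.run, NExp.eval, RExp.eval, State.storeR, State.setN, e1, e16, hi',
          Function.update_self]
        by_cases hlj : l = j
        · rw [hlj, Function.update_self]; simp
        · rw [Function.update_of_ne (by rw [Ne, index_inj (by omega) hj]; omega),
            this (by omega)]
    · rintro τ' F' ⟨h3, h4⟩
      have e1 : τ'.nvar 1 = d := (F'.nvar 1 rfl).trans hd'
      have e16 : τ'.nvar 16 = k := (F'.nvar 16 rfl).trans hi
      have e7 : τ'.narr 7 = τ.narr 7 := F'.narr 7 rfl
      refine Runs.of_loopFree rfl (by decide) ⟨fun k' hk' l hl => ?_, fun k' hk' => ?_⟩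
      · have h5 := h3 k'
        have h6 := h4 l hl
        simp only [frameOf] at h5 h6 ⊢
        simp only [Cmd.run, NExp.eval, RExp.eval, State.storeR, State.storeN, State.setN, e1, e16,
          Function.update_self]
        by_cases hkk : k' = k
        · subst hkk
          by_cases hlk : l = k'
          · subst hlk; simp
          · rw [Function.update_of_ne (by rw [Ne, index_inj hl hk]; omega), h6,
              if_neg (Ne.symm hlk)]
        · rw [Function.update_of_ne (by rw [Ne, index_inj hl hk]; omega), h5 (by omega) l hl]
      · simp [e16, e7]
        intro h; exact h2 k' (by omega)
    · simp only [NExp.cost]; omega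
  · simp only [NExp.cost]
    nlinarith
  · rintro τ _ ⟨h1, h2⟩
    refine ⟨h1, Finset.filter_eq_empty_iff.2 fun k hk => ?_⟩
    simp [h2 k (Finset.mem_range.1 hk)]

/-- Set the weight of each row to its norm in the dual of the current frame. -/
def reweight : Cmd :=
  .forN 15 (.var 19) (.seq computeV (.seq
    (.sumTo 2 16 (.var 1) (.mul (.read 5 (.var 16)) (.read 5 (.var 16))))
    (.rstore 3 (.var 15) (.sqrt (.var 2)))))

theorem reweight_runs (ω : Tape) {σ : State} {d : ℕ} (hd : σ.nvar 1 = d) (hd1 : 1 ≤ d) :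
    Runs ω reweight σ (300 * (d * d) * (σ.nvar 19 + 1)) (fun τ => ∀ c < σ.nvar 19,
      τ.rarr 3 c = √(∑ k ∈ Finset.range d, dot d (denseOf d σ c) (frameOf d σ k) *
        dot d (denseOf d σ c) (frameOf d σ k))) := by
  refine (Runs.forN (N := σ.nvar 19) (B := 200 * (d * d)) (Inv := fun j τ => ∀ c < j,
      τ.rarr 3 c = √(∑ k ∈ Finset.range d, dot d (denseOf d σ c) (frameOf d σ k) *
        dot d (denseOf d σ c) (frameOf d σ k))) rfl ?_ ?_ ?_).mono ?_ fun τ _ h => h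
  · intro τ hF
    exact hF.nvar 19 rfl
  · intro c hc; omega
  · intro j hj τ hF hi hI
    have hd' : τ.nvar 1 = d := (hF.nvar 1 rfl).trans hd
    have e2 : denseOf d τ = denseOf d σ := by
      funext c l; simp only [denseOf, show τ.rarr 2 = σ.rarr 2 from hF.rarr 2 rfl]
    have e4 : frameOf d τ = frameOf d σ := by
      funext c l; simp only [frameOf, show τ.rarr 4 = σ.rarr 4 from hF.rarr 4 rfl]
    refine ((computeV_runs ω hd' hd1).seq (B' := 60 + d * 30) fun τ₁ F₁ h₁ => Runs.mono
      ((Runs.sumTo (N := d) (fun k => τ₁.rarr 5 k * τ₁.rarr 5 k) ?_ ?_).seq (B' := 10)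
        (Q := fun τ' => ∀ c < j + 1, (τ'.setN 15 (j + 1)).rarr 3 c =
          √(∑ k ∈ Finset.range d, dot d (denseOf d σ c) (frameOf d σ k) *
        dot d (denseOf d σ c) (frameOf d σ k)))
        fun τ₂ _ hτ₂ => ?_) ?_ fun τ _ h => h).mono ?_
        fun τ _ h => h
    · intro k v
      simp [show τ₁.nvar 1 = d from (F₁.nvar 1 rfl).trans hd']
    · intro k _ v; simp
    · subst hτ₂
      refine Runs.of_loopFree rfl (by decide) ?_
      intro c hc
      simp [show τ₁.nvar 15 = j from (F₁.nvar 15 rfl).trans hi]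
      split_ifs with h
      · congr 1
        refine Finset.sum_congr rfl fun k hk => ?_
        rw [h₁ k (Finset.mem_range.1 hk), hi, e2, e4, h]
      · rw [show τ₁.rarr 3 = τ.rarr 3 from F₁.rarr 3 rfl]
        exact hI c (by omega)
    · simp only [NExp.cost, RExp.cost]; omega
    · nlinarith
  · simp only [NExp.cost]
    nlinarith [Nat.mul_le_mul_left (σ.nvar 19) (Nat.mul_le_mul hd1 hd1), Nat.mul_le_mul hd1 hd1]

/-- The Lewis iteration for the chosen rows. -/
def lewis : Cmd :=
  .forN 14 (.add (.var 7) (.const 1)) (.seq initFrame (.seq (.forN 15 (.var 19) addRow) reweight))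

/-- Halving the excess over 4d for `σ.nvar 7` rounds is enough since `cnt` is at most 2 to that
power. -/
theorem lewis_runs (ω : Tape) {σ : State} {d cnt : ℕ} (hd : σ.nvar 1 = d) (hd1 : 1 ≤ d)
    (hcnt : σ.nvar 19 = cnt) (hL : cnt ≤ 2 ^ σ.nvar 7) (hw : ∀ c < cnt, σ.rarr 3 c = 1)
    (hne : ∀ c < cnt, ∃ l < d, denseOf d σ c l ≠ 0) :
    Runs ω lewis σ ((σ.nvar 7 + 2) * (2000 * (d * d) * (cnt + 1))) (fun τ =>
      IsRounding d (denseOf d σ) (Finset.range cnt) (4 * d) (frameOf d τ) (activeOf d τ)) := by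
  have hdd : 1 ≤ d * d := Nat.mul_le_mul hd1 hd1
  have hd0 : (0 : ℝ) ≤ d := Nat.cast_nonneg _
  set b := denseOf d σ with hb
  -- The frame in memory belongs to the weights before the last reweighting. Therefore the third
  -- clause has the exponent `j - 1`, and one extra round is run.
  refine (Runs.forN (N := σ.nvar 7 + 1) (B := 1700 * (d * d) * (cnt + 1)) (Inv := fun j τ =>
    Dominating d b (Finset.range cnt) (τ.rarr 3) ∧
    ∑ i ∈ Finset.range cnt, τ.rarr 3 i ≤ max (4 * (d : ℝ)) (cnt / 2 ^ j) ∧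
    (0 < j → ∃ w, Dominating d b (Finset.range cnt) w ∧
      ∑ i ∈ Finset.range cnt, w i ≤ max (4 * (d : ℝ)) (cnt / 2 ^ (j - 1)) ∧
      IsFrame d b (Finset.range cnt) w (frameOf d τ) (activeOf d τ))) rfl ?_ ?_ ?_).mono ?_ ?_
  · intro τ hF
    simp [show τ.nvar 7 = σ.nvar 7 from hF.nvar 7 rfl]
  · refine ⟨Dominating.one fun i hi => hw i (Finset.mem_range.1 hi), ?_, fun h => by omega⟩
    have : ∑ i ∈ Finset.range cnt, (σ.setN 14 0).rarr 3 i = cnt := by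
      rw [Finset.sum_congr rfl fun i hi => show (σ.setN 14 0).rarr 3 i = 1 from
        hw i (Finset.mem_range.1 hi)]
      simp
    rw [this]
    simp
  · rintro j hj τ hF hi ⟨hdom, hW, -⟩
    have hdτ : τ.nvar 1 = d := (hF.nvar 1 rfl).trans hd
    have ecnt : τ.nvar 19 = cnt := (hF.nvar 19 rfl).trans hcnt
    have e2 : τ.rarr 2 = σ.rarr 2 := hF.rarr 2 rfl
    refine ((initFrame_runs ω hdτ hd1).seq (B' := 1590 * (d * d) * (cnt + 1))
      fun τ₁ F₁ h₁ => ?_).mono (by nlinarith) fun τ _ h => h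
    have hd₁ : τ₁.nvar 1 = d := (F₁.nvar 1 rfl).trans hdτ
    have ecnt₁ : τ₁.nvar 19 = cnt := (F₁.nvar 19 rfl).trans ecnt
    have e2₁ : τ₁.rarr 2 = σ.rarr 2 := (F₁.rarr 2 rfl).trans e2
    have e3₁ : τ₁.rarr 3 = τ.rarr 3 := F₁.rarr 3 rfl
    refine (Runs.seq (B := 1100 * (d * d) * (cnt + 1)) (B' := 300 * (d * d) * (cnt + 1))
      (P := fun τ₂ => IsFrame d b (Finset.range cnt) (τ.rarr 3) (frameOf d τ₂) (activeOf d τ₂))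
      ?_ fun τ₂ F₂ h₂ => ?_).mono (by nlinarith) fun τ _ h => h
    · refine (Runs.forN (N := cnt) (B := 1000 * (d * d)) (Inv := fun c τ₂ =>
        IsFrame d b (Finset.range c) (τ.rarr 3) (frameOf d τ₂) (activeOf d τ₂)) rfl ?_ ?_ ?_).mono
        ?_ fun τ _ h => h
      · intro τ₂ F₂
        exact (F₂.nvar 19 rfl).trans ecnt₁
      · have e : activeOf d (τ₁.setN 15 0) = ∅ := h₁.2
        rw [e]
        exact IsFrame.empty fun k hk l hl => h₁.1 k hk l hl
      · intro c hc τ₂ F₂ hi₂ hI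
        have ew : τ₂.rarr 3 = τ.rarr 3 := (F₂.rarr 3 rfl).trans e3₁
        have eb : denseOf d τ₂ = b := by
          funext c l
          simp only [hb, denseOf, show τ₂.rarr 2 = σ.rarr 2 from (F₂.rarr 2 rfl).trans e2₁]
        have h3 := addRow_runs ω (σ := τ₂) ((F₂.nvar 1 rfl).trans hd₁) hd1 hi₂
          (by rw [ew]; exact hdom.pos c (Finset.mem_range.2 hc)) (by rw [eb, ew]; exact hI)
        rw [eb, ew] at h3
        exact h3
      · simp only [NExp.cost]
        nlinarith
    · have hd₂ : τ₂.nvar 1 = d := (F₂.nvar 1 rfl).trans hd₁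
      have ecnt₂ : τ₂.nvar 19 = cnt := (F₂.nvar 19 rfl).trans ecnt₁
      have eb : denseOf d τ₂ = b := by
        funext c l
        simp only [hb, denseOf, show τ₂.rarr 2 = σ.rarr 2 from (F₂.rarr 2 rfl).trans e2₁]
      have h3 := reweight_runs ω hd₂ hd1
      rw [ecnt₂, eb] at h3
      refine h3.mono le_rfl fun τ₃ F₃ h₃ => ?_
      have ef : frameOf d (τ₃.setN 14 (j + 1)) = frameOf d τ₂ := by
        funext c l
        simp only [frameOf, State.setN, show τ₃.rarr 4 = τ₂.rarr 4 from F₃.rarr 4 rfl]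
      have ea : activeOf d (τ₃.setN 14 (j + 1)) = activeOf d τ₂ := by
        simp only [activeOf, State.setN, show τ₃.narr 7 = τ₂.narr 7 from F₃.narr 7 rfl]
      obtain ⟨h4, h5⟩ := hdom.step h₂ (fun i hi' => hne i (Finset.mem_range.1 hi'))
        (w' := τ₃.rarr 3) fun i hi' => h₃ i (Finset.mem_range.1 hi')
      refine ⟨h4, ?_, fun _ => ⟨τ.rarr 3, hdom, ?_, ?_⟩⟩
      · have := lewis_total_step hd0 hW (by positivity) h5
        rwa [div_div, ← pow_succ] at this
      · simpa using hW
      · rw [ef, ea]; exact h₂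
  · simp only [NExp.cost]
    nlinarith [Nat.mul_le_mul hdd (Nat.le_add_left 1 cnt)]
  · rintro τ _ ⟨_, _, h⟩
    obtain ⟨w, h1, h2, h3⟩ := h (by omega)
    refine h3.isRounding h1 (h2.trans (max_le le_rfl ?_))
    rw [Nat.add_sub_cancel]
    have h4 : (cnt : ℝ) ≤ 2 ^ σ.nvar 7 := by exact_mod_cast hL
    have h5 : (1 : ℝ) ≤ d := by exact_mod_cast hd1
    exact (div_le_one_of_le₀ h4 (by positivity)).trans (by linarith)

end RealRAM

namespace RealRAM

attribute [local simp] Cmd.run NExp.eval RExp.eval BExp.holds State.setN State.setR State.storeN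
  State.storeR State.advance Function.update_apply

/-! ### Estimating the rows -/

/-- Random combinations of the marked and of the unmarked vectors of the frame, in arrays `9` and
`10`. -/
def drawVectors : Cmd :=
  .seq (.forN 23 (.var 1) (.seq (.rstore 9 (.var 23) (.ofNat (.const 0)))
      (.rstore 10 (.var 23) (.ofNat (.const 0)))))
    (.forN 16 (.var 1) (.seq (.drawBelow 18 (.var 11)) (.forN 23 (.var 1)
      (.ite (.nlt (.const 0) (.read 7 (.var 16)))
        (.rstore 9 (.var 23) (.add (.read 9 (.var 23))
          (.mul (.ofNat (.var 18)) (.read 4 (idx 16 23)))))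
        (.rstore 10 (.var 23) (.add (.read 10 (.var 23))
          (.mul (.ofNat (.var 18)) (.read 4 (idx 16 23)))))))))

/-- Marked and unmarked vectors are combined separately: products with the former measure a row,
products with the null vectors only have to be tested for zero. -/
theorem drawVectors_runs (ω : Tape) {σ : State} {d : ℕ} (hd : σ.nvar 1 = d) (hd1 : 1 ≤ d)
    (h11 : σ.nvar 11 = 2) :
    Runs ω drawVectors σ (300 * (d * d)) (fun τ => τ.pos = σ.pos + d ∧
      (∀ l < d, τ.rarr 9 l = ∑ k ∈ Finset.range d, if σ.narr 7 k ≠ 0 then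
        (belowOf 2 (ω (σ.pos + k)) : ℝ) * frameOf d σ k l else 0) ∧
      ∀ l < d, τ.rarr 10 l = ∑ k ∈ Finset.range d, if σ.narr 7 k ≠ 0 then 0 else
        (belowOf 2 (ω (σ.pos + k)) : ℝ) * frameOf d σ k l) := by
  refine (Runs.seq (B := 6 + d * 20)
    (P := fun τ => ∀ l < d, τ.rarr 9 l = 0 ∧ τ.rarr 10 l = 0)
    ((Runs.forN (N := d) (B := 10) (Inv := fun k τ => ∀ l < k, τ.rarr 9 l = 0 ∧ τ.rarr 10 l = 0)
      rfl ?_ ?_ ?_).mono ?_ fun τ _ h => h)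
    (fun τ₁ F₁ h₁ => Runs.forN (N := d) (B := 20 + d * 80) (Inv := fun k τ => τ.pos = σ.pos + k ∧
      (∀ l < d, τ.rarr 9 l = ∑ k ∈ Finset.range k, if σ.narr 7 k ≠ 0 then
        (belowOf 2 (ω (σ.pos + k)) : ℝ) * frameOf d σ k l else 0) ∧
      ∀ l < d, τ.rarr 10 l = ∑ k ∈ Finset.range k, if σ.narr 7 k ≠ 0 then 0 else
        (belowOf 2 (ω (σ.pos + k)) : ℝ) * frameOf d σ k l) rfl ?_ ?_ ?_)).mono ?_ fun τ _ h => h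
  · intro τ hF
    exact (hF.nvar 1 rfl).trans hd
  · intro l hl; omega
  · intro k hk τ hF hi hI
    refine Runs.of_loopFree rfl (by decide) ?_
    intro l hl
    have := hI l
    simp [hi]
    constructor <;> intro h
    · exact (this (by omega)).1
    · exact (this (by omega)).2
  · simp only [NExp.cost]; omega
  · intro τ hF
    exact (hF.nvar 1 rfl).trans ((F₁.nvar 1 rfl).trans hd)
  · refine ⟨F₁.pos rfl, fun l hl => ?_, fun l hl => ?_⟩
    · simpa using (h₁ l hl).1
    · simpa using (h₁ l hl).2
  · rintro k hk τ hF hi ⟨hp, h9, h10⟩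
    have ed : τ.nvar 1 = d := (hF.nvar 1 rfl).trans ((F₁.nvar 1 rfl).trans hd)
    have e11 : τ.nvar 11 = 2 := (hF.nvar 11 rfl).trans ((F₁.nvar 11 rfl).trans h11)
    have e7 : τ.narr 7 = σ.narr 7 := (hF.narr 7 rfl).trans (F₁.narr 7 rfl)
    have e4 : τ.rarr 4 = σ.rarr 4 := (hF.rarr 4 rfl).trans (F₁.rarr 4 rfl)
    refine (Runs.seq (B := 2) (P := fun τ' => τ'.pos = σ.pos + (k + 1) ∧
        τ'.nvar 18 = belowOf 2 (ω (σ.pos + k))) ?_ fun τ₂ F₂ h₂ => Runs.mono (B' := 6 + d * 80)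
        (Runs.forN (N := d) (B := 60)
        (Inv := fun j τ' =>
          (∀ l < d, τ'.rarr 9 l = τ.rarr 9 l + if l < j then if σ.narr 7 k ≠ 0 then
            (belowOf 2 (ω (σ.pos + k)) : ℝ) * frameOf d σ k l else 0 else 0) ∧
          ∀ l < d, τ'.rarr 10 l = τ.rarr 10 l + if l < j then if σ.narr 7 k ≠ 0 then 0 else
            (belowOf 2 (ω (σ.pos + k)) : ℝ) * frameOf d σ k l else 0)
        rfl ?_ ?_ ?_) ?_ ?_).mono ?_ fun τ _ h => h
    · refine Runs.of_loopFree rfl (by decide) ⟨?_, ?_⟩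
      · simp [hp, add_assoc]
      · simp [e11, hp]
    · intro τ' hF'
      exact (hF'.nvar 1 rfl).trans ((F₂.nvar 1 rfl).trans ed)
    · simp [show τ₂.rarr 9 = τ.rarr 9 from F₂.rarr 9 rfl,
        show τ₂.rarr 10 = τ.rarr 10 from F₂.rarr 10 rfl]
    · rintro j hj τ' hF' hi' ⟨h3, h4⟩
      have e18' : τ'.nvar 18 = belowOf 2 (ω (σ.pos + k)) := (hF'.nvar 18 rfl).trans h₂.2
      have e16' : τ'.nvar 16 = k := (hF'.nvar 16 rfl).trans ((F₂.nvar 16 rfl).trans hi)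
      have e1' : τ'.nvar 1 = d := (hF'.nvar 1 rfl).trans ((F₂.nvar 1 rfl).trans ed)
      have e7' : τ'.narr 7 = σ.narr 7 := (hF'.narr 7 rfl).trans ((F₂.narr 7 rfl).trans e7)
      have e4' : τ'.rarr 4 = σ.rarr 4 := (hF'.rarr 4 rfl).trans ((F₂.rarr 4 rfl).trans e4)
      refine Runs.of_loopFree rfl (by decide) ?_
      have hlt : ∀ l, l < j + 1 ↔ l = j ∨ l < j := by intro l; omega
      by_cases h7 : σ.narr 7 k = 0
      · simp only [h7, ne_eq, not_true, if_false] at h3 h4 ⊢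
        simp [e18', e16', e1', e7', e4', hi', h7, frameOf, hlt] at h3 h4 ⊢
        refine ⟨h3, fun l hl => ?_⟩
        by_cases hlj : l = j
        · subst hlj; have := h4 l hl; simp [this]
        · simp [hlj, h4 l hl]
      · simp only [h7, ne_eq, not_false_eq_true, if_true] at h3 h4 ⊢
        simp [e18', e16', e1', e7', e4', hi', Nat.pos_of_ne_zero h7, frameOf, hlt] at h3 h4 ⊢
        refine ⟨fun l hl => ?_, h4⟩
        by_cases hlj : l = j
        · subst hlj; have := h3 l hl; simp [this]
        · simp [hlj, h3 l hl]
    · simp only [NExp.cost]; omega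
    · rintro τ₃ F₃ ⟨h3, h4⟩
      refine ⟨(F₃.pos rfl).trans h₂.1, fun l hl => ?_, fun l hl => ?_⟩
      · rw [Finset.sum_range_succ, ← h9 l hl]
        simpa [hl] using h3 l hl
      · rw [Finset.sum_range_succ, ← h10 l hl]
        simpa [hl] using h4 l hl
    · omega
  · simp only [NExp.cost]
    nlinarith

/-- The products of the rows with the vectors in arrays `9` and `10`, in arrays `11` and `12`. -/
def project : Cmd :=
  .seq (.forN 13 (.var 4) (.seq (.rstore 11 (.var 13) (.ofNat (.const 0)))
      (.rstore 12 (.var 13) (.ofNat (.const 0)))))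
    (.forN 13 (.var 2) (.seq
      (.rstore 11 (.read 5 (.var 13)) (.add (.read 11 (.read 5 (.var 13)))
        (.mul (.read 0 (.var 13)) (.read 9 (.read 1 (.var 13))))))
      (.rstore 12 (.read 5 (.var 13)) (.add (.read 12 (.read 5 (.var 13)))
        (.mul (.read 0 (.var 13)) (.read 10 (.read 1 (.var 13))))))))

/-- Evaluated along the list of entries, the products of all rows with a vector take time linear in
`N`, without a factor d. -/
theorem dot_rowVec {d N : ℕ} {rid col : ℕ → ℕ} {val : ℕ → ℝ} (hcol : ∀ t < N, col t < d) (r : ℕ)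
    (x : ℕ → ℝ) : dot d (rowVec N rid col val r) x =
      ∑ t ∈ Finset.range N, if rid t = r then val t * x (col t) else 0 := by
  simp only [dot, rowVec, Finset.sum_mul]
  rw [Finset.sum_comm]
  refine Finset.sum_congr rfl fun t ht => ?_
  have h := hcol t (Finset.mem_range.1 ht)
  by_cases hr : rid t = r
  · simp [hr, h]
  · simp [hr]

theorem project_runs (ω : Tape) {σ : State} {R N d : ℕ} (hR : σ.nvar 4 = R) (hN : σ.nvar 2 = N)
    (hcol : ∀ t < N, σ.narr 1 t < d) :
    Runs ω project σ (100 * (R + N + 1)) (fun τ =>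
      (∀ r < R, τ.rarr 11 r = dot d (rowVec N (σ.narr 5) (σ.narr 1) (σ.rarr 0) r) (σ.rarr 9)) ∧
      ∀ r < R, τ.rarr 12 r = dot d (rowVec N (σ.narr 5) (σ.narr 1) (σ.rarr 0) r) (σ.rarr 10)) := by
  simp only [dot_rowVec hcol]
  refine (Runs.seq (B := 6 + R * 20)
    (P := fun τ => ∀ r < R, τ.rarr 11 r = 0 ∧ τ.rarr 12 r = 0)
    ((Runs.forN (N := R) (B := 10) (Inv := fun k τ => ∀ l < k, τ.rarr 11 l = 0 ∧ τ.rarr 12 l = 0)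
      rfl ?_ ?_ ?_).mono ?_ fun τ _ h => h)
    (fun τ₁ F₁ h₁ => Runs.forN (N := N) (B := 40) (Inv := fun k τ =>
      (∀ r < R, τ.rarr 11 r = ∑ t ∈ Finset.range k,
        if σ.narr 5 t = r then σ.rarr 0 t * σ.rarr 9 (σ.narr 1 t) else 0) ∧
      ∀ r < R, τ.rarr 12 r = ∑ t ∈ Finset.range k,
        if σ.narr 5 t = r then σ.rarr 0 t * σ.rarr 10 (σ.narr 1 t) else 0)
      rfl ?_ ?_ ?_)).mono ?_ fun τ _ h => h
  · intro τ hF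
    exact (hF.nvar 4 rfl).trans hR
  · intro l hl; omega
  · intro k hk τ hF hi hI
    refine Runs.of_loopFree rfl (by decide) ?_
    intro l hl
    have := hI l
    simp [hi]
    constructor <;> intro h
    · exact (this (by omega)).1
    · exact (this (by omega)).2
  · simp only [NExp.cost]; omega
  · intro τ hF
    exact (hF.nvar 2 rfl).trans ((F₁.nvar 2 rfl).trans hN)
  · refine ⟨fun l hl => ?_, fun l hl => ?_⟩
    · simpa using (h₁ l hl).1
    · simpa using (h₁ l hl).2
  · rintro k hk τ hF hi ⟨h3, h4⟩
    have e5 : τ.narr 5 = σ.narr 5 := (hF.narr 5 rfl).trans (F₁.narr 5 rfl)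
    have e1 : τ.narr 1 = σ.narr 1 := (hF.narr 1 rfl).trans (F₁.narr 1 rfl)
    have e0 : τ.rarr 0 = σ.rarr 0 := (hF.rarr 0 rfl).trans (F₁.rarr 0 rfl)
    have e9 : τ.rarr 9 = σ.rarr 9 := (hF.rarr 9 rfl).trans (F₁.rarr 9 rfl)
    have e10 : τ.rarr 10 = σ.rarr 10 := (hF.rarr 10 rfl).trans (F₁.rarr 10 rfl)
    refine Runs.of_loopFree rfl (by decide) ?_
    simp only [Finset.sum_range_succ]
    simp [hi, e5, e1, e0, e9, e10]
    refine ⟨fun r hr => ?_, fun r hr => ?_⟩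
    · by_cases h : r = σ.narr 5 k
      · subst h; simp [h3 _ hr]
      · simp [h, Ne.symm h, h3 _ hr]
    · by_cases h : r = σ.narr 5 k
      · subst h; simp [h4 _ hr]
      · simp [h, Ne.symm h, h4 _ hr]
  · simp only [NExp.cost]; omega

/-- The new estimate of a row with estimate `u`, whose products with the two random vectors are
`p` and `n`. -/
noncomputable def estimate (u p n : ℝ) : ℝ := if n = 0 then min 1 (max u |p|) else 1

/-- Update the estimates in array `13`. -/
def updateEstimates : Cmd :=
  .forN 13 (.var 4) (.seq (.seq (.rset 1 (.read 13 (.var 13))) (.seq (.rset 2 (.read 11 (.var 13)))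
      (.rset 3 (.sub (.ofNat (.const 0)) (.var 2)))))
    (.seq (.ite (.rlt (.var 1) (.var 2)) (.rset 1 (.var 2)) .skip)
    (.seq (.ite (.rlt (.var 1) (.var 3)) (.rset 1 (.var 3)) .skip)
    (.seq (.ite (.rlt (.ofNat (.const 1)) (.var 1)) (.rset 1 (.ofNat (.const 1))) .skip)
    (.seq (.ite (.and (.not (.rlt (.ofNat (.const 0)) (.read 12 (.var 13))))
        (.not (.rlt (.read 12 (.var 13)) (.ofNat (.const 0))))) .skip
        (.rset 1 (.ofNat (.const 1))))
      (.rstore 13 (.var 13) (.var 1)))))))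

theorem updateEstimates_runs (ω : Tape) {σ : State} {R : ℕ} (hR : σ.nvar 4 = R) :
    Runs ω updateEstimates σ (100 * (R + 1)) (fun τ => ∀ r < R, τ.rarr 13 r =
      estimate (σ.rarr 13 r) (σ.rarr 11 r) (σ.rarr 12 r)) := by
  refine (Runs.forN (N := R) (B := 70) (Inv := fun k τ => ∀ r, τ.rarr 13 r =
      if r < k then estimate (σ.rarr 13 r) (σ.rarr 11 r) (σ.rarr 12 r) else σ.rarr 13 r)
      rfl ?_ ?_ ?_).mono ?_ fun τ _ h r hr => by rw [h r, if_pos hr]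
  · intro τ hF
    exact (hF.nvar 4 rfl).trans hR
  · simp
  · intro k hk τ hF hi hI
    have e11 : τ.rarr 11 = σ.rarr 11 := hF.rarr 11 rfl
    have e12 : τ.rarr 12 = σ.rarr 12 := hF.rarr 12 rfl
    have e13 : τ.rarr 13 k = σ.rarr 13 k := by simpa using hI k
    refine (Runs.seq (B := 15) (P := fun τ' => τ'.rvar 1 = σ.rarr 13 k ∧
      τ'.rvar 2 = σ.rarr 11 k ∧ τ'.rvar 3 = - σ.rarr 11 k) ?_ fun τ₁ F₁ h₁ =>
      (Runs.seq (B := 8) (P := fun τ' => τ'.rvar 1 = max (σ.rarr 13 k) (σ.rarr 11 k)) ?_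
      fun τ₂ F₂ h₂ => (Runs.seq (B := 8)
        (P := fun τ' => τ'.rvar 1 = max (σ.rarr 13 k) |σ.rarr 11 k|) ?_
      fun τ₃ F₃ h₃ => (Runs.seq (B := 10)
        (P := fun τ' => τ'.rvar 1 = min 1 (max (σ.rarr 13 k) |σ.rarr 11 k|)) ?_
      fun τ₄ F₄ h₄ => (Runs.seq (B := 20)
        (P := fun τ' => τ'.rvar 1 = estimate (σ.rarr 13 k) (σ.rarr 11 k) (σ.rarr 12 k)) ?_
      fun τ₅ F₅ h₅ => Runs.of_loopFree (B := 3) rfl (by decide) ?_))))).mono ?_ fun τ _ h => h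
    · refine Runs.of_loopFree rfl (by decide) ?_
      simp [hi, e11, e13]
    · refine Runs.of_loopFree rfl (by decide) ?_
      obtain ⟨h1, h2, h3⟩ := h₁
      by_cases h : σ.rarr 13 k < σ.rarr 11 k
      · simp [h1, h2, h, max_eq_right h.le]
      · simp [h1, h2, h, max_eq_left (not_lt.1 h)]
    · refine Runs.of_loopFree rfl (by decide) ?_
      have h3 : τ₂.rvar 3 = - σ.rarr 11 k := (F₂.rvar 3 rfl).trans h₁.2.2
      rw [show |σ.rarr 11 k| = max (σ.rarr 11 k) (-σ.rarr 11 k) from rfl, ← max_assoc]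
      by_cases h : max (σ.rarr 13 k) (σ.rarr 11 k) < - σ.rarr 11 k
      · rw [max_eq_right h.le]
        rw [max_lt_iff] at h
        simp [h₂, h3, h.1, h.2]
      · rw [max_eq_left (not_lt.1 h)]
        have h' : ¬ (BExp.rlt (.var 1) (.var 3)).holds τ₂ := by
          rwa [BExp.holds, RExp.eval, RExp.eval, h₂, h3]
        simp only [Cmd.run, if_neg h', h₂]
    · refine Runs.of_loopFree rfl (by decide) ?_
      by_cases h : 1 < max (σ.rarr 13 k) |σ.rarr 11 k|
      · simp only [Cmd.run, BExp.holds, RExp.eval, NExp.eval, h₃, Nat.cast_one, if_pos h]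
        simp [min_eq_left h.le]
      · simp only [Cmd.run, BExp.holds, RExp.eval, NExp.eval, h₃, Nat.cast_one, if_neg h]
        rw [min_eq_right (not_lt.1 h)]
    · refine Runs.of_loopFree rfl (by decide) ?_
      have e : τ₄.rarr 12 (τ₄.nvar 13) = σ.rarr 12 k := by
        rw [show τ₄.rarr 12 = τ.rarr 12 from (F₄.rarr 12 rfl).trans ((F₃.rarr 12 rfl).trans
          ((F₂.rarr 12 rfl).trans (F₁.rarr 12 rfl))), e12,
          show τ₄.nvar 13 = τ.nvar 13 from (F₄.nvar 13 rfl).trans ((F₃.nvar 13 rfl).trans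
          ((F₂.nvar 13 rfl).trans (F₁.nvar 13 rfl))), hi]
      by_cases h : σ.rarr 12 k = 0
      · simp [e, h, h₄, estimate]
      · have h' : ¬ (σ.rarr 12 k ≤ 0 ∧ 0 ≤ σ.rarr 12 k) := fun h1 => h (le_antisymm h1.1 h1.2)
        simp [e, h, estimate]
        rw [if_neg h']
        simp
    · intro r
      have e : τ₅.nvar 13 = k := by
        rw [show τ₅.nvar 13 = τ.nvar 13 from (F₅.nvar 13 rfl).trans ((F₄.nvar 13 rfl).trans
          ((F₃.nvar 13 rfl).trans ((F₂.nvar 13 rfl).trans (F₁.nvar 13 rfl)))), hi]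
      have e' : τ₅.rarr 13 = τ.rarr 13 := (F₅.rarr 13 rfl).trans ((F₄.rarr 13 rfl).trans
          ((F₃.rarr 13 rfl).trans ((F₂.rarr 13 rfl).trans (F₁.rarr 13 rfl))))
      simp [e, e', h₅]
      by_cases h : r = k
      · simp [h]
      · rw [if_neg h, hI r]
        by_cases h' : r < k
        · simp [h', h'.le]
        · rw [if_neg h', if_neg (by omega)]
    · decide
  · simp only [NExp.cost]; omega

end RealRAM

namespace RealRAM

attribute [local simp] Cmd.run NExp.eval RExp.eval BExp.holds State.setN State.setR State.storeN
  State.storeR State.advance Function.update_apply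

/-- The estimate `u` for a row with inner products `v` with a frame, from `T` random vectors `g t`
of coefficients, if the vectors outside of `J` are null vectors. -/
structure IsEstimate (T d : ℕ) (J : Finset ℕ) (g : ℕ → ℕ → ℕ) (v : ℕ → ℝ) (u : ℝ) : Prop where
  nonneg : 0 ≤ u
  le_one : u ≤ 1
  flag : ∀ t < T, ∑ k ∈ Finset.range d, (if k ∈ J then 0 else (g t k : ℝ) * v k) ≠ 0 → u = 1
  ge : ∀ t < T, min 1 |∑ k ∈ Finset.range d, if k ∈ J then (g t k : ℝ) * v k else 0| ≤ u
  le : ∀ B, 0 ≤ B → (∀ t < T, ∑ k ∈ Finset.range d, (if k ∈ J then 0 else (g t k : ℝ) * v k) = 0 ∧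
    |∑ k ∈ Finset.range d, if k ∈ J then (g t k : ℝ) * v k else 0| ≤ B) → u ≤ B

theorem IsEstimate.zero (d : ℕ) (J : Finset ℕ) (g : ℕ → ℕ → ℕ) (v : ℕ → ℝ) :
    IsEstimate 0 d J g v 0 :=
  ⟨le_rfl, zero_le_one, fun t ht => by omega, fun t ht => by omega, fun B hB _ => hB⟩

/-- Estimates never decrease and never exceed 1, so a flag raised in an earlier trial survives. -/
theorem IsEstimate.succ {T d : ℕ} {J : Finset ℕ} {g : ℕ → ℕ → ℕ} {v : ℕ → ℝ} {u : ℝ}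
    (h : IsEstimate T d J g v u) : IsEstimate (T + 1) d J g v
      (estimate u (∑ k ∈ Finset.range d, if k ∈ J then (g T k : ℝ) * v k else 0)
        (∑ k ∈ Finset.range d, if k ∈ J then 0 else (g T k : ℝ) * v k)) := by
  set p := ∑ k ∈ Finset.range d, if k ∈ J then (g T k : ℝ) * v k else 0 with hp
  set m := ∑ k ∈ Finset.range d, if k ∈ J then 0 else (g T k : ℝ) * v k with hm
  have hlt : ∀ {t}, t < T + 1 → t < T ∨ t = T := fun h => by omega
  unfold estimate
  split_ifs with h0
  · have hu : u ≤ min 1 (max u |p|) := le_min h.le_one (le_max_left _ _)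
    refine ⟨h.nonneg.trans hu, min_le_left _ _, fun t ht hne => ?_, fun t ht => ?_,
      fun B hB hall => ?_⟩
    · rcases hlt ht with h1 | rfl
      · exact le_antisymm (min_le_left _ _) ((h.flag t h1 hne).symm.le.trans hu)
      · exact absurd h0 hne
    · rcases hlt ht with h1 | rfl
      · exact (h.ge t h1).trans hu
      · exact min_le_min_left _ (le_max_right _ _)
    · exact (min_le_right _ _).trans (max_le (h.le B hB fun t ht => hall t (by omega))
        (hall T (by omega)).2)
  · refine ⟨zero_le_one, le_rfl, fun _ _ _ => rfl, fun _ _ => min_le_left _ _, fun B hB hall => ?_⟩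
    exact absurd (hall T (by omega)).1 h0

/-- Estimate the rows by products with random combinations of the vectors of the frame. -/
def trials : Cmd :=
  .forN 14 (.var 22) (.seq drawVectors (.seq project updateEstimates))

theorem dot_sum_ite {d : ℕ} (a : ℕ → ℝ) (c : ℕ → ℝ) (F : ℕ → ℕ → ℝ) (p : ℕ → Prop)
    [DecidablePred p] {x : ℕ → ℝ}
    (hx : ∀ l < d, x l = ∑ k ∈ Finset.range d, if p k then c k * F k l else 0) :
    dot d a x = ∑ k ∈ Finset.range d, if p k then c k * dot d a (F k) else 0 := by
  unfold dot
  rw [Finset.sum_congr rfl fun l hl => by rw [hx l (Finset.mem_range.1 hl)]]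
  simp only [Finset.mul_sum]
  rw [Finset.sum_comm]
  refine Finset.sum_congr rfl fun k _ => ?_
  split_ifs
  · exact Finset.sum_congr rfl fun l _ => by ring
  · simp

theorem trials_runs (ω : Tape) {σ : State} {R N d T : ℕ} (hd : σ.nvar 1 = d) (hd1 : 1 ≤ d)
    (hR : σ.nvar 4 = R) (hN : σ.nvar 2 = N) (h11 : σ.nvar 11 = 2) (hT : σ.nvar 22 = T)
    (hcol : ∀ t < N, σ.narr 1 t < d) (h13 : ∀ i, σ.rarr 13 i = 0) :
    Runs ω trials σ ((T + 1) * (300 * (d * d) + 200 * (R + N) + 400)) (fun τ =>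
      τ.pos = σ.pos + T * d ∧ ∀ r < R, IsEstimate T d (activeOf d σ)
        (fun t k => belowOf 2 (ω (σ.pos + (t * d + k))))
        (fun k => dot d (rowVec N (σ.narr 5) (σ.narr 1) (σ.rarr 0) r) (frameOf d σ k))
        (τ.rarr 13 r)) := by
  refine (Runs.forN (N := T) (B := 300 * (d * d) + (100 * (R + N + 1) + 100 * (R + 1)))
    (Inv := fun k τ => τ.pos = σ.pos + k * d ∧ ∀ r < R, IsEstimate k d (activeOf d σ)
        (fun t k => belowOf 2 (ω (σ.pos + (t * d + k))))
        (fun k => dot d (rowVec N (σ.narr 5) (σ.narr 1) (σ.rarr 0) r) (frameOf d σ k))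
        (τ.rarr 13 r)) rfl ?_ ?_ ?_).mono ?_ fun τ _ h => h
  · intro τ hF
    exact (hF.nvar 22 rfl).trans hT
  · refine ⟨by simp, fun r _ => ?_⟩
    rw [show (σ.setN 14 0).rarr 13 r = 0 from h13 r]
    exact IsEstimate.zero _ _ _ _
  · rintro k hk τ hF hi ⟨hp, hI⟩
    have ed : τ.nvar 1 = d := (hF.nvar 1 rfl).trans hd
    have eR : τ.nvar 4 = R := (hF.nvar 4 rfl).trans hR
    have eN : τ.nvar 2 = N := (hF.nvar 2 rfl).trans hN
    have e11 : τ.nvar 11 = 2 := (hF.nvar 11 rfl).trans h11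
    have e7 : τ.narr 7 = σ.narr 7 := hF.narr 7 rfl
    have e1 : τ.narr 1 = σ.narr 1 := hF.narr 1 rfl
    have e5 : τ.narr 5 = σ.narr 5 := hF.narr 5 rfl
    have e0 : τ.rarr 0 = σ.rarr 0 := hF.rarr 0 rfl
    have e4 : frameOf d τ = frameOf d σ := by
      funext c l; simp only [frameOf, show τ.rarr 4 = σ.rarr 4 from hF.rarr 4 rfl]
    refine (drawVectors_runs ω ed hd1 e11).seq fun τ₁ F₁ h₁ => ?_
    refine (project_runs ω ((F₁.nvar 4 rfl).trans eR) ((F₁.nvar 2 rfl).trans eN)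
      (d := d) ?_).seq fun τ₂ F₂ h₂ => ?_
    · rw [show τ₁.narr 1 = τ.narr 1 from F₁.narr 1 rfl, e1]; exact hcol
    refine (updateEstimates_runs ω ((F₂.nvar 4 rfl).trans ((F₁.nvar 4 rfl).trans eR))).mono le_rfl
      fun τ₃ F₃ h₃ => ⟨?_, fun r hr => ?_⟩
    · rw [show (τ₃.setN 14 (k + 1)).pos = τ₃.pos from rfl, F₃.pos rfl, F₂.pos rfl, h₁.1, hp]
      ring
    · rw [show (τ₃.setN 14 (k + 1)).rarr 13 r = τ₃.rarr 13 r from rfl, h₃ r hr, h₂.1 r hr,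
        h₂.2 r hr, show τ₂.rarr 13 = τ.rarr 13 from (F₂.rarr 13 rfl).trans (F₁.rarr 13 rfl),
        show τ₁.narr 5 = τ.narr 5 from F₁.narr 5 rfl, show τ₁.narr 1 = τ.narr 1 from F₁.narr 1 rfl,
        show τ₁.rarr 0 = τ.rarr 0 from F₁.rarr 0 rfl, e5, e1, e0]
      have h := (hI r hr).succ
      -- Trial `k` reads the group `k` of d positions, as in `drawnGroups`.
      have hpos : ∀ j, τ.pos + j = σ.pos + (k * d + j) := fun j => by rw [hp]; ring
      rw [dot_sum_ite _ _ _ (fun k => τ.narr 7 k ≠ 0) h₁.2.1, dot_sum_ite _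
        (fun j => (belowOf 2 (ω (τ.pos + j)) : ℝ)) (frameOf d τ) (fun k => ¬ τ.narr 7 k ≠ 0)
        (fun l hl => (h₁.2.2 l hl).trans (Finset.sum_congr rfl fun _ _ => (ite_not _ _ _).symm))]
      convert h using 1
      congr 1 <;> refine Finset.sum_congr rfl fun j hj => ?_
      · rw [e7, e4, hpos]
        simp only [mem_activeOf, Finset.mem_range.1 hj, true_and]
      · rw [e7, e4, hpos, ite_not]
        simp only [mem_activeOf, Finset.mem_range.1 hj, true_and]
  · simp only [NExp.cost]
    nlinarith

/-! ### Copies of the rows -/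

/-- Distribute the numbers `0, …, M - 1` over the rows, in order, according to the estimates. Array
`8` holds the row of each number, array `9` counts the numbers of each row. -/
def makeCopies : Cmd :=
  .seq (.nset 17 (.mul (.const 240) (.mul (.mul (.var 1) (.var 1)) (.mul (.var 1) (.var 1)))))
  (.forN 13 (.var 12) (.seq
    (.seq (.nstore 8 (.var 13) (.var 21)) (.nstore 9 (.var 21) (.add (.read 9 (.var 21)) (.const 1))))
    (.ite (.and (.not (.rlt (.mul (.ofNat (.read 9 (.var 21))) (.ofNat (.var 17)))
        (.mul (.read 13 (.var 21)) (.ofNat (.var 4)))))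
        (.nlt (.add (.var 21) (.const 1)) (.var 4)))
      (.nset 21 (.add (.var 21) (.const 1))) .skip)))

/-- With U = 240d⁴, the pointer leaves a row as soon as its number c of copies satisfies cU ≥ uR.
One copy fewer was not more than enough, so (c - 1)U ≤ uR, and all rows together need at most R + (∑
u)R/U ≤ 2R copies. The last row takes what is left over. -/
theorem makeCopies_runs (ω : Tape) {σ : State} {R d : ℕ} (hR : σ.nvar 4 = R) (hR1 : 1 ≤ R)
    (hd : σ.nvar 1 = d) (hd1 : 1 ≤ d) (h12 : σ.nvar 12 = 2 * R) (h21 : σ.nvar 21 = 0)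
    (h9 : ∀ i, σ.narr 9 i = 0) (hu : ∀ r < R, 0 ≤ σ.rarr 13 r) :
    Runs ω makeCopies σ (200 * (R + 1)) (fun τ =>
      (∀ z < 2 * R, τ.narr 8 z < R) ∧
      (∀ r, τ.narr 9 r = ((Finset.range (2 * R)).filter fun z => τ.narr 8 z = r).card) ∧
      (∑ r ∈ Finset.range R, σ.rarr 13 r ≤ 240 * d ^ 4 → ∀ r < R,
        1 ≤ τ.narr 9 r ∧ σ.rarr 13 r * R ≤ τ.narr 9 r * (240 * d ^ 4))) := by
  set u := σ.rarr 13 with hudef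
  set U : ℝ := 240 * (d : ℝ) ^ 4 with hU
  have hU0 : 0 < U := by positivity
  refine (Runs.seq (B := 12) (P := fun τ => (τ.nvar 17 : ℝ) = U) (Runs.of_loopFree rfl (by decide) ?_)
    fun τ₁ F₁ h₁ => Runs.forN (N := 2 * R) (B := 50) (Inv := fun k τ =>
      τ.nvar 21 < R ∧ (∀ z < k, τ.narr 8 z ≤ τ.nvar 21) ∧
      (∀ r, τ.narr 9 r = ((Finset.range k).filter fun z => τ.narr 8 z = r).card) ∧
      (∑ r ∈ Finset.range R, (τ.narr 9 r : ℝ) = k) ∧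
      (∀ r < τ.nvar 21, 1 ≤ τ.narr 9 r ∧ u r * R ≤ τ.narr 9 r * U ∧
        (τ.narr 9 r - 1) * U ≤ u r * R) ∧
      (∀ r, τ.nvar 21 < r → τ.narr 9 r = 0) ∧
      -- The row at the pointer is either not yet oversupplied, or it is the last one and saturated.
      (τ.narr 9 (τ.nvar 21) * U ≤ u (τ.nvar 21) * R ∨
        τ.nvar 21 + 1 = R ∧ 1 ≤ τ.narr 9 (τ.nvar 21) ∧
          u (τ.nvar 21) * R ≤ τ.narr 9 (τ.nvar 21) * U)) rfl ?_ ?_ ?_).mono ?_ ?_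
  · simp [hd, hU]; ring
  · intro τ hF
    exact (hF.nvar 12 rfl).trans ((F₁.nvar 12 rfl).trans h12)
  · have e9 : τ₁.narr 9 = σ.narr 9 := F₁.narr 9 rfl
    have e21 : τ₁.nvar 21 = 0 := (F₁.nvar 21 rfl).trans h21
    simp [e9, e21, h9]
    exact ⟨by omega, fun r => (Finset.card_eq_zero.2 (Finset.filter_empty _)).symm,
      mul_nonneg (hu 0 (by omega)) (Nat.cast_nonneg _)⟩
  · rintro k hk τ hF hi ⟨hptr, h8, hcn, hsum, hdone, hrest, hcur⟩
    have e4 : τ.nvar 4 = R := (hF.nvar 4 rfl).trans ((F₁.nvar 4 rfl).trans hR)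
    have e17 : (τ.nvar 17 : ℝ) = U := by rw [hF.nvar 17 rfl, h₁]
    have e13 : τ.rarr 13 = u := (hF.rarr 13 rfl).trans (F₁.rarr 13 rfl)
    set j := τ.nvar 21 with hj
    have hcn' : ∀ r, (if r = j then τ.narr 9 j + 1 else τ.narr 9 r) =
        ((Finset.range (k + 1)).filter fun z => (if z = k then j else τ.narr 8 z) = r).card := by
      intro r
      rw [Finset.range_add_one, Finset.filter_insert, if_pos rfl, Finset.filter_congr (q := fun z =>
        τ.narr 8 z = r) (fun z hz => by rw [if_neg (Finset.mem_range.1 hz).ne])]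
      split_ifs with h1 h2 h2
      · rw [Finset.card_insert_of_notMem (by simp), ← hcn, h1]
      · exact absurd h1.symm h2
      · exact absurd h2.symm h1
      · exact hcn r
    have hsum' : ∑ r ∈ Finset.range R, ((if r = j then τ.narr 9 j + 1 else τ.narr 9 r : ℕ) : ℝ) =
        (k + 1 : ℕ) := by
      rw [Nat.cast_add, ← hsum, ← Finset.add_sum_erase _ _ (Finset.mem_range.2 hptr),
        ← Finset.add_sum_erase (Finset.range R) (fun r => (τ.narr 9 r : ℝ))
          (Finset.mem_range.2 hptr), if_pos rfl]
      rw [Finset.sum_congr rfl fun r hr => by rw [if_neg (Finset.ne_of_mem_erase hr)]]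
      push_cast; ring
    refine (Runs.seq (B := 20) (P := fun τ' => τ'.nvar 21 = j ∧
      (∀ z, τ'.narr 8 z = if z = k then j else τ.narr 8 z) ∧
      (∀ r, τ'.narr 9 r = if r = j then τ.narr 9 j + 1 else τ.narr 9 r))
      (Runs.of_loopFree rfl (by decide) ?_) fun τ₂ F₂ h₂ =>
      Runs.of_loopFree (B := 30) rfl (by decide) ?_).mono le_rfl fun τ _ h => h
    · simp [hi, hj]
    obtain ⟨h21', h8', h9'⟩ := h₂
    have e4' : τ₂.nvar 4 = R := (F₂.nvar 4 rfl).trans e4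
    have e17' : (τ₂.nvar 17 : ℝ) = U := by rw [F₂.nvar 17 rfl, e17]
    have e13' : τ₂.rarr 13 = u := (F₂.rarr 13 rfl).trans e13
    have hjj : τ₂.narr 9 j = τ.narr 9 j + 1 := by rw [h9', if_pos rfl]
    have h8le : ∀ z < k + 1, τ₂.narr 8 z ≤ j := by
      intro z hz
      rw [h8']
      split_ifs
      · exact le_rfl
      · exact h8 z (by omega)
    have hdone' : ∀ r < j, 1 ≤ τ₂.narr 9 r ∧ u r * R ≤ τ₂.narr 9 r * U ∧
        (τ₂.narr 9 r - 1) * U ≤ u r * R := by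
      intro r hr
      rw [h9', if_neg hr.ne]
      exact hdone r hr
    have hrest' : ∀ r, j < r → τ₂.narr 9 r = 0 := by
      intro r hr
      rw [h9', if_neg hr.ne']
      exact hrest r hr
    have hcn₂ : ∀ r, τ₂.narr 9 r =
        ((Finset.range (k + 1)).filter fun z => τ₂.narr 8 z = r).card := by
      intro r; simp only [h9', h8']; exact hcn' r
    have hsum₂ : ∑ r ∈ Finset.range R, (τ₂.narr 9 r : ℝ) = (k + 1 : ℕ) := by
      simp only [h9']; exact hsum'
    have hR0 : (0 : ℝ) ≤ R := Nat.cast_nonneg _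
    by_cases hlt : (τ₂.narr 9 j : ℝ) * U < u j * R
    · simp only [Cmd.run, BExp.holds, RExp.eval, NExp.eval, h21', e17', e13', e4', hlt, not_true,
        false_and, if_false]
      simp only [State.setN, Function.update_apply]
      simp only [Nat.reduceEqDiff, if_false, h21']
      exact ⟨hptr, h8le, hcn₂, hsum₂, hdone', hrest', Or.inl hlt.le⟩
    by_cases hlast : j + 1 < R
    · simp only [Cmd.run, BExp.holds, RExp.eval, NExp.eval, h21', e17', e13', e4', hlt, hlast,
        not_false_eq_true, and_self, if_true]
      simp only [State.setN, Function.update_apply]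
      simp only [Nat.reduceEqDiff, if_false, if_true]
      refine ⟨hlast, fun z hz => (h8le z hz).trans (Nat.le_succ _), hcn₂, hsum₂, ?_,
        fun r hr => hrest' r (by omega), Or.inl ?_⟩
      · intro r hr
        rcases Nat.lt_succ_iff_lt_or_eq.1 hr with h | rfl
        · exact hdone' r h
        · refine ⟨by omega, not_lt.1 hlt, ?_⟩
          rcases hcur with h | h
          · rw [hjj]; push_cast; simpa using h
          · omega
      · rw [hrest' (j + 1) (by omega)]
        simpa using mul_nonneg (hu _ hlast) hR0
    · simp only [Cmd.run, BExp.holds, RExp.eval, NExp.eval, h21', e17', e13', e4', hlt, hlast,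
        and_false, if_false]
      simp only [State.setN, Function.update_apply]
      simp only [Nat.reduceEqDiff, if_false, h21']
      exact ⟨hptr, h8le, hcn₂, hsum₂, hdone', hrest',
        Or.inr ⟨by omega, by omega, not_lt.1 hlt⟩⟩
  · simp only [NExp.cost]; omega
  · rintro τ hF ⟨hptr, h8, hcn, hsum, hdone, hrest, hcur⟩
    set j := τ.nvar 21 with hj
    refine ⟨fun z hz => (h8 z hz).trans_lt hptr, hcn, fun hUsum r hr => ?_⟩
    have hR0 : (0 : ℝ) < R := by exact_mod_cast hR1
    rcases hcur with h | ⟨h1, h2⟩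
    -- If the row at the pointer were not oversupplied, the 2R copies would satisfy 2RU ≤ UR + (R -
    -- 1)U.
    · exfalso
      have hle : ∀ r ∈ Finset.range R,
          (τ.narr 9 r : ℝ) * U ≤ u r * R + if r = j then 0 else U := by
        intro r hr
        have hr := Finset.mem_range.1 hr
        rcases lt_trichotomy r j with h3 | rfl | h3
        · rw [if_neg h3.ne]
          have := (hdone r h3).2.2
          linarith
        · simpa using h
        · rw [if_neg h3.ne', hrest r h3]
          have := mul_nonneg (hu r hr) hR0.le
          simp only [Nat.cast_zero, zero_mul]
          linarith
      have h4 := Finset.sum_le_sum hle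
      have h5 : ∑ r ∈ Finset.range R, (if r = j then 0 else U) = R * U - U := by
        rw [Finset.sum_congr rfl fun r _ => show (if r = j then 0 else U) =
          U - if r = j then U else 0 by split_ifs <;> simp, Finset.sum_sub_distrib,
          Finset.sum_ite_eq', if_pos (Finset.mem_range.2 hptr)]
        simp
      rw [← Finset.sum_mul, hsum, Finset.sum_add_distrib, ← Finset.sum_mul, h5] at h4
      push_cast at h4
      nlinarith
    · rcases Nat.lt_or_ge r j with h3 | h3
      · exact ⟨(hdone r h3).1, (hdone r h3).2.1⟩
      · rw [show r = j by omega]; exact h2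

/-! ### The output -/

/-- Draw the rows of the sampling matrix. -/
def writeSamples : Cmd :=
  .seq (.nset 3 (.var 9)) (.forN 13 (.var 9) (.seq (.drawBelow 18 (.var 12)) (.seq
    (.nstore 2 (.var 13) (.read 4 (.read 8 (.var 18))))
    (.rstore 1 (.var 13) (.div (.ofNat (.var 12))
      (.mul (.ofNat (.var 9)) (.ofNat (.read 9 (.read 8 (.var 18))))))))))

/-- A row with c of the M copies is drawn with probability c/M, so the weight M/(sc) makes the
sampled norm unbiased. -/
theorem writeSamples_runs (ω : Tape) {σ : State} {s M : ℕ} (hs : σ.nvar 9 = s)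
    (hM : σ.nvar 12 = M) :
    Runs ω writeSamples σ (100 * (s + 1)) (fun τ => τ.pos = σ.pos + s ∧ τ.nvar 3 = s ∧
      ∀ t < s, τ.narr 2 t = σ.narr 4 (σ.narr 8 (belowOf M (ω (σ.pos + t)))) ∧
        τ.rarr 1 t = M / (s * σ.narr 9 (σ.narr 8 (belowOf M (ω (σ.pos + t)))))) := by
  refine (Runs.seq (B := 2) (P := fun τ => τ.nvar 3 = s) (Runs.of_loopFree rfl (by decide) ?_)
    fun τ₁ F₁ h₁ => Runs.forN (N := s) (B := 40) (Inv := fun k τ => τ.pos = σ.pos + k ∧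
      τ.nvar 3 = s ∧
      ∀ t < k, τ.narr 2 t = σ.narr 4 (σ.narr 8 (belowOf M (ω (σ.pos + t)))) ∧
        τ.rarr 1 t = M / (s * σ.narr 9 (σ.narr 8 (belowOf M (ω (σ.pos + t)))))) rfl
      ?_ ?_ ?_).mono ?_ fun τ _ h => h
  · simp [hs]
  · intro τ hF
    exact (hF.nvar 9 rfl).trans ((F₁.nvar 9 rfl).trans hs)
  · exact ⟨F₁.pos rfl, by simpa using h₁, fun t ht => by omega⟩
  · rintro k hk τ hF hi ⟨hp, h3, hI⟩
    have es : τ.nvar 9 = s := (hF.nvar 9 rfl).trans ((F₁.nvar 9 rfl).trans hs)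
    have eM : τ.nvar 12 = M := (hF.nvar 12 rfl).trans ((F₁.nvar 12 rfl).trans hM)
    have e4 : τ.narr 4 = σ.narr 4 := (hF.narr 4 rfl).trans (F₁.narr 4 rfl)
    have e8 : τ.narr 8 = σ.narr 8 := (hF.narr 8 rfl).trans (F₁.narr 8 rfl)
    have e9 : τ.narr 9 = σ.narr 9 := (hF.narr 9 rfl).trans (F₁.narr 9 rfl)
    refine Runs.of_loopFree rfl (by decide) ⟨?_, ?_, fun t ht => ?_⟩
    · simp [hp, add_assoc]
    · simp [h3]
    · simp [hi, eM, es, e4, e8, e9, hp]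
      by_cases h : t = k
      · simp [h]
      · simpa [h] using hI t (by omega)
  · simp only [NExp.cost]; omega

/-- Output all nonempty rows. -/
def writeAll : Cmd :=
  .seq (.nset 3 (.var 4)) (.forN 13 (.var 4) (.seq (.nstore 2 (.var 13) (.read 4 (.var 13)))
    (.rstore 1 (.var 13) (.ofNat (.const 1)))))

theorem writeAll_runs (ω : Tape) {σ : State} {R : ℕ} (hR : σ.nvar 4 = R) :
    Runs ω writeAll σ (100 * (R + 1)) (fun τ => τ.nvar 3 = R ∧
      ∀ t < R, τ.narr 2 t = σ.narr 4 t ∧ τ.rarr 1 t = 1) := by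
  refine (Runs.seq (B := 2) (P := fun τ => τ.nvar 3 = R) (Runs.of_loopFree rfl (by decide) ?_)
    fun τ₁ F₁ h₁ => Runs.forN (N := R) (B := 20) (Inv := fun k τ => τ.nvar 3 = R ∧
      ∀ t < k, τ.narr 2 t = σ.narr 4 t ∧ τ.rarr 1 t = 1) rfl ?_ ?_ ?_).mono ?_ fun τ _ h => h
  · simp [hR]
  · intro τ hF
    exact (hF.nvar 4 rfl).trans ((F₁.nvar 4 rfl).trans hR)
  · exact ⟨by simpa using h₁, fun t ht => by omega⟩
  · rintro k hk τ hF hi ⟨h3, hI⟩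
    have e4 : τ.narr 4 = σ.narr 4 := (hF.narr 4 rfl).trans (F₁.narr 4 rfl)
    refine Runs.of_loopFree rfl (by decide) ⟨?_, fun t ht => ?_⟩
    · simp [h3]
    · simp [hi, e4]
      by_cases h : t = k
      · simp [h]
      · simpa [h] using hI t (by omega)
  · simp only [NExp.cost]; omega

end RealRAM

/-! ### The failure events -/

theorem card_markov {X : Type*} [Fintype X] {f : X → ℝ} {K : ℝ} (hK : 0 < K) (hf : ∀ x, 0 ≤ f x)
    (h : ∑ x, f x ≤ K * Fintype.card X) [DecidablePred fun x => 20 * K < f x] :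
    20 * (Finset.univ.filter fun x => 20 * K < f x).card ≤ Fintype.card X := by
  set B := Finset.univ.filter fun x => 20 * K < f x with hB
  have h1 : (B.card : ℝ) * (20 * K) ≤ ∑ x, f x := by
    rw [← nsmul_eq_mul, ← Finset.sum_const]
    exact (Finset.sum_le_sum fun x hx => (Finset.mem_filter.1 hx).2.le).trans
      (Finset.sum_le_sum_of_subset_of_nonneg (Finset.subset_univ _) fun x _ _ => hf x)
  have h2 : (B.card : ℝ) * 20 ≤ Fintype.card X := by
    refine le_of_mul_le_mul_right ?_ hK
    linarith
  have h3 : ((20 * B.card : ℕ) : ℝ) ≤ Fintype.card X := by push_cast; linarith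
  exact_mod_cast h3

/-- The set of the `i` with `b i = 0`. -/
def chosen {R D : ℕ} (b : Fin R → Fin (D + 1)) : Finset ℕ :=
  (Finset.univ.filter fun i => b i = 0).map Fin.valEmbedding

theorem mem_chosen {R D : ℕ} {b : Fin R → Fin (D + 1)} {r : ℕ} :
    r ∈ chosen b ↔ ∃ h : r < R, b ⟨r, h⟩ = 0 := by
  simp only [chosen, Finset.mem_map, Finset.mem_filter, Finset.mem_univ, true_and,
    Fin.valEmbedding_apply]
  constructor
  · rintro ⟨i, hi, rfl⟩; exact ⟨i.2, hi⟩
  · rintro ⟨h, hb⟩; exact ⟨⟨r, h⟩, hb, rfl⟩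

/-- The sensitivity of `i` in the set enlarged by `i` does not depend on the draw for `i`, which is
the form that `leave_one_out` needs. -/
theorem insert_chosen_update {R D : ℕ} (b : Fin R → Fin (D + 1)) (i : Fin R) :
    insert (i : ℕ) (chosen (Function.update b i 0)) = insert (i : ℕ) (chosen b) := by
  ext r
  simp only [Finset.mem_insert, mem_chosen]
  refine or_congr_right' fun hne => ?_
  refine exists_congr fun h => ?_
  rw [Function.update_of_ne]
  rintro rfl
  exact hne rfl

/-- Markov for the size of the random set; its mean R/(D + 1) is `leave_one_out` for the constant 1.
-/
theorem card_chosen_large {R D : ℕ} (hR : 1 ≤ R) :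
    20 * (Finset.univ.filter fun b : Fin R → Fin (D + 1) =>
      20 * R < (chosen b).card * (D + 1)).card ≤ Fintype.card (Fin R → Fin (D + 1)) := by
  classical
  have hR0 : (0 : ℝ) < R := by exact_mod_cast hR
  have h := leave_one_out (R := R) (D := D) fun _ _ => 1
  have h1 : ∑ b : Fin R → Fin (D + 1), (((chosen b).card * (D + 1) : ℕ) : ℝ) ≤
      R * Fintype.card (Fin R → Fin (D + 1)) := by
    simp only [Finset.sum_const, nsmul_eq_mul, mul_one, Finset.card_univ, Fintype.card_fin] at h
    simp only [chosen, Finset.card_map, Nat.cast_mul]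
    rw [← Finset.sum_mul, mul_comm, ← h, mul_comm]
  refine le_trans (le_of_eq ?_) (card_markov hR0 (fun b => Nat.cast_nonneg _) h1)
  congr 2
  ext b
  simp only [Finset.mem_filter, Finset.mem_univ, true_and]
  exact_mod_cast Iff.rfl

-- By `leave_one_out` the mean is D + 1 = d² times the mean total sensitivity within the chosen set,
-- thus at most 4d³. Markov turns this into 80d³ at failure rate 1/20.
open Classical in
theorem card_sens_large {R D d : ℕ} {a : ℕ → ℕ → ℝ} (hd : 1 ≤ d) (hD : D + 1 = d * d)
    (hne : ∀ r < R, ∃ l < d, a r l ≠ 0) :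
    20 * (Finset.univ.filter fun b : Fin R → Fin (D + 1) =>
      80 * (d : ℝ) ^ 3 < ∑ r ∈ Finset.range R, sens d a (insert r (chosen b)) r).card ≤
      Fintype.card (Fin R → Fin (D + 1)) := by
  have hd0 : (0 : ℝ) < d := by exact_mod_cast hd
  have h := leave_one_out (R := R) (D := D) fun b i => sens d a (insert (i : ℕ) (chosen b)) i
  simp only [insert_chosen_update] at h
  have h1 : ∑ b : Fin R → Fin (D + 1), ∑ r ∈ Finset.range R, sens d a (insert r (chosen b)) r ≤
      4 * (d : ℝ) ^ 3 * Fintype.card (Fin R → Fin (D + 1)) := by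
    simp only [Finset.sum_range]
    rw [h]
    have h2 : ∀ b : Fin R → Fin (D + 1),
        ∑ i with b i = 0, sens d a (insert (i : ℕ) (chosen b)) i ≤ 4 * d := by
      intro b
      refine le_trans (le_of_eq ?_) (sum_sens_le (a := a) (S := chosen b) hd fun i hi =>
        hne i (mem_chosen.1 hi).1)
      conv_rhs => rw [chosen, Finset.sum_map]
      refine Finset.sum_congr rfl fun i hi => ?_
      rw [Finset.insert_eq_of_mem (mem_chosen.2 ⟨i.2, (Finset.mem_filter.1 hi).2⟩)]
      rfl
    have h3 := Finset.sum_le_sum fun b (_ : b ∈ Finset.univ) => h2 b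
    rw [Finset.sum_const, Finset.card_univ, nsmul_eq_mul] at h3
    calc _ ≤ ((D + 1 : ℕ) : ℝ) * (Fintype.card (Fin R → Fin (D + 1)) * (4 * d)) :=
          mul_le_mul_of_nonneg_left h3 (Nat.cast_nonneg _)
      _ = _ := by rw [show ((D + 1 : ℕ) : ℝ) = d * d by exact_mod_cast hD]; ring
  have h2 := card_markov (K := 4 * (d : ℝ) ^ 3) (by positivity)
    (fun b => Finset.sum_nonneg fun r _ => sens_nonneg) h1
  simpa only [show 20 * (4 * (d : ℝ) ^ 3) = 80 * (d : ℝ) ^ 3 by ring] using h2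

open Classical in
theorem card_bad_choice {R D d : ℕ} {a : ℕ → ℕ → ℝ} (hR : 1 ≤ R) (hd : 1 ≤ d) (hD : D + 1 = d * d)
    (hne : ∀ r < R, ∃ l < d, a r l ≠ 0) :
    10 * (Finset.univ.filter fun b : Fin R → Fin (D + 1) =>
      20 * R < (chosen b).card * (D + 1) ∨
      80 * (d : ℝ) ^ 3 < ∑ r ∈ Finset.range R, sens d a (insert r (chosen b)) r).card ≤
      Fintype.card (Fin R → Fin (D + 1)) := by
  have h1 := card_chosen_large (D := D) hR
  have h2 := card_sens_large hd hD hne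
  have h3 := Finset.card_union_le (Finset.univ.filter fun b : Fin R → Fin (D + 1) =>
      20 * R < (chosen b).card * (D + 1)) (Finset.univ.filter fun b : Fin R → Fin (D + 1) =>
      80 * (d : ℝ) ^ 3 < ∑ r ∈ Finset.range R, sens d a (insert r (chosen b)) r)
  rw [← Finset.filter_or] at h3
  convert (show 10 * (Finset.univ.filter fun b : Fin R → Fin (D + 1) =>
      20 * R < (chosen b).card * (D + 1) ∨
      80 * (d : ℝ) ^ 3 < ∑ r ∈ Finset.range R, sens d a (insert r (chosen b)) r).card ≤
      Fintype.card (Fin R → Fin (D + 1)) by omega)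

-- A union bound over the rows, each failing at rate at most 2 to the power -T. The hypothesis `hRT`
-- gives 1/32 in total.
open Classical in
theorem card_bad_trials {R T d : ℕ} (w : ℕ → Fin d → ℝ) (j : ℕ → Fin d) (hRT : 32 * R ≤ 2 ^ T) :
    20 * (Finset.univ.filter fun g : Fin T → Fin d → Fin 2 => ∃ r < R, ∀ t,
      |∑ k, w r k * ((g t k : ℕ) : ℝ)| < |w r (j r)| / 2).card ≤
      Fintype.card (Fin T → Fin d → Fin 2) := by
  set K := Fintype.card (Fin T → Fin d → Fin 2) with hK
  set B : ℕ → Finset (Fin T → Fin d → Fin 2) := fun r => Finset.univ.filter fun g => ∀ t,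
      |∑ k, w r k * ((g t k : ℕ) : ℝ)| < |w r (j r)| / 2 with hB
  have h1 : (Finset.univ.filter fun g : Fin T → Fin d → Fin 2 => ∃ r < R, ∀ t,
      |∑ k, w r k * ((g t k : ℕ) : ℝ)| < |w r (j r)| / 2) ⊆ (Finset.range R).biUnion B := by
    intro g hg
    obtain ⟨r, hr, h⟩ := (Finset.mem_filter.1 hg).2
    exact Finset.mem_biUnion.2 ⟨r, Finset.mem_range.2 hr, Finset.mem_filter.2 ⟨Finset.mem_univ _, h⟩⟩
  have h2 : 2 ^ T * ((Finset.range R).biUnion B).card ≤ R * K := by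
    calc 2 ^ T * ((Finset.range R).biUnion B).card ≤ 2 ^ T * ∑ r ∈ Finset.range R, (B r).card :=
          Nat.mul_le_mul_left _ Finset.card_biUnion_le
      _ = ∑ r ∈ Finset.range R, 2 ^ T * (B r).card := Finset.mul_sum _ _ _
      _ ≤ ∑ r ∈ Finset.range R, K := Finset.sum_le_sum fun r _ => by
          have := card_all_small (T := T) (w r) (j r)
          simp only [hB]
          convert this
      _ = R * K := by simp
  have h3 := Finset.card_le_card h1
  have h4 : 2 ^ T * (32 * ((Finset.range R).biUnion B).card) ≤ 2 ^ T * K :=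
    calc 2 ^ T * (32 * ((Finset.range R).biUnion B).card)
        = 32 * (2 ^ T * ((Finset.range R).biUnion B).card) := by ring
      _ ≤ 32 * (R * K) := Nat.mul_le_mul_left _ h2
      _ = (32 * R) * K := by ring
      _ ≤ 2 ^ T * K := Nat.mul_le_mul_right _ hRT
  have h5 := Nat.le_of_mul_le_mul_left h4 (by positivity)
  omega

/-! ### What the estimates guarantee, and sampling from the copies. -/

namespace RealRAM

/-- Unless a random combination is untypically small in all trials, the estimate of a row is not
too small. -/
theorem exists_trial_test {d : ℕ} (hd : 1 ≤ d) (J : Finset ℕ) (v : ℕ → ℝ) :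
    ∃ (w : Fin d → ℝ) (j : Fin d), ∀ (T : ℕ) (g : ℕ → ℕ → ℕ) (G : Fin T → Fin d → Fin 2) (u : ℝ),
      (∀ (t : Fin T) (k : Fin d), g t k = G t k) → IsEstimate T d J g v u →
      ¬ (∀ t, |∑ k, w k * ((G t k : ℕ) : ℝ)| < |w j| / 2) →
      u = 1 ∨ (∀ k < d, k ∉ J → v k = 0) ∧ ∀ k < d, |v k| ≤ 2 * u := by
  have hne : (Finset.univ : Finset (Fin d)).Nonempty := ⟨⟨0, hd⟩, Finset.mem_univ _⟩
  by_cases hnull : ∀ k < d, k ∉ J → v k = 0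
  -- No null vector sees the row, so the test concerns the marked products, at the largest of them:
  -- a combination of at least half its size bounds all products by 2u.
  · obtain ⟨j, -, hj⟩ := Finset.exists_max_image Finset.univ
      (fun k : Fin d => |if (k : ℕ) ∈ J then v k else 0|) hne
    refine ⟨fun k => if (k : ℕ) ∈ J then v k else 0, j, fun T g G u hgG h htest => ?_⟩
    push Not at htest
    obtain ⟨t, ht⟩ := htest
    have h1 := h.ge t t.2
    rw [Finset.sum_range, Finset.sum_congr rfl fun (k : Fin d) _ => show
      (if (k : ℕ) ∈ J then (g t k : ℝ) * v k else 0) =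
        (if (k : ℕ) ∈ J then v k else 0) * ((G t k : ℕ) : ℝ) by
      rw [hgG]; split_ifs <;> ring] at h1
    rcases min_le_iff.1 h1 with h2 | h2
    · exact Or.inl (le_antisymm h.le_one h2)
    · refine Or.inr ⟨hnull, fun k hk => ?_⟩
      have h3 := hj ⟨k, hk⟩ (Finset.mem_univ _)
      simp only at h3
      by_cases hkJ : k ∈ J
      · rw [if_pos hkJ] at h3
        linarith
      · rw [hnull k hk hkJ, abs_zero]
        linarith [h.nonneg]
  · push Not at hnull
    obtain ⟨j, hjd, hjJ, hj⟩ := hnull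
    -- Some null vector sees the row. The test concerns the unmarked products, and passing it makes
    -- one combination nonzero, which raises the flag.
    refine ⟨fun k => if (k : ℕ) ∈ J then 0 else v k, ⟨j, hjd⟩, fun T g G u hgG h htest => ?_⟩
    push Not at htest
    obtain ⟨t, ht⟩ := htest
    refine Or.inl (h.flag t t.2 ?_)
    rw [Finset.sum_range, Finset.sum_congr rfl fun (k : Fin d) _ => show
      (if (k : ℕ) ∈ J then 0 else (g t k : ℝ) * v k) =
        (if (k : ℕ) ∈ J then 0 else v k) * ((G t k : ℕ) : ℝ) by
      rw [hgG]; split_ifs <;> ring]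
    intro h0
    rw [h0, abs_zero, if_neg hjJ] at ht
    have := abs_pos.2 hj
    linarith

/-- A 0-1 combination never exceeds the sum of the absolute values, which `sum_abs_le_sens` bounds.
If a null vector sees the row, its sensitivity is at least 1 and u ≤ 1 suffices. The bound holds for
every outcome of the trials. -/
theorem IsEstimate.le_sens {T d i : ℕ} {S J : Finset ℕ} {g : ℕ → ℕ → ℕ} {a F : ℕ → ℕ → ℝ} {u : ℝ}
    (h : IsEstimate T d J g (fun k => dot d (a i) (F k)) u) (hg : ∀ t k, g t k ≤ 1)
    (hS : IsRounding d a S (4 * d) F J) (hd : 1 ≤ d) :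
    u ≤ 3 * d * sens d a (insert i S) i := by
  have hd' : (1 : ℝ) ≤ d := by exact_mod_cast hd
  by_cases hnull : ∀ k < d, k ∉ J → dot d (a i) (F k) = 0
  · refine le_trans (le_min h.le_one (h.le _ (Finset.sum_nonneg fun _ _ => abs_nonneg _)
      fun t _ => ⟨?_, ?_⟩)) (hS.sum_abs_le_sens hd i)
    · refine Finset.sum_eq_zero fun k hk => ?_
      split_ifs with hkJ
      · rfl
      · rw [hnull k (Finset.mem_range.1 hk) hkJ, mul_zero]
    · refine (Finset.abs_sum_le_sum_abs _ _).trans (Finset.sum_le_sum fun k _ => ?_)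
      split_ifs
      · rw [abs_mul, Nat.abs_cast]
        have : (g t k : ℝ) ≤ 1 := by exact_mod_cast hg t k
        exact mul_le_of_le_one_left (abs_nonneg _) this
      · rw [abs_zero]; exact abs_nonneg _
  · push Not at hnull
    obtain ⟨k, hk, hkJ, hv⟩ := hnull
    have h1 := hS.one_le_sens (by positivity) hk hkJ hv
    have := h.le_one
    nlinarith

end RealRAM

theorem IsRounding.image {d cnt : ℕ} {a b F : ℕ → ℕ → ℝ} {W : ℝ} {J : Finset ℕ}
    (h : IsRounding d b (Finset.range cnt) W F J) {f : ℕ → ℕ}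
    (hf : Set.InjOn f (Finset.range cnt)) (hb : ∀ c < cnt, ∀ l < d, b c l = a (f c) l) :
    IsRounding d a ((Finset.range cnt).image f) W F J := by
  have e : ∀ x, rowNorm d a ((Finset.range cnt).image f) x = rowNorm d b (Finset.range cnt) x := by
    intro x
    rw [rowNorm, Finset.sum_image hf]
    exact Finset.sum_congr rfl fun c hc => by
      rw [dot_congr_left x fun l hl => (hb c (Finset.mem_range.1 hc) l hl).symm]
  exact ⟨h.sub, h.spans, fun y => by rw [e]; exact h.lower y, fun y => by rw [e]; exact h.upper y⟩

-- Rescaled by M/c, the copies of all rows average to the exact norm, and each has sensitivity at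
-- most 2R · 2du/c ≤ 4d · 240d⁴ = 960d⁵ in this normalisation.
open Classical in
theorem card_not_embeds_copies {d R M s q ℓ : ℕ} {a : ℕ → ℕ → ℝ} {ε : ℝ} {copy cn : ℕ → ℕ}
    {u : ℕ → ℝ} (hd : 1 ≤ d) (hne : ∀ r < R, ∃ l < d, a r l ≠ 0) (hε : 0 < ε) (hε1 : ε < 1)
    (hq : 1 ≤ q * ε * ε) (hℓ : 2 ≤ 2 ^ ℓ * ε) (hs : s = 1000000 * d ^ 7 * ℓ * q)
    (hM : M = 2 * R) (hcopy : ∀ z < M, copy z < R)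
    (hcn : ∀ r, cn r = ((Finset.range M).filter fun z => copy z = r).card)
    (hcn1 : ∀ r < R, 1 ≤ cn r ∧ u r * R ≤ cn r * (240 * d ^ 4))
    (hu : ∀ r < R, ∀ x, |dot d (a r) x| ≤ 2 * d * u r * rowNorm d a (Finset.range R) x) :
    20 * (Finset.univ.filter fun Z : Fin s → Fin M => ¬ ∀ x,
      |∑ t, (M : ℝ) / cn (copy (Z t)) * |dot d (a (copy (Z t))) x| -
        s * rowNorm d a (Finset.range R) x| ≤ s * (ε * rowNorm d a (Finset.range R) x)).card ≤
      Fintype.card (Fin s → Fin M) := by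
  have hdot : ∀ (c : ℝ) (r : ℕ) (x : ℕ → ℝ), 0 ≤ c →
      |dot d (fun l => c * a r l) x| = c * |dot d (a r) x| := by
    intro c r x hc
    have : dot d (fun l => c * a r l) x = c * dot d (a r) x := by
      simp only [dot, Finset.mul_sum, mul_assoc]
    rw [this, abs_mul, abs_of_nonneg hc]
  have hc0 : ∀ r, 0 ≤ (M : ℝ) / cn r := fun r => by positivity
  have h := card_not_embeds (d := d) (M := M) (s := s) (q := q) (ℓ := ℓ) (a := a)
    (S := Finset.range R)
    (b := fun z l => (M : ℝ) / cn (copy z) * a (copy z) l) hd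
    (fun i hi => hne i (Finset.mem_range.1 hi)) hε hε1 hq hℓ hs ?_ ?_
  · simp only [hdot _ _ _ (hc0 _)] at h
    rw [Fintype.card_fun, Fintype.card_fin, Fintype.card_fin]
    exact_mod_cast h
  · intro x
    simp only [hdot _ _ _ (hc0 _)]
    rw [← Finset.sum_range (fun z => (M : ℝ) / cn (copy z) * |dot d (a (copy z)) x|),
      ← Finset.sum_fiberwise_of_maps_to (t := Finset.range R) (g := copy)
        (fun z hz => Finset.mem_range.2 (hcopy z (Finset.mem_range.1 hz))), rowNorm, Finset.mul_sum]
    refine Finset.sum_congr rfl fun r hr => ?_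
    rw [Finset.sum_congr rfl fun z hz => by rw [(Finset.mem_filter.1 hz).2], Finset.sum_const,
      ← hcn, nsmul_eq_mul]
    have : (0 : ℝ) < cn r := by exact_mod_cast (hcn1 r (Finset.mem_range.1 hr)).1
    field_simp
  · intro z x
    simp only [hdot _ _ _ (hc0 _)]
    set r := copy z with hr
    have hrR : r < R := hcopy z z.2
    have hN := rowNorm_nonneg d a (Finset.range R) x
    have h1 : (0 : ℝ) < cn r := by exact_mod_cast (hcn1 r hrR).1
    rw [div_mul_eq_mul_div, div_le_iff₀ h1, hM]
    push_cast
    calc 2 * (R : ℝ) * |dot d (a r) x|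
        ≤ 2 * R * (2 * d * u r * rowNorm d a (Finset.range R) x) :=
          mul_le_mul_of_nonneg_left (hu r hrR x) (by positivity)
      _ = 4 * d * rowNorm d a (Finset.range R) x * (u r * R) := by ring
      _ ≤ 4 * d * rowNorm d a (Finset.range R) x * (cn r * (240 * d ^ 4)) :=
          mul_le_mul_of_nonneg_left (hcn1 r hrR).2 (by positivity)
      _ = _ := by ring

namespace RealRAM

attribute [local simp] Cmd.run NExp.eval RExp.eval BExp.holds State.setN State.setR State.storeN
  State.storeR State.advance Function.update_apply

/-! ### The sampling algorithm -/

/-- One tape is fixed for each value of `f`; by `Exec.transfer` every tape with the same value ends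
in the same state. The final state thus becomes a function on a finite set of outcomes, and no
measurability question arises. -/
theorem Runs.exists_final {X : Type*} {f : Tape → X} (hf : Function.Surjective f) {c : Cmd}
    {σ : State} {y m B n : ℕ} {Q : Tape → State → Prop} (hd : c.drawsOnly y = true)
    (hw : c.wnv y = false) (hm : σ.nvar y = m)
    (hag : ∀ ω ω', f ω = f ω' → ∀ p, σ.pos ≤ p → p < σ.pos + n →
      belowOf m (ω p) = belowOf m (ω' p))
    (h : ∀ ω, Runs ω c σ B (fun τ => τ.pos = σ.pos + n ∧ Q ω τ)) :
    ∃ F : X → State, (∀ ω, ∃ t ≤ B, Exec ω c σ t (F (f ω))) ∧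
      ∀ x, ∃ ω, f ω = x ∧ Q ω (F x) ∧ (F x).pos = σ.pos + n ∧ Frame c σ (F x) := by
  choose t τ he ht hp hQ using h
  refine ⟨fun x => τ (Function.surjInv hf x), fun ω => ⟨_, ht _, (he _).transfer hd hw hm ?_⟩,
    fun x => ⟨_, Function.surjInv_eq hf x, hQ _, hp _, (he _).frame⟩⟩
  intro p h1 h2
  exact hag _ _ (Function.surjInv_eq hf _) p h1 (by rwa [← hp])

theorem drawn_surjective (m n : ℕ) : Function.Surjective (drawn m 0 n) := by
  intro b
  choose u hu using fun i : Fin n => exists_belowOf_eq (b i).2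
  refine ⟨fun p => if h : p < n then u ⟨p, h⟩ else 0, funext fun i => Fin.ext ?_⟩
  simp [drawn, hu]

theorem drawnGroups_surjective (m p T : ℕ) {d : ℕ} (hd : 1 ≤ d) :
    Function.Surjective (drawnGroups m p T d) := by
  intro g
  choose u hu using fun (t : Fin T) (k : Fin d) => exists_belowOf_eq (g t k).2
  refine ⟨fun i => if h : (i - p) / d < T then u ⟨(i - p) / d, h⟩ ⟨(i - p) % d, Nat.mod_lt _ hd⟩
    else 0, funext fun t => funext fun k => Fin.ext ?_⟩
  have h1 : (p + ((t : ℕ) * d + k) - p) / d = t := by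
    rw [Nat.add_sub_cancel_left, add_comm, Nat.add_mul_div_right _ _ hd,
      Nat.div_eq_of_lt k.2, zero_add]
  have h2 : (p + ((t : ℕ) * d + k) - p) % d = k := by
    rw [Nat.add_sub_cancel_left, add_comm, Nat.add_mul_mod_self_right, Nat.mod_eq_of_lt k.2]
  simp only [drawnGroups, h1, h2, t.2, dite_true, Fin.eta, hu]

/-- Round the norm on a random set of rows. -/
def roundSample : Cmd := .seq sampleRows (.seq denseRows lewis)

/-- The time bound holds on all tapes, because the cap gives cnt · d² ≤ 20R. The rounding is claimed
only when the cap did not interfere. -/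
theorem roundSample_runs (ω : Tape) {σ : State} {R N d L : ℕ} (hd : σ.nvar 1 = d) (hd1 : 1 ≤ d)
    (hN : σ.nvar 2 = N) (hR : σ.nvar 4 = R) (h7 : σ.nvar 7 = L) (h10 : σ.nvar 10 = d * d)
    (h19 : σ.nvar 19 = 0) (h6 : ∀ i, σ.narr 6 i = 0) (h2 : ∀ i, σ.rarr 2 i = 0) (hpos : σ.pos = 0)
    (hL : R ≤ 2 ^ L) (hcol : ∀ t < N, σ.narr 1 t < d)
    (hne : ∀ r < R, ∃ l < d, rowVec N (σ.narr 5) (σ.narr 1) (σ.rarr 0) r l ≠ 0) :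
    Runs ω roundSample σ (100 * (R + 1) + (100 * (N + 1) + 100 * (R + 1) +
        (L + 2) * (2000 * (20 * R + d * d)))) (fun τ => τ.pos = R ∧
      ∀ S : Finset ℕ, (∀ r, r ∈ S ↔ r < R ∧ belowOf (d * d) (ω r) = 0) →
        S.card * (d * d) ≤ 20 * R →
        IsRounding d (rowVec N (σ.narr 5) (σ.narr 1) (σ.rarr 0)) S (4 * d) (frameOf d τ)
          (activeOf d τ)) := by
  refine (sampleRows_runs ω hR h10 h19 h6 hpos).seq fun τ₁ F₁ h₁ => ?_
  obtain ⟨hp, hsel⟩ := h₁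
  have hcnt : τ₁.nvar 19 ≤ R := by
    refine hsel.cnt_le_card.trans ?_
    calc _ ≤ (Finset.range R).card := Finset.card_filter_le _ _
      _ = R := Finset.card_range R
  have e1 : τ₁.nvar 1 = d := (F₁.nvar 1 rfl).trans hd
  have en1 : τ₁.narr 1 = σ.narr 1 := F₁.narr 1 rfl
  have en5 : τ₁.narr 5 = σ.narr 5 := F₁.narr 5 rfl
  have er0 : τ₁.rarr 0 = σ.rarr 0 := F₁.rarr 0 rfl
  have hden := denseRows_runs ω (σ := τ₁) ((F₁.nvar 2 rfl).trans hN) e1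
    (fun t ht => by rw [en1]; exact hcol t ht)
    (fun i => by rw [show τ₁.rarr 2 = σ.rarr 2 from F₁.rarr 2 rfl]; exact h2 i) hsel.inj
  rw [en1, en5, er0] at hden
  set a := rowVec N (σ.narr 5) (σ.narr 1) (σ.rarr 0) with ha
  refine (hden.mono (B' := 100 * (N + 1) + 100 * (R + 1)) (by omega) fun τ _ h => h).seq
    fun τ₂ F₂ h₂ => ?_
  choose! f hf using hsel.surj
  have hfR : ∀ c < τ₁.nvar 19, f c < R ∧ belowOf (d * d) (ω (f c)) = 0 := fun c hc =>
    hsel.zero (f c) (by rw [hf c hc]; omega)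
  have hdense : ∀ c < τ₁.nvar 19, ∀ l < d, denseOf d τ₂ c l = a (f c) l := by
    intro c hc l hl
    have := h₂.1 (f c) (by rw [hf c hc]; omega) l hl
    rwa [hf c hc, Nat.add_sub_cancel] at this
  have e7 : τ₂.nvar 7 = L := (F₂.nvar 7 rfl).trans ((F₁.nvar 7 rfl).trans h7)
  have hlew := lewis_runs ω (σ := τ₂) ((F₂.nvar 1 rfl).trans e1) hd1 (F₂.nvar 19 rfl)
    (by rw [e7]; exact hcnt.trans hL) h₂.2 (fun c hc => by
      obtain ⟨l, hl, h⟩ := hne _ (hfR c hc).1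
      exact ⟨l, hl, by rw [hdense c hc l hl]; exact h⟩)
  refine hlew.mono ?_ fun τ₃ F₃ h₃ => ⟨?_, fun S hS hcard => ?_⟩
  · rw [e7]
    have h5 := hsel.cnt_le
    refine Nat.mul_le_mul_left _ ?_
    calc 2000 * (d * d) * (τ₁.nvar 19 + 1) = 2000 * (τ₁.nvar 19 * (d * d) + d * d) := by ring
      _ ≤ _ := Nat.mul_le_mul_left _ (by omega)
  · rw [F₃.pos rfl, F₂.pos rfl, hp]
  · have hinj : Set.InjOn f (Finset.range (τ₁.nvar 19)) := by
      intro c hc c' hc' h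
      rw [Finset.coe_range, Set.mem_Iio] at hc hc'
      have h1 := hf c hc
      rw [h, hf c' hc'] at h1
      omega
    have := h₃.image hinj hdense
    convert this using 1
    ext r
    rw [hS, Finset.mem_image]
    constructor
    · rintro ⟨hr, hb⟩
      have hnum : 0 < τ₁.narr 6 r := by
        rcases hsel.all with h | h
        · exfalso
          have : (Finset.range R).filter (fun r => belowOf (d * d) (ω r) = 0) = S := by
            ext r; rw [hS, Finset.mem_filter, Finset.mem_range]
          rw [this] at h
          omega
        · exact h r hr hb
      have hle := hsel.num_le r
      refine ⟨τ₁.narr 6 r - 1, Finset.mem_range.2 (by omega), ?_⟩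
      have h1 := hf (τ₁.narr 6 r - 1) (by omega)
      exact hsel.inj _ _ (by omega) (by omega)
    · rintro ⟨c, hc, rfl⟩
      exact hfR c (Finset.mem_range.1 hc)

/-- Estimate the rows and make copies of them accordingly. -/
def weighRows : Cmd := .seq trials makeCopies

theorem weighRows_runs (ω : Tape) {σ : State} {R N d T : ℕ} (hd : σ.nvar 1 = d) (hd1 : 1 ≤ d)
    (hR : σ.nvar 4 = R) (hR1 : 1 ≤ R) (hN : σ.nvar 2 = N) (h11 : σ.nvar 11 = 2)
    (h12 : σ.nvar 12 = 2 * R) (h21 : σ.nvar 21 = 0) (hT : σ.nvar 22 = T)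
    (hcol : ∀ t < N, σ.narr 1 t < d) (h9 : ∀ i, σ.narr 9 i = 0) (h13 : ∀ i, σ.rarr 13 i = 0) :
    Runs ω weighRows σ ((T + 1) * (300 * (d * d) + 200 * (R + N) + 400) + 200 * (R + 1)) (fun τ =>
      τ.pos = σ.pos + T * d ∧ (∀ r < R, IsEstimate T d (activeOf d σ)
        (fun t k => belowOf 2 (ω (σ.pos + (t * d + k))))
        (fun k => dot d (rowVec N (σ.narr 5) (σ.narr 1) (σ.rarr 0) r) (frameOf d σ k))
        (τ.rarr 13 r)) ∧
      (∀ z < 2 * R, τ.narr 8 z < R) ∧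
      (∀ r, τ.narr 9 r = ((Finset.range (2 * R)).filter fun z => τ.narr 8 z = r).card) ∧
      (∑ r ∈ Finset.range R, τ.rarr 13 r ≤ 240 * d ^ 4 → ∀ r < R,
        1 ≤ τ.narr 9 r ∧ τ.rarr 13 r * R ≤ τ.narr 9 r * (240 * d ^ 4))) := by
  refine (trials_runs ω hd hd1 hR hN h11 hT hcol h13).seq fun τ₁ F₁ h₁ => ?_
  refine (makeCopies_runs ω ((F₁.nvar 4 rfl).trans hR) hR1 ((F₁.nvar 1 rfl).trans hd) hd1
    ((F₁.nvar 12 rfl).trans h12) ((F₁.nvar 21 rfl).trans h21)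
    (fun i => by rw [show τ₁.narr 9 = σ.narr 9 from F₁.narr 9 rfl]; exact h9 i)
    fun r hr => (h₁.2 r hr).nonneg).mono le_rfl fun τ₂ F₂ h₂ => ?_
  have e : τ₂.rarr 13 = τ₁.rarr 13 := F₂.rarr 13 rfl
  rw [e]
  exact ⟨(F₂.pos rfl).trans h₁.1, h₁.2, h₂.1, h₂.2.1, h₂.2.2⟩

/-- Sample the rows. -/
def sampling : Cmd := .seq roundSample (.seq weighRows writeSamples)

/-- The time that `sampling` takes. -/
def samplingTime (R N d L s : ℕ) : ℕ :=
  100 * (R + 1) + (100 * (N + 1) + 100 * (R + 1) + (L + 2) * (2000 * (20 * R + d * d))) +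
    ((L + 6) * (300 * (d * d) + 200 * (R + N) + 400) + 200 * (R + 1) + 100 * (s + 1))

theorem sampling_runs {σ : State} {R N d L s q ℓ : ℕ} {ε : ℝ} {a : ℕ → ℕ → ℝ}
    (ha : a = rowVec N (σ.narr 5) (σ.narr 1) (σ.rarr 0)) (hd : σ.nvar 1 = d)
    (hd1 : 1 ≤ d) (hN : σ.nvar 2 = N) (hR : σ.nvar 4 = R) (hR1 : 1 ≤ R) (h7 : σ.nvar 7 = L)
    (h9 : σ.nvar 9 = s) (h10 : σ.nvar 10 = d * d) (h11 : σ.nvar 11 = 2) (h12 : σ.nvar 12 = 2 * R)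
    (h19 : σ.nvar 19 = 0) (h21 : σ.nvar 21 = 0) (h22 : σ.nvar 22 = L + 5)
    (hn6 : ∀ i, σ.narr 6 i = 0) (hn9 : ∀ i, σ.narr 9 i = 0) (hr2 : ∀ i, σ.rarr 2 i = 0)
    (hr13 : ∀ i, σ.rarr 13 i = 0) (hpos : σ.pos = 0) (hL : R ≤ 2 ^ L)
    (hcol : ∀ t < N, σ.narr 1 t < d) (hne : ∀ r < R, ∃ l < d, a r l ≠ 0)
    (hε : 0 < ε) (hε1 : ε < 1) (hq : 1 ≤ q * ε * ε) (hℓ : 2 ≤ 2 ^ ℓ * ε)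
    (hs : s = 1000000 * d ^ 7 * ℓ * q) (hs1 : 1 ≤ s) :
    ∃ (time : Tape → ℕ) (final : Tape → State),
      (∀ ω, Exec ω sampling σ (time ω) (final ω) ∧ time ω ≤ samplingTime R N d L s ∧
        (final ω).nvar 3 = s ∧
        ∀ t < s, (∃ r < R, (final ω).narr 2 t = σ.narr 4 r) ∧ 0 < (final ω).rarr 1 t) ∧
      tapeMeasure {ω | ¬ ∃ ρ : ℕ → ℕ, (∀ t < s, ρ t < R ∧ (final ω).narr 2 t = σ.narr 4 (ρ t)) ∧
        ∀ x, |∑ t ∈ Finset.range s, (final ω).rarr 1 t * |dot d (a (ρ t)) x| -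
          rowNorm d a (Finset.range R) x| ≤ ε * rowNorm d a (Finset.range R) x} ≤ 1 / 3 := by
  classical
  -- The moduli d² and 2R are written as successors to match the outcome types `Fin (D + 1)` and
  -- `Fin (M + 1)`.
  obtain ⟨D, hD⟩ : ∃ D, d * d = D + 1 := ⟨d * d - 1, by have := Nat.mul_le_mul hd1 hd1; omega⟩
  obtain ⟨M, hM⟩ : ∃ M, 2 * R = M + 1 := ⟨2 * R - 1, by omega⟩
  obtain ⟨FA, hFA, hFA'⟩ := Runs.exists_final (drawn_surjective D R) (c := roundSample) (σ := σ)
    (y := 10) (m := D + 1) (n := R) rfl rfl (h10.trans hD) (fun ω ω' h p _ hp => by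
      rw [hpos, zero_add] at hp
      have := congrArg Fin.val (congrFun h ⟨p, hp⟩)
      simpa [drawn] using this) (fun ω => by
      rw [hpos, zero_add]
      exact roundSample_runs ω hd hd1 hN hR h7 h10 h19 hn6 hr2 hpos hL hcol (by rwa [← ha]))
  have hframe : ∀ b, Frame roundSample σ (FA b) := fun b => by
    obtain ⟨ω, -, -, -, h⟩ := hFA' b; exact h
  have hposA : ∀ b, (FA b).pos = R := fun b => by
    obtain ⟨ω, -, -, h, -⟩ := hFA' b; rw [h, hpos, zero_add]
  have hround : ∀ b, (chosen b).card * (D + 1) ≤ 20 * R →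
      IsRounding d a (chosen b) (4 * d) (frameOf d (FA b)) (activeOf d (FA b)) := by
    intro b hcard
    obtain ⟨ω, rfl, h, -, -⟩ := hFA' b
    rw [ha]
    refine h (chosen _) (fun r => ?_) (by rwa [hD])
    rw [mem_chosen, hD]
    constructor
    · rintro ⟨hr, h0⟩
      have := congrArg Fin.val h0
      exact ⟨hr, by simpa [drawn] using this⟩
    -- The draw 0 is the one that puts a row into the set.
    · rintro ⟨hr, h0⟩
      exact ⟨hr, Fin.ext (by simpa [drawn] using h0)⟩
  have hB : ∀ b, ∃ F : (Fin (L + 5) → Fin d → Fin 2) → State,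
      (∀ ω, ∃ t ≤ (L + 6) * (300 * (d * d) + 200 * (R + N) + 400) + 200 * (R + 1),
        Exec ω weighRows (FA b) t (F (drawnGroups 1 R (L + 5) d ω))) ∧
      ∀ g, Frame weighRows (FA b) (F g) ∧ (F g).pos = R + (L + 5) * d ∧
        (∃ g' : ℕ → ℕ → ℕ, (∀ t k, g' t k ≤ 1) ∧
          (∀ (t : Fin (L + 5)) (k : Fin d), g' t k = g t k) ∧
          ∀ r < R, IsEstimate (L + 5) d (activeOf d (FA b)) g'
            (fun k => dot d (a r) (frameOf d (FA b) k)) ((F g).rarr 13 r)) ∧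
        (∀ z < 2 * R, (F g).narr 8 z < R) ∧
        (∀ r, (F g).narr 9 r =
          ((Finset.range (2 * R)).filter fun z => (F g).narr 8 z = r).card) ∧
        (∑ r ∈ Finset.range R, (F g).rarr 13 r ≤ 240 * d ^ 4 → ∀ r < R,
          1 ≤ (F g).narr 9 r ∧ (F g).rarr 13 r * R ≤ (F g).narr 9 r * (240 * d ^ 4)) := by
    intro b
    have hF := hframe b
    have en1 : (FA b).narr 1 = σ.narr 1 := hF.narr 1 rfl
    have en5 : (FA b).narr 5 = σ.narr 5 := hF.narr 5 rfl
    have er0 : (FA b).rarr 0 = σ.rarr 0 := hF.rarr 0 rfl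
    obtain ⟨F, h1, h2⟩ := Runs.exists_final (drawnGroups_surjective 1 R (L + 5) hd1)
      (c := weighRows) (σ := FA b) (y := 11) (m := 2) (n := (L + 5) * d) rfl rfl
      ((hF.nvar 11 rfl).trans h11) (fun ω ω' h p hp hp' => by
        rw [hposA] at hp hp'
        have h3 : (p - R) / d < L + 5 := (Nat.div_lt_iff_lt_mul hd1).2 (by omega)
        have := congrArg Fin.val (congrFun (congrFun h ⟨(p - R) / d, h3⟩)
          ⟨(p - R) % d, Nat.mod_lt _ hd1⟩)
        simp only [drawnGroups] at this
        rwa [Nat.div_add_mod', Nat.add_sub_cancel' hp] at this)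
      (fun ω => weighRows_runs ω ((hF.nvar 1 rfl).trans hd) hd1 ((hF.nvar 4 rfl).trans hR) hR1
        ((hF.nvar 2 rfl).trans hN) ((hF.nvar 11 rfl).trans h11) ((hF.nvar 12 rfl).trans h12)
        ((hF.nvar 21 rfl).trans h21) ((hF.nvar 22 rfl).trans h22)
        (fun t ht => by rw [en1]; exact hcol t ht)
        (fun i => by rw [show (FA b).narr 9 = σ.narr 9 from hF.narr 9 rfl]; exact hn9 i)
        (fun i => by rw [show (FA b).rarr 13 = σ.rarr 13 from hF.rarr 13 rfl]; exact hr13 i))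
    refine ⟨F, h1, fun g => ?_⟩
    obtain ⟨ω, rfl, ⟨h3, h4, h5, h6⟩, h7, h8⟩ := h2 g
    refine ⟨h8, by rw [h7, hposA], ⟨fun t k => belowOf 2 (ω (R + (t * d + k))), fun t k => ?_,
      fun t k => ?_, ?_⟩, h4, h5, h6⟩
    · exact Nat.lt_succ_iff.1 (belowOf_lt 1 _)
    · simp [drawnGroups]
    · rw [en1, en5, er0, hposA, ← ha] at h3
      exact h3
  choose FB hFB hFB' using hB
  have hC := fun ω => writeSamples_runs ω
    (σ := FB (drawn D 0 R ω) (drawnGroups 1 R (L + 5) d ω)) (s := s) (M := 2 * R)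
    ((((hFB' _ _).1.nvar 9 rfl).trans ((hframe _).nvar 9 rfl)).trans h9)
    ((((hFB' _ _).1.nvar 12 rfl).trans ((hframe _).nvar 12 rfl)).trans h12)
  choose tA htA hEA using hFA
  choose tB htB hEB using fun ω => hFB (drawn D 0 R ω) ω
  choose tC FC hEC htC hpC h3C hspec using hC
  have hposB : ∀ b g, (FB b g).pos = R + (L + 5) * d := fun b g => (hFB' b g).2.1
  have hrow : ∀ b g, (FB b g).narr 4 = σ.narr 4 := fun b g =>
    ((hFB' b g).1.narr 4 rfl).trans ((hframe b).narr 4 rfl)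
  have hcopy : ∀ b g, ∀ z < 2 * R, (FB b g).narr 8 z < R := fun b g => (hFB' b g).2.2.2.1
  have hcn : ∀ b g r, (FB b g).narr 9 r =
      ((Finset.range (2 * R)).filter fun z => (FB b g).narr 8 z = r).card := fun b g =>
    (hFB' b g).2.2.2.2.1
  have hbel : ∀ u, belowOf (2 * R) u < 2 * R := fun u => by rw [hM]; exact belowOf_lt M u
  have hs0 : (0 : ℝ) < s := by exact_mod_cast hs1
  have hpositive : ∀ ω, ∀ t < s, 0 < (FC ω).rarr 1 t := by
    intro ω t ht
    rw [(hspec ω t ht).2]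
    set FF := FB (drawn D 0 R ω) (drawnGroups 1 R (L + 5) d ω) with hFF
    -- A drawn copy is itself counted, so this holds on every tape, even where the estimates are
    -- bad.
    have h1 : 1 ≤ FF.narr 9 (FF.narr 8 (belowOf (2 * R) (ω (FF.pos + t)))) := by
      rw [hcn]
      exact Finset.card_pos.2 ⟨_, Finset.mem_filter.2 ⟨Finset.mem_range.2 (hbel _), rfl⟩⟩
    have h2 : (0 : ℝ) < FF.narr 9 (FF.narr 8 (belowOf (2 * R) (ω (FF.pos + t)))) := by
      exact_mod_cast h1
    have h3 : (0 : ℝ) < (2 * R : ℕ) := by exact_mod_cast (by omega : 0 < 2 * R)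
    positivity
  refine ⟨fun ω => tA ω + (tB ω + tC ω), FC, fun ω =>
    ⟨Exec.seq (hEA ω) (Exec.seq (hEB ω) (hEC ω)),
      by
        have h1 := htA ω
        have h2 := htB ω
        have h3 := htC ω
        change tA ω + (tB ω + tC ω) ≤ _
        unfold samplingTime
        omega, h3C ω, fun t ht =>
      ⟨⟨_, hcopy _ _ _ (hbel _), (hspec ω t ht).1.trans (by rw [hrow])⟩, hpositive ω t ht⟩⟩, ?_⟩
  -- The test vectors depend on the first stage only, hence are fixed before the trials are drawn.
  choose w j hwj using fun (b : Fin R → Fin (D + 1)) (r : ℕ) =>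
    exists_trial_test hd1 (activeOf d (FA b)) (fun k => dot d (a r) (frameOf d (FA b) k))
  refine le_trans (measure_mono ?_) (tapeMeasure_three_stages (R := R) (D := D) (T := L + 5) (d := d)
    (s := s) (M := M)
    (fun b => 20 * R < (chosen b).card * (D + 1) ∨
      80 * (d : ℝ) ^ 3 < ∑ r ∈ Finset.range R, sens d a (insert r (chosen b)) r)
    (fun b g => ∃ r < R, ∀ t, |∑ k, w b r k * ((g t k : ℕ) : ℝ)| < |w b r (j b r)| / 2)
    (fun b g Z => ¬ ∀ x, |∑ t, ((M + 1 : ℕ) : ℝ) / (FB b g).narr 9 ((FB b g).narr 8 (Z t)) *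
      |dot d (a ((FB b g).narr 8 (Z t))) x| - s * rowNorm d a (Finset.range R) x| ≤
        s * (ε * rowNorm d a (Finset.range R) x)) ?_ ?_ ?_)
  · intro ω hω
    rw [Set.mem_ofPred_eq] at hω ⊢
    by_contra hgood
    push Not at hgood
    refine hω ⟨fun t => (FB (drawn D 0 R ω) (drawnGroups 1 R (L + 5) d ω)).narr 8 (belowOf (2 * R)
      (ω (R + (L + 5) * d + t))), fun t ht => ⟨hcopy _ _ _ (hbel _), ?_⟩, fun x => ?_⟩
    · rw [(hspec ω t ht).1, hrow, hposB]
    · have h := hgood.2.2 x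
      set FF := FB (drawn D 0 R ω) (drawnGroups 1 R (L + 5) d ω) with hFF
      have e : ∑ t : Fin s, ((M + 1 : ℕ) : ℝ) / FF.narr 9 (FF.narr 8 (drawn M (R + (L + 5) * d) s ω t)) *
          |dot d (a (FF.narr 8 (drawn M (R + (L + 5) * d) s ω t))) x| =
          s * ∑ t ∈ Finset.range s, (FC ω).rarr 1 t *
            |dot d (a (FF.narr 8 (belowOf (2 * R) (ω (R + (L + 5) * d + t))))) x| := by
        rw [Finset.sum_range, Finset.mul_sum]
        refine Finset.sum_congr rfl fun t _ => ?_
        rw [(hspec ω t t.2).2, hposB]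
        simp only [drawn, ← hM, ← hFF]
        rw [← mul_assoc]
        congr 1
        rw [← div_div, div_right_comm, mul_div_cancel₀ _ hs0.ne']
      rw [e, ← mul_sub, abs_mul, abs_of_pos hs0] at h
      exact le_of_mul_le_mul_left h hs0
  · convert card_bad_choice hR1 hd1 hD.symm hne
  · intro b _
    convert card_bad_trials (R := R) (T := L + 5) (w b) (j b) (by rw [pow_add]; omega)
  · intro b g h1 h2
    push Not at h1 h2
    have hr := hround b h1.1
    have hS : chosen b ⊆ Finset.range R := fun r hr =>
      Finset.mem_range.2 (mem_chosen.1 hr).1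
    obtain ⟨-, -, ⟨g', hg1, hg2, hest⟩, -, -, hgood⟩ := hFB' b g
    have hsum : ∑ r ∈ Finset.range R, (FB b g).rarr 13 r ≤ 240 * d ^ 4 := by
      calc ∑ r ∈ Finset.range R, (FB b g).rarr 13 r
          ≤ ∑ r ∈ Finset.range R, 3 * d * sens d a (insert r (chosen b)) r :=
            Finset.sum_le_sum fun r hr' =>
              (hest r (Finset.mem_range.1 hr')).le_sens hg1 hr hd1
        _ = 3 * d * ∑ r ∈ Finset.range R, sens d a (insert r (chosen b)) r := by
            rw [Finset.mul_sum]
        _ ≤ 3 * d * (80 * d ^ 3) := mul_le_mul_of_nonneg_left h1.2 (by positivity)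
        _ = _ := by ring
    -- A row with estimate 1 satisfies this trivially, since no row exceeds the whole norm;
    -- otherwise the rounding applies.
    have hle : ∀ r < R, ∀ x, |dot d (a r) x| ≤
        2 * d * (FB b g).rarr 13 r * rowNorm d a (Finset.range R) x := by
      intro r hrR x
      rcases hwj b r (L + 5) g' g _ hg2 (hest r hrR) (by
        intro h; obtain ⟨t, ht⟩ := h2 r hrR; exact absurd (h t) (not_lt.2 ht)) with h3 | ⟨h3, h4⟩
      · rw [h3]
        have h5 := abs_dot_le_rowNorm d a (Finset.mem_range.2 hrR) x
        have h6 : (1 : ℝ) ≤ d := by exact_mod_cast hd1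
        have h7 := rowNorm_nonneg d a (Finset.range R) x
        nlinarith
      · exact hr.abs_dot_le hS (hest r hrR).nonneg h3 h4 x
    convert card_not_embeds_copies (M := M + 1) (R := R) (copy := (FB b g).narr 8)
      (cn := (FB b g).narr 9) hd1 hne hε hε1 hq hℓ hs hM.symm (by rw [← hM]; exact hcopy b g)
      (by rw [← hM]; exact hcn b g) (hgood hsum) hle

end RealRAM

open RealRAM

/-! ### Input and output -/

theorem l1Norm_eq {m : ℕ} (v : Fin m → ℝ) : l1Norm v = ∑ i, |v i| := by
  simp [l1Norm, PiLp.norm_eq_of_L1]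

/-- A vector as a function on the natural numbers. -/
def extendVec {d : ℕ} (x : Fin d → ℝ) (l : ℕ) : ℝ := if h : l < d then x ⟨l, h⟩ else 0

theorem dot_extendVec {d : ℕ} (a : ℕ → ℝ) (x : Fin d → ℝ) :
    dot d a (extendVec x) = ∑ l : Fin d, a l * x l := by
  simp [dot, Finset.sum_range, extendVec]

section input

variable {n d : ℕ} {A : Matrix (Fin n) (Fin d) ℝ} {e : Fin (nnz A) ≃ SupportPos A} {ε : ℝ}
  {R : ℕ} {rowOf rid : ℕ → ℕ}

theorem inputState_row {t : ℕ} (h : t < nnz A) :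
    (inputState A e ε).narr 0 t = (e ⟨t, h⟩).1.1 := by simp [inputState, h]

theorem inputState_col {t : ℕ} (h : t < nnz A) :
    (inputState A e ε).narr 1 t = (e ⟨t, h⟩).1.2 := by simp [inputState, h]

theorem inputState_val {t : ℕ} (h : t < nnz A) :
    (inputState A e ε).rarr 0 t = A (e ⟨t, h⟩).1.1 (e ⟨t, h⟩).1.2 := by simp [inputState, h]

theorem inputState_narr {a : ℕ} (ha : 2 ≤ a) (t : ℕ) : (inputState A e ε).narr a t = 0 := by
  simp [inputState, show a ≠ 0 by omega, show a ≠ 1 by omega]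

theorem inputState_rarr {a : ℕ} (ha : 1 ≤ a) (t : ℕ) : (inputState A e ε).rarr a t = 0 := by
  simp [inputState, show a ≠ 0 by omega]

theorem RealRAM.IsNumbering.rowOf_lt
    (h : IsNumbering (nnz A) ((inputState A e ε).narr 0) R rowOf rid)
    {r : ℕ} (hr : r < R) : rowOf r < n := by
  obtain ⟨t, ht, rfl⟩ := h.surj r hr
  rw [h.rowOf_rid t ht, inputState_row ht]
  exact (e ⟨t, ht⟩).1.1.2

/-- Exactly one entry of the list sits at a nonzero position, and none at a zero position. -/
theorem RealRAM.IsNumbering.rowVec_eq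
    (h : IsNumbering (nnz A) ((inputState A e ε).narr 0) R rowOf rid)
    {r : ℕ} (hr : r < R) (l : Fin d) :
    rowVec (nnz A) rid ((inputState A e ε).narr 1) ((inputState A e ε).rarr 0) r l =
      A ⟨rowOf r, h.rowOf_lt hr⟩ l := by
  have hcond : ∀ t : Fin (nnz A), (if rid t = r ∧ (inputState A e ε).narr 1 t = l then
      (inputState A e ε).rarr 0 t else 0) =
      if (e t).1 = (⟨rowOf r, h.rowOf_lt hr⟩, l) then A (e t).1.1 (e t).1.2 else 0 := by
    intro t
    rw [inputState_col t.2, inputState_val t.2]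
    refine if_congr ?_ rfl rfl
    rw [Prod.ext_iff, Fin.ext_iff, Fin.ext_iff]
    refine and_congr ?_ Iff.rfl
    have h1 := h.rowOf_rid t t.2
    rw [inputState_row t.2] at h1
    simp only [Fin.eta] at h1 ⊢
    rw [← h1]
    exact ⟨fun h2 => by rw [h2], fun h2 => h.inj _ (h.lt t t.2) _ hr h2⟩
  rw [rowVec, Finset.sum_range, Finset.sum_congr rfl fun t _ => hcond t]
  by_cases h0 : A ⟨rowOf r, h.rowOf_lt hr⟩ l = 0
  · rw [h0]
    refine Finset.sum_eq_zero fun t _ => ?_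
    split_ifs with h1
    · rw [h1]; exact h0
    · rfl
  · rw [Finset.sum_eq_single (e.symm ⟨(⟨rowOf r, h.rowOf_lt hr⟩, l), h0⟩)]
    · simp
    · intro t _ ht
      rw [if_neg]
      intro h1
      exact ht ((Equiv.eq_symm_apply e).2 (Subtype.ext h1))
    · intro h1; exact absurd (Finset.mem_univ _) h1

theorem RealRAM.IsNumbering.exists_ne_zero
    (h : IsNumbering (nnz A) ((inputState A e ε).narr 0) R rowOf rid) {r : ℕ} (hr : r < R) :
    ∃ l < d, rowVec (nnz A) rid ((inputState A e ε).narr 1) ((inputState A e ε).rarr 0) r l ≠ 0 := by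
  obtain ⟨t, ht, rfl⟩ := h.surj r hr
  refine ⟨(e ⟨t, ht⟩).1.2, (e ⟨t, ht⟩).1.2.2, ?_⟩
  rw [h.rowVec_eq hr]
  have h1 := h.rowOf_rid t ht
  rw [inputState_row ht] at h1
  simp only [h1, Fin.eta]
  exact (e ⟨t, ht⟩).2

theorem RealRAM.IsNumbering.mulVec_eq
    (h : IsNumbering (nnz A) ((inputState A e ε).narr 0) R rowOf rid)
    {r : ℕ} (hr : r < R) (x : Fin d → ℝ) : A.mulVec x ⟨rowOf r, h.rowOf_lt hr⟩ =
      dot d (rowVec (nnz A) rid ((inputState A e ε).narr 1) ((inputState A e ε).rarr 0) r)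
        (extendVec x) := by
  rw [dot_extendVec, Matrix.mulVec, dotProduct]
  exact Finset.sum_congr rfl fun l _ => by rw [h.rowVec_eq hr]

/-- The rows that were not numbered are zero. -/
theorem RealRAM.IsNumbering.l1Norm_mulVec
    (h : IsNumbering (nnz A) ((inputState A e ε).narr 0) R rowOf rid) (x : Fin d → ℝ) :
    l1Norm (A.mulVec x) = rowNorm d
      (rowVec (nnz A) rid ((inputState A e ε).narr 1) ((inputState A e ε).rarr 0))
      (Finset.range R) (extendVec x) := by
  rw [l1Norm_eq, rowNorm, Finset.sum_range]
  symm
  refine Fintype.sum_of_injective (fun r : Fin R => (⟨rowOf r, h.rowOf_lt r.2⟩ : Fin n)) ?_ _ _ ?_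
    fun r => by rw [h.mulVec_eq r.2]
  · intro r r' hrr
    exact Fin.ext (h.inj r r.2 r' r'.2 (by simpa using hrr))
  · intro i hi
    rw [abs_eq_zero, Matrix.mulVec, dotProduct]
    refine Finset.sum_eq_zero fun l _ => ?_
    by_contra h0
    have hA : A i l ≠ 0 := left_ne_zero_of_mul h0
    refine hi ⟨⟨rid (e.symm ⟨(i, l), hA⟩), h.lt _ (e.symm ⟨(i, l), hA⟩).2⟩, Fin.ext ?_⟩
    have h1 := h.rowOf_rid (e.symm ⟨(i, l), hA⟩) (e.symm ⟨(i, l), hA⟩).2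
    rw [inputState_row (e.symm ⟨(i, l), hA⟩).2] at h1
    simpa using h1

theorem isSamplingMatrix_outputMatrix {τ : State}
    (h : ∀ t < outputRows τ, τ.narr 2 t < n ∧ τ.rarr 1 t ≠ 0) :
    IsSamplingMatrix (outputMatrix n τ) := by
  intro t
  obtain ⟨h1, h2⟩ := h t t.2
  refine ⟨⟨τ.narr 2 t, h1⟩, by simpa [outputMatrix] using h2, fun i hi => Fin.ext ?_⟩
  by_contra hne
  exact hi (by simp only [outputMatrix, if_neg hne])

theorem RealRAM.IsNumbering.embedsL1
    (h : IsNumbering (nnz A) ((inputState A e ε).narr 0) R rowOf rid)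
    {τ : State} {ρ : ℕ → ℕ} {s : ℕ} (hs : τ.nvar 3 = s)
    (hρ : ∀ t < s, ρ t < R ∧ τ.narr 2 t = rowOf (ρ t)) (hpos : ∀ t < s, 0 < τ.rarr 1 t)
    (hx : ∀ x, |∑ t ∈ Finset.range s, τ.rarr 1 t * |dot d (rowVec (nnz A) rid
        ((inputState A e ε).narr 1) ((inputState A e ε).rarr 0) (ρ t)) x| -
      rowNorm d (rowVec (nnz A) rid ((inputState A e ε).narr 1) ((inputState A e ε).rarr 0))
        (Finset.range R) x| ≤
      ε * rowNorm d (rowVec (nnz A) rid ((inputState A e ε).narr 1) ((inputState A e ε).rarr 0))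
        (Finset.range R) x) :
    EmbedsL1 (outputMatrix n τ) A ε := by
  intro x
  subst hs
  have h1 : l1Norm ((outputMatrix n τ).mulVec (A.mulVec x)) = ∑ t ∈ Finset.range (τ.nvar 3),
      τ.rarr 1 t * |dot d (rowVec (nnz A) rid
        ((inputState A e ε).narr 1) ((inputState A e ε).rarr 0) (ρ t)) (extendVec x)| := by
    rw [l1Norm_eq, Finset.sum_range]
    refine Finset.sum_congr rfl fun (t : Fin (outputRows τ)) _ => ?_
    rw [← h.mulVec_eq (hρ t t.2).1, ← abs_of_pos (hpos t t.2), ← abs_mul]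
    refine congrArg abs ?_
    rw [Matrix.mulVec, dotProduct, Finset.sum_eq_single ⟨rowOf (ρ t), h.rowOf_lt (hρ t t.2).1⟩]
    · simp [outputMatrix, (hρ t t.2).2]
    · intro i _ hi
      rw [outputMatrix, if_neg, zero_mul]
      intro h2
      exact hi (Fin.ext (h2.trans (hρ t t.2).2))
    · intro h2; exact absurd (Finset.mem_univ _) h2
  have h2 := abs_le.1 (hx (extendVec x))
  rw [← h1, ← h.l1Norm_mulVec] at h2
  constructor <;> linarith [h2.1, h2.2]

theorem nnz_pos (hd : 1 ≤ d) (hA : A.rank = d) : 1 ≤ nnz A := by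
  by_contra h0
  have h1 : nnz A = 0 := by omega
  have h2 : A = 0 := by
    ext i l
    by_contra h3
    have : IsEmpty (SupportPos A) := by
      rcases Nat.card_eq_zero.1 h1 with h | h
      · exact h
      · exact absurd h (not_infinite_iff_finite.2 inferInstance)
    exact this.false ⟨(i, l), h3⟩
  rw [h2, Matrix.rank_zero] at hA
  omega

end input

/-! ### The bounds -/

theorem half_lt_log_two : 1 / 2 < Real.log 2 := by
  have := Real.log_two_gt_d9
  linarith

/-- For n ≥ 2 one has 2n + 1 ≤ n³, and log 2 > 1/2 doubles the factor 3. -/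
theorem exponent_le_log {L n : ℕ} (hn : 2 ≤ n) (hL : 2 ^ L ≤ 2 * n + 1) :
    (L : ℝ) ≤ 6 * Real.log n := by
  have h1 : 2 ^ L ≤ n ^ 3 := by nlinarith [Nat.mul_le_mul hn hn]
  have h2 : ((2 : ℝ) ^ L) ≤ (n : ℝ) ^ 3 := by exact_mod_cast h1
  have h3 := Real.log_le_log (by positivity) h2
  rw [Real.log_pow, Real.log_pow] at h3
  have := half_lt_log_two
  push_cast at h3
  nlinarith [(Nat.cast_nonneg L : (0 : ℝ) ≤ L)]

/-- Minimality gives q ≤ 2/ε² and ℓ ≤ 4 log(2/ε); the product of the constants is 8 · 1000000. -/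
theorem samples_le {d q ℓ s : ℕ} {ε : ℝ} (hε : 0 < ε) (hε1 : ε < 1)
    (hq : ((q : ℝ) - 1) * ε * ε < 1) (hℓ : 2 ^ ℓ * ε < 4) (hs : s = 1000000 * d ^ 7 * ℓ * q) :
    (s : ℝ) ≤ 8000000 * (d : ℝ) ^ 7 * (Real.log (2 / ε) / ε ^ 2) := by
  have h1 : (q : ℝ) ≤ 2 / ε ^ 2 := by
    rw [le_div_iff₀ (by positivity)]
    nlinarith
  have h2 : (ℓ : ℝ) ≤ 4 * Real.log (2 / ε) := by
    have h3 : (2 : ℝ) ^ ℓ ≤ 2 * (2 / ε) := by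
      rw [← mul_div_assoc, le_div_iff₀ hε]; linarith
    have h4 := Real.log_le_log (by positivity) h3
    rw [Real.log_pow, Real.log_mul (by norm_num) (by positivity)] at h4
    have h5 : Real.log 2 ≤ Real.log (2 / ε) :=
      Real.log_le_log (by norm_num) (by rw [le_div_iff₀ hε]; linarith)
    have := half_lt_log_two
    nlinarith [(Nat.cast_nonneg ℓ : (0 : ℝ) ≤ ℓ)]
  have h6 : (0 : ℝ) ≤ Real.log (2 / ε) := by
    have := (Nat.cast_nonneg ℓ : (0 : ℝ) ≤ ℓ); linarith
  rw [hs]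
  push_cast
  calc 1000000 * (d : ℝ) ^ 7 * ℓ * q ≤ 1000000 * (d : ℝ) ^ 7 * (4 * Real.log (2 / ε)) * (2 / ε ^ 2) := by
        gcongr
    _ = _ := by ring

/-- Sampling is used only if s ≤ N, and then d² ≤ N absorbs every cost that depends on d. -/
theorem samplingTime_le {R N d L s : ℕ} (hR : R ≤ N) (hs : s ≤ N) (hd : d * d ≤ N) (hN : 1 ≤ N) :
    500 * (N + 1) + (5 + samplingTime R N d L s) ≤ 60000 * ((L + 6) * N) := by
  unfold samplingTime
  have h1 : (L + 2) * (2000 * (20 * R + d * d)) ≤ (L + 6) * (42000 * N) :=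
    Nat.mul_le_mul (by omega) (by omega)
  have h2 : (L + 6) * (300 * (d * d) + 200 * (R + N) + 400) ≤ (L + 6) * (1100 * N) :=
    Nat.mul_le_mul_left _ (by omega)
  have h3 : 6 * N ≤ (L + 6) * N := Nat.mul_le_mul_right _ (by omega)
  rw [show (L + 6) * (42000 * N) = 42000 * ((L + 6) * N) by ring] at h1
  rw [show (L + 6) * (1100 * N) = 1100 * ((L + 6) * N) by ring] at h2
  omega

/-! ### The theorem. -/

theorem theorem3 :
    ∃ (P : RealRAM.Cmd) (C : ℝ) (k : ℕ),
      ∀ (n d : ℕ) (A : Matrix (Fin n) (Fin d) ℝ) (ε : ℝ),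
        2 ≤ n → 1 ≤ d → A.rank = d → 0 < ε → ε < 1 →
        ∀ e : Fin (nnz A) ≃ SupportPos A,
          ∃ (time : RealRAM.Tape → ℕ) (final : RealRAM.Tape → RealRAM.State),
            (∀ ω : RealRAM.Tape,
              RealRAM.Exec ω P (inputState A e ε) (time ω) (final ω) ∧
              (time ω : ℝ) ≤ C * ((nnz A : ℝ) * Real.log n) ∧
              IsSamplingMatrix (outputMatrix n (final ω)) ∧
              (outputRows (final ω) : ℝ) ≤ C * (d : ℝ) ^ k * (Real.log (2 / ε) / ε ^ 2)) ∧
            RealRAM.tapeMeasure {ω : RealRAM.Tape | ¬ EmbedsL1 (outputMatrix n (final ω)) A ε}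
              ≤ 1 / 3 := by
  refine ⟨.seq prepare (.ite (.nlt (.var 2) (.var 9)) writeAll sampling), 8000000, 7, ?_⟩
  intro n d A ε hn hd hA hε hε1 e
  have hN1 : 1 ≤ nnz A := nnz_pos hd hA
  obtain ⟨t₀, σ, hex, ht₀, hprep⟩ := prepare_runs (fun _ => 0) (σ := inputState A e ε) (d := d)
    (N := nnz A) (ε := ε) (by simp [inputState]) (by simp [inputState]) (by simp [inputState])
    (fun i => inputState_narr (by norm_num) i) (by simp [inputState]) hε1
  have hpos : σ.pos = 0 := hprep.frame.pos rfl
  have hexec : ∀ ω, Exec ω prepare (inputState A e ε) t₀ σ := fun ω =>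
    -- The preparation draws nothing, so its run is the same on all tapes; the variable and the
    -- modulus are arbitrary.
    hex.transfer (y := 99) (m := 0) rfl rfl (by simp [inputState]) fun p hp hp' => by omega
  have hvar2 : σ.nvar 2 = nnz A := (hprep.frame.nvar 2 rfl).trans (by simp [inputState])
  have hvar1 : σ.nvar 1 = d := (hprep.frame.nvar 1 rfl).trans (by simp [inputState])
  have hnum := hprep.num
  have e1 : σ.narr 1 = (inputState A e ε).narr 1 := hprep.frame.narr 1 rfl
  have e0 : σ.rarr 0 = (inputState A e ε).rarr 0 := hprep.frame.rarr 0 rfl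
  set R := σ.nvar 4 with hR
  set s := σ.nvar 9 with hs
  have hRN : R ≤ nnz A := hnum.le
  have hR1 : 1 ≤ R := by have := hnum.lt 0 hN1; omega
  have hsle := samples_le hε hε1 hprep.q_lt hprep.l_lt hprep.samples
  have hlog : 1 / 2 < Real.log n := half_lt_log_two.trans_le
    (Real.log_le_log (by norm_num) (by exact_mod_cast hn))
  have hNR : (1 : ℝ) ≤ nnz A := by exact_mod_cast hN1
  -- In the first case all nonempty rows are output with weight 1: there is no error, and their
  -- number is at most nnz(A) < s.
  by_cases hbig : nnz A < s
  · have hrun := fun ω => writeAll_runs ω (σ := σ) (R := R) rfl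
    choose t τ hE ht h3 hspec using hrun
    refine ⟨fun ω => t₀ + ((BExp.nlt (.var 2) (.var 9)).cost + 1 + t ω), τ,
      fun ω => ⟨Exec.seq (hexec ω) (Exec.iteTrue ?_ (hE ω)), ?_, ?_, ?_⟩, ?_⟩
    · simpa [BExp.holds, NExp.eval, hvar2] using hbig
    · have h1 : t₀ + ((BExp.nlt (.var 2) (.var 9)).cost + 1 + t ω) ≤ 2000 * nnz A := by
        have := ht ω
        simp only [BExp.cost, NExp.cost]
        omega
      have h2 : ((t₀ + ((BExp.nlt (.var 2) (.var 9)).cost + 1 + t ω) : ℕ) : ℝ) ≤ 2000 * nnz A := by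
        exact_mod_cast h1
      nlinarith
    · refine isSamplingMatrix_outputMatrix fun t ht => ?_
      rw [outputRows, h3] at ht
      obtain ⟨h4, h5⟩ := hspec ω t ht
      rw [h4, h5]
      exact ⟨hnum.rowOf_lt ht, one_ne_zero⟩
    · refine le_trans ?_ hsle
      rw [outputRows, h3]
      exact_mod_cast (by omega : R ≤ s)
    · have : {ω : Tape | ¬ EmbedsL1 (outputMatrix n (τ ω)) A ε} = ∅ := by
        refine Set.eq_empty_of_forall_notMem fun ω hω => hω ?_
        refine hnum.embedsL1 (ρ := id) (h3 ω) (fun t ht => ⟨ht, (hspec ω t ht).1⟩)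
          (fun t ht => by rw [(hspec ω t ht).2]; exact one_pos) fun x => ?_
        rw [Finset.sum_congr rfl fun t ht => by
          rw [(hspec ω t (Finset.mem_range.1 ht)).2, one_mul]]
        simp only [id, rowNorm, sub_self, abs_zero]
        exact mul_nonneg hε.le (Finset.sum_nonneg fun _ _ => abs_nonneg _)
      rw [this, measure_empty]
      exact zero_le
  · have hsN : s ≤ nnz A := not_lt.1 hbig
    -- The factors of `s` are positive, so each of them is at most s ≤ nnz(A); hence the searches
    -- for `q` and `ℓ` ended before their cutoff.
    have hq1 : 1 ≤ σ.nvar 5 := by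
      by_contra h0
      have h1 := hprep.one_le_q (by omega)
      rw [show σ.nvar 5 = 0 by omega] at h1
      norm_num at h1
    have hl1 : 1 ≤ σ.nvar 6 := by
      by_contra h0
      have h1 := hprep.two_le_l (by omega)
      rw [show σ.nvar 6 = 0 by omega] at h1
      norm_num at h1
      linarith
    have hd7 : d * d ≤ d ^ 7 := by
      calc d * d = d ^ 2 := by ring
        _ ≤ d ^ 7 := Nat.pow_le_pow_right hd (by norm_num)
    have hs' : s = 1000000 * d ^ 7 * σ.nvar 6 * σ.nvar 5 := hprep.samples
    have hd71 : 1 ≤ d ^ 7 := Nat.one_le_pow _ _ hd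
    have hqs : σ.nvar 5 ≤ s := by
      rw [hs']
      exact Nat.le_mul_of_pos_left _ (by positivity)
    have hls : σ.nvar 6 ≤ s := by
      rw [hs', mul_right_comm]
      exact Nat.le_mul_of_pos_left _ (by positivity)
    have hds : d * d ≤ s := by
      rw [hs']
      calc d * d ≤ d ^ 7 := hd7
        _ ≤ d ^ 7 * (1000000 * σ.nvar 6 * σ.nvar 5) := Nat.le_mul_of_pos_right _ (by positivity)
        _ = _ := by ring
    have hnarr : ∀ a, 2 ≤ a → prepare.wna a = false → ∀ i, σ.narr a i = 0 := fun a h1 h2 i => by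
      rw [hprep.frame.narr a h2]; exact inputState_narr h1 i
    have hrarr : ∀ a, 1 ≤ a → prepare.wra a = false → ∀ i, σ.rarr a i = 0 := fun a h1 h2 i => by
      rw [hprep.frame.rarr a h2]; exact inputState_rarr h1 i
    obtain ⟨t, τ, hrun, hprob⟩ := sampling_runs (σ := σ) rfl hvar1 hd hvar2 hR.symm hR1 rfl rfl
      hprep.mod₁ hprep.mod₂ hprep.mod₃ ((hprep.frame.nvar 19 rfl).trans (by simp [inputState]))
      ((hprep.frame.nvar 21 rfl).trans (by simp [inputState])) hprep.trials
      (hnarr 6 (by norm_num) rfl) (hnarr 9 (by norm_num) rfl) (hrarr 2 (by norm_num) rfl)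
      (hrarr 13 (by norm_num) rfl) hpos hprep.rows_le
      (fun t ht => by rw [e1, inputState_col ht]; exact (e ⟨t, ht⟩).1.2.2)
      (fun r hr => by rw [e1, e0]; exact hnum.exists_ne_zero hr)
      hε hε1 (hprep.one_le_q (hqs.trans hsN)) (hprep.two_le_l (hls.trans hsN)) hprep.samples
      (hq1.trans hqs)
    refine ⟨fun ω => t₀ + ((BExp.nlt (.var 2) (.var 9)).cost + 1 + t ω), τ,
      fun ω => ⟨Exec.seq (hexec ω) (Exec.iteFalse ?_ (hrun ω).1), ?_, ?_, ?_⟩, ?_⟩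
    · simpa [BExp.holds, NExp.eval, hvar2] using hsN
    · have h1 : t₀ + ((BExp.nlt (.var 2) (.var 9)).cost + 1 + t ω) ≤
          60000 * ((σ.nvar 7 + 6) * nnz A) := by
        refine le_trans ?_ (samplingTime_le (L := σ.nvar 7) hRN hsN (hds.trans hsN) hN1)
        have : t ω ≤ samplingTime R (nnz A) d (σ.nvar 7) s := (hrun ω).2.1
        simp only [BExp.cost, NExp.cost]
        omega
      have h2 : ((t₀ + ((BExp.nlt (.var 2) (.var 9)).cost + 1 + t ω) : ℕ) : ℝ) ≤
          60000 * (((σ.nvar 7 : ℝ) + 6) * nnz A) := by exact_mod_cast h1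
      have hRn : R ≤ n := by
        have := Fintype.card_le_of_injective
          (fun r : Fin R => (⟨σ.narr 4 r, hnum.rowOf_lt r.2⟩ : Fin n))
          fun r r' h => Fin.ext (hnum.inj r r.2 r' r'.2 (by simpa using h))
        simpa using this
      have h3 := exponent_le_log hn (hprep.le_rows.trans (by omega : 2 * R + 1 ≤ 2 * n + 1))
      -- The exponent is at most 6 log n, and 6 ≤ 12 log n because log n > 1/2.
      have h4 : ((σ.nvar 7 : ℝ) + 6) * nnz A ≤ (18 * Real.log n) * nnz A :=
        mul_le_mul_of_nonneg_right (by linarith) (by linarith)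
      nlinarith
    · refine isSamplingMatrix_outputMatrix fun i hi => ?_
      rw [outputRows, (hrun ω).2.2.1] at hi
      obtain ⟨⟨r, hr, h5⟩, h6⟩ := (hrun ω).2.2.2 i hi
      exact ⟨by rw [h5]; exact hnum.rowOf_lt hr, h6.ne'⟩
    · rw [outputRows, (hrun ω).2.2.1]
      exact hsle
    · refine le_trans (measure_mono fun ω hω => ?_) hprob
      rw [Set.mem_ofPred_eq] at hω ⊢
      rintro ⟨ρ, h5, h6⟩
      apply hω
      rw [e1, e0] at h6
      exact hnum.embedsL1 (hrun ω).2.2.1 h5 (fun i hi => ((hrun ω).2.2.2 i hi).2) h6
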